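/- Let $n,d\ge 1$ be integers, $v$ an indeterminate and $\mathcal A=\mathbb Z[v,v^{-1}]$. **The algebra $\mathbf{MU}$.** The mirabolic quantum group $\mathbf{MU}$ is the associative unital $\mathbb Q(v)$-algebra with generators $L$, $E_i,F_i$ $(1\le i\le n-1)$ and $H_a^{\pm}=H_a^{\pm1}$ $(1\le a\le n)$, and the relations (for all admissible indices) $$H_aH_a^{-1}=H_a^{-1}H_a=1,\quad H_aH_b=H_bH_a,\quad H_aL=LH_a,\quad L^2=L,$$ $$E_i^2E_j+E_jE_i^2=(v+v^{-1})E_iE_jE_i,\quad F_i^2F_j+F_jF_i^2=(v+v^{-1})F_iF_jF_i\qquad(|i-j|=1),$$ $$E_iE_j=E_jE_i,\quad F_iF_j=F_jF_i\qquad(|i-j|>1),$$ $$H_aE_i=v^{\delta_{a,i}-\delta_{a,i+1}}E_iH_a,\quad H_aF_i=v^{-\delta_{a,i}+\delta_{a,i+1}}F_iH_a,\quad E_iF_j-F_jE_i=\delta_{ij}\frac{H_iH_{i+1}^{-1}-H_i^{-1}H_{i+1}}{v-v^{-1}},$$ $$LE_i=LE_iL,\qquad F_iL=LF_iL,$$ $$(v+v^{-1})E_iLE_i=v^{-1}E_i^2L+vLE_i^2,\qquad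 (v+v^{-1})F_iLF_i=vF_i^2L+v^{-1}LF_i^2.$$ **The algebra $\mathcal{MS}_{n,d}$.** For a prime power $q$ let $V=\mathbb F_q^d$ and let $\mathscr X$ be the set of flags $0=V_0\subseteq V_1\subseteq\cdots\subseteq V_n=V$. Let $\Xi_{n|n,d}$ be the set of pairs $(A,\Delta)$, where $A=(a_{ij})$ is an $n\times n$ matrix over $\mathbb N$ with $\sum a_{ij}=d$ and $\Delta=\{(i_1,j_1),\dots,(i_k,j_k)\}$ with $i_1<\dots<i_k$, $j_1>\dots>j_k$, is a (possibly empty) set of positions with $a_{ij}>0$ for $(i,j)\in\Delta$. The $GL_d(\mathbb F_q)$-orbit $\mathcal O_{A,\Delta}\subseteq\mathscr X\times\mathscr X\times V$ consists of the triples $(V_\bullet,V'_\bullet,\omega)$ for which $V$ has a basis $b_{ijk}$ $(1\le k\le a_{ij})$ such that $V_s=\langle b_{ijk}: i\le s\rangle$, $V'_t=\langle b_{ijk}: j\le t\rangle$ and $\omega=\sum_{(i,j)\in\Delta}b_{ij1}$; let $e_{A,\Delta}$ be its characteristic function. $\mathcal{MS}_{n,d}$ is the $\mathcal A$-algebra of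 $GL_d$-invariant $\mathcal A$-valued functions on $\mathscr X\times\mathscr X\times V$, with basis $\{e_{A,\Delta}\}_{(A,\Delta)\in\Xi_{n|n,d}}$, whose product specializes at $v=\sqrt q$, for every prime power $q$, to the convolution $$(g*h)(f,f',\omega)=\sum_{f''\in\mathscr X,\ \mu\in V}g(f,f'',\mu)\,h(f'',f',\omega-\mu).$$ Put $[A]_\Delta=v^{-d(A,\Delta)+r(A,\Delta)}e_{A,\Delta}$, where $$d(A,\Delta)=\sum_{i<k\text{ or }j<l}a_{ij}a_{kl}+\sum_{(i,j)}a_{ij},\qquad r(A,\Delta)=\sum_{i<k}a_{ij}a_{kl},$$ the second sum in $d(A,\Delta)$ being over the positions $(i,j)$ such that $i\le k$ and $j\le l$ for some $(k,l)\in\Delta$. Define elements of $\mathcal{MS}_{n,d}$ by $$E_i=\sum_B[B]_\emptyset,\quad F_i=\sum_C[C]_\emptyset,\quad H_a^{\pm}=\sum_D v^{\pm d_{aa}}[D]_\emptyset,\quad L=\sum_D v^{-2d_{11}}[D]_\emptyset+\sum_{D'}v^{-d'_{11}}[D']_{\{(1,1)\}},$$ where $(B,\emptyset),(C,\emptyset),(D,\emptyset),(D',\{(1,1)\})$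 run over the elements of $\Xi_{n|n,d}$ such that $B-E_{i,i+1}$, $C-E_{i+1,i}$, $D$, $D'$ are diagonal matrices ($E_{k,l}$ denoting the matrix units). **Proposition.** There is a surjective homomorphism of $\mathbb Q(v)$-algebras $\mathbf{MU}\to\mathbb Q(v)\otimes_{\mathcal A}\mathcal{MS}_{n,d}$ with $E_i\mapsto 1\otimes E_i$, $F_i\mapsto 1\otimes F_i$, $L\mapsto 1\otimes L$ and $H_a^{\pm}\mapsto 1\otimes H_a^{\pm}$ for all $1\le i\le n-1$ and $1\le a\le n$. -/

import Mathlib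

open scoped TensorProduct LaurentPolynomial

noncomputable section

namespace Mirabolic

/-! ### Scalars -/

/-- The field `ℚ(v)`. -/
abbrev Qv : Type := RatFunc ℚ

/-- The indeterminate `v` of `ℚ(v)`. -/
def v : Qv := RatFunc.X

/-- The ring `𝒜 = ℤ[v, v⁻¹]`; the monomial `v ^ k` is `LaurentPolynomial.T k`. -/
abbrev Lau : Type := ℤ[T;T⁻¹]

/-- The inclusion `ℤ[v, v⁻¹] ⊆ ℚ(v)`, `v ↦ v`. -/
instance instAlgebraLauQv : Algebra Lau Qv :=
  (LaurentPolynomial.eval₂ (Int.castRingHom Qv)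
    (Units.mk0 (RatFunc.X : RatFunc ℚ) RatFunc.X_ne_zero)).toAlgebra

/-! ### The mirabolic quantum group `MU` -/

/-- The generators `E_i, F_i` (`1 ≤ i ≤ n - 1`), `H_a`, `H_a⁻¹` (`1 ≤ a ≤ n`) and `L`;
indices are counted from `0`. -/
inductive Gen (n : ℕ) : Type
  | E (i : Fin (n - 1))
  | F (i : Fin (n - 1))
  | H (a : Fin n)
  | Hinv (a : Fin n)
  | L

/-- The index `i ∈ [1, n - 1]`, regarded as an element of `[1, n]`. -/
def lo {n : ℕ} (i : Fin (n - 1)) : Fin n := ⟨i, by omega⟩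

/-- The index `i + 1 ∈ [1, n]` for `i ∈ [1, n - 1]`. -/
def hi {n : ℕ} (i : Fin (n - 1)) : Fin n := ⟨i + 1, by omega⟩

/-- The integer `δ_{a,i} - δ_{a,i+1}`. -/
def wt {n : ℕ} (a : Fin n) (i : Fin (n - 1)) : ℤ :=
  (if a = lo i then 1 else 0) - (if a = hi i then 1 else 0)

section Presentation

variable {n : ℕ}

/-- The free `ℚ(v)`-algebra on the generators. -/
abbrev FreeGen (n : ℕ) : Type := FreeAlgebra Qv (Gen n)

/-- A generator as an element of the free algebra. -/
abbrev gen (g : Gen n) : FreeGen n := FreeAlgebra.ι Qv g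

open Gen in
/-- The defining relations of the mirabolic quantum group. -/
inductive Rel (n : ℕ) : FreeGen n → FreeGen n → Prop
  | H_mul_Hinv (a : Fin n) : Rel n (gen (H a) * gen (Hinv a)) 1
  | Hinv_mul_H (a : Fin n) : Rel n (gen (Hinv a) * gen (H a)) 1
  | H_comm (a b : Fin n) : Rel n (gen (H a) * gen (H b)) (gen (H b) * gen (H a))
  | E_serre (i j : Fin (n - 1)) (h : (i : ℕ) + 1 = j ∨ (j : ℕ) + 1 = i) :
      Rel n (gen (E i) ^ 2 * gen (E j) + gen (E j) * gen (E i) ^ 2)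
        ((v + v⁻¹) • (gen (E i) * gen (E j) * gen (E i)))
  | F_serre (i j : Fin (n - 1)) (h : (i : ℕ) + 1 = j ∨ (j : ℕ) + 1 = i) :
      Rel n (gen (F i) ^ 2 * gen (F j) + gen (F j) * gen (F i) ^ 2)
        ((v + v⁻¹) • (gen (F i) * gen (F j) * gen (F i)))
  | E_comm (i j : Fin (n - 1)) (h : (i : ℕ) + 1 < j ∨ (j : ℕ) + 1 < i) :
      Rel n (gen (E i) * gen (E j)) (gen (E j) * gen (E i))
  | F_comm (i j : Fin (n - 1)) (h : (i : ℕ) + 1 < j ∨ (j : ℕ) + 1 < i) :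
      Rel n (gen (F i) * gen (F j)) (gen (F j) * gen (F i))
  | H_E (a : Fin n) (i : Fin (n - 1)) :
      Rel n (gen (H a) * gen (E i)) ((v ^ wt a i) • (gen (E i) * gen (H a)))
  | H_F (a : Fin n) (i : Fin (n - 1)) :
      Rel n (gen (H a) * gen (F i)) ((v ^ (-wt a i)) • (gen (F i) * gen (H a)))
  | E_F (i j : Fin (n - 1)) :
      Rel n (gen (E i) * gen (F j) - gen (F j) * gen (E i))
        (if i = j then
          (v - v⁻¹)⁻¹ • (gen (H (lo i)) * gen (Hinv (hi i)) - gen (Hinv (lo i)) * gen (H (hi i)))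
        else 0)
  | H_L (a : Fin n) : Rel n (gen (H a) * gen L) (gen L * gen (H a))
  | L_sq : Rel n (gen L ^ 2) (gen L)
  | L_E (i : Fin (n - 1)) : Rel n (gen L * gen (E i)) (gen L * gen (E i) * gen L)
  | F_L (i : Fin (n - 1)) : Rel n (gen (F i) * gen L) (gen L * gen (F i) * gen L)
  | E_L_E (i : Fin (n - 1)) :
      Rel n ((v + v⁻¹) • (gen (E i) * gen L * gen (E i)))
        (v⁻¹ • (gen (E i) ^ 2 * gen L) + v • (gen L * gen (E i) ^ 2))
  | F_L_F (i : Fin (n - 1)) :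
      Rel n ((v + v⁻¹) • (gen (F i) * gen L * gen (F i)))
        (v • (gen (F i) ^ 2 * gen L) + v⁻¹ • (gen L * gen (F i) ^ 2))

end Presentation

/-- The mirabolic quantum group `MU`, a `ℚ(v)`-algebra given by generators and relations. -/
abbrev MU (n : ℕ) : Type := RingQuot (Rel n)

/-- The class in `MU` of a generator. -/
def MU.of {n : ℕ} (g : Gen n) : MU n := RingQuot.mkAlgHom Qv (Rel n) (gen g)

/-! ### Decorated matrices -/

/-- Decorated `n × n` matrices `(A, Δ)` with `∑ a_{ij} = d`. -/
@[ext]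
structure DecMat (n d : ℕ) : Type where
  /-- the matrix -/
  A : Matrix (Fin n) (Fin n) ℕ
  /-- the set of circled positions -/
  Δ : Finset (Fin n × Fin n)
  sum_eq : ∑ i, ∑ j, A i j = d
  pos : ∀ p ∈ Δ, 0 < A p.1 p.2
  anti : ∀ p ∈ Δ, ∀ r ∈ Δ, p ≠ r → (p.1 < r.1 ∧ r.2 < p.2) ∨ (r.1 < p.1 ∧ p.2 < r.2)

instance instFiniteDecMat (n d : ℕ) : Finite (DecMat n d) := by
  have hle : ∀ (X : DecMat n d) (i j : Fin n), X.A i j < d + 1 := by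
    intro X i j
    have h1 : X.A i j ≤ ∑ j, X.A i j :=
      Finset.single_le_sum (f := fun j => X.A i j) (fun _ _ => Nat.zero_le _) (Finset.mem_univ j)
    have h2 : ∑ j, X.A i j ≤ ∑ i, ∑ j, X.A i j :=
      Finset.single_le_sum (f := fun i => ∑ j, X.A i j) (fun _ _ => Nat.zero_le _)
        (Finset.mem_univ i)
    have h3 := X.sum_eq
    omega
  refine Finite.of_injective (β := (Fin n → Fin n → Fin (d + 1)) × Finset (Fin n × Fin n))
    (fun X => (fun i j => ⟨X.A i j, hle X i j⟩, X.Δ)) ?_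
  intro X Y h
  simp only [Prod.mk.injEq] at h
  refine DecMat.ext ?_ h.2
  ext i j
  simpa using congrFun (congrFun h.1 i) j

instance instFintypeDecMat (n d : ℕ) : Fintype (DecMat n d) := Fintype.ofFinite _

namespace DecMat

variable {n d : ℕ}

open Classical in
/-- The dimension `d(A, Δ)` of the orbit `𝒪_{A,Δ}`:
`∑_{i < k or j < l} a_{ij} a_{kl} + ∑_{{(i,j)} ≤ Δ} a_{ij}`, where `{(i,j)} ≤ Δ` means that
`i ≤ k` and `j ≤ l` for some `(k, l) ∈ Δ`. -/
def dimOrbit (X : DecMat n d) : ℕ :=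
  (∑ i, ∑ j, ∑ k, ∑ l, if i < k ∨ j < l then X.A i j * X.A k l else 0) +
    ∑ i, ∑ j, if ∃ p ∈ X.Δ, i ≤ p.1 ∧ j ≤ p.2 then X.A i j else 0

/-- The dimension `r(A, Δ)` of the image of `𝒪_{A,Δ}` under the first projection:
`∑_{i < k} a_{ij} a_{kl}`. -/
def dimFlag (X : DecMat n d) : ℕ :=
  ∑ i, ∑ j, ∑ k, ∑ l, if i < k then X.A i j * X.A k l else 0

end DecMat

/-! ### Partial flags over finite fields, and relative position -/

section Flags

variable (K : Type) [Field K] (n d : ℕ)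

/-- The set `𝒳` of `n`-step partial flags `0 = V_0 ⊆ V_1 ⊆ ⋯ ⊆ V_n = V` in `V = K ^ d`. -/
def Flag : Type :=
  {f : Fin (n + 1) → Submodule K (Fin d → K) // Monotone f ∧ f 0 = ⊥ ∧ f (Fin.last n) = ⊤}

instance instFiniteFlag [Finite K] : Finite (Flag K n d) := by
  have : Finite (Submodule K (Fin d → K)) :=
    Finite.of_injective (fun S : Submodule K (Fin d → K) => (S : Set (Fin d → K)))
      SetLike.coe_injective
  unfold Flag
  infer_instance

instance instFintypeFlag [Finite K] : Fintype (Flag K n d) := Fintype.ofFinite _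

instance instDecidableEqFlag : DecidableEq (Flag K n d) := Classical.decEq _

variable {K n d}

/-- `(f, f', ω)` lies in the orbit `𝒪_{A,Δ}` of `GL(V)` on `𝒳 × 𝒳 × V`: there is a basis
`b_{ijk}` (`1 ≤ k ≤ a_{ij}`) of `V` such that `V_s` is spanned by the `b_{ijk}` with `i ≤ s`,
`V'_t` is spanned by the `b_{ijk}` with `j ≤ t`, and `ω = ∑_{(i,j) ∈ Δ} b_{ij1}`. -/
def InOrbit (X : DecMat n d) (f f' : Flag K n d) (ω : Fin d → K) : Prop :=
  ∃ b : Module.Basis (Σ p : Fin n × Fin n, Fin (X.A p.1 p.2)) K (Fin d → K),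
    (∀ s : Fin (n + 1), f.1 s = Submodule.span K (b '' {x | (x.1.1 : ℕ) < s})) ∧
    (∀ t : Fin (n + 1), f'.1 t = Submodule.span K (b '' {x | (x.1.2 : ℕ) < t})) ∧
    ω = ∑ p ∈ X.Δ.attach, b ⟨p.1, ⟨0, X.pos p.1 p.2⟩⟩

end Flags

/-! ### The mirabolic quantum Schur algebra

`𝒜`-valued functions are multiplied by specializing `v` to `√q` and taking the convolution product
over `𝔽_q`, for every prime power `q` at once. -/

/-- Prime powers `q = p ^ k`, `k ≥ 1`. -/
structure PrimePow : Type where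
  p : ℕ
  k : ℕ
  prime : p.Prime
  k_ne_zero : k ≠ 0

namespace PrimePow

/-- The number `q = p ^ k`. -/
def q (Q : PrimePow) : ℕ := Q.p ^ Q.k

instance instFactPrime (Q : PrimePow) : Fact Q.p.Prime := ⟨Q.prime⟩

/-- The finite field `𝔽_q`. -/
abbrev F (Q : PrimePow) : Type := GaloisField Q.p Q.k

lemma sqrt_q_ne_zero (Q : PrimePow) : Real.sqrt Q.q ≠ 0 := by
  have : 0 < Q.q := pow_pos Q.prime.pos _
  positivity

/-- The field `ℝ`, regarded as an `𝒜`-algebra through the specialization `v ↦ √q`. -/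
def Val (_Q : PrimePow) : Type := ℝ

instance instFieldVal (Q : PrimePow) : Field Q.Val := inferInstanceAs (Field ℝ)

instance instAlgebraLauVal (Q : PrimePow) : Algebra Lau Q.Val :=
  (LaurentPolynomial.eval₂ (Int.castRingHom ℝ)
    (Units.mk0 (Real.sqrt Q.q) Q.sqrt_q_ne_zero) : Lau →+* ℝ).toAlgebra

end PrimePow

/-- The convolution algebra of functions on `𝒳 × 𝒳 × V` over `𝔽_q`. A function `g` is the matrix
whose `(f, f')` entry is the function `g(f, f', ·)` on `V`, an element of the group algebra of `V`;
matrix multiplication is then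
`(g ∗ h)(f, f', ω) = ∑_{f'', μ} g(f, f'', μ) h(f'', f', ω - μ)`. -/
abbrev Conv (n d : ℕ) (Q : PrimePow) : Type :=
  Matrix (Flag Q.F n d) (Flag Q.F n d) (AddMonoidAlgebra Q.Val (Fin d → Q.F))

open Classical in
/-- The characteristic function `e_{A,Δ}` of the orbit `𝒪_{A,Δ}`, over all `𝔽_q` simultaneously. -/
def e {n d : ℕ} (X : DecMat n d) : ∀ Q : PrimePow, Conv n d Q := fun _ =>
  Matrix.of fun f f' => AddMonoidAlgebra.ofCoeff
    (Finsupp.equivFunOnFinite.symm fun ω => if InOrbit X f f' ω then 1 else 0)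

/-- The mirabolic quantum Schur algebra `𝓜𝓢_{n,d}`: the `𝒜`-algebra generated by the characteristic
functions of the orbits, `v` acting on functions over `𝔽_q` as `√q`. -/
abbrev MS (n d : ℕ) : Subalgebra Lau (∀ Q : PrimePow, Conv n d Q) :=
  Algebra.adjoin Lau (Set.range (e (n := n) (d := d)))

namespace MS

variable {n d : ℕ}

/-- The element `e_{A,Δ}` of `𝓜𝓢_{n,d}`. -/
def char (X : DecMat n d) : MS n d := ⟨e X, Algebra.subset_adjoin ⟨X, rfl⟩⟩

/-- The normalized element `[A]_Δ = v ^ (-d(A, Δ) + r(A, Δ)) e_{A,Δ}`. -/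
def std (X : DecMat n d) : MS n d :=
  (LaurentPolynomial.T (-(X.dimOrbit : ℤ) + (X.dimFlag : ℤ)) : Lau) • char X

open Classical in
/-- `E_i = ∑ [B]_∅`, over all `B` such that `B - E_{i,i+1}` is diagonal. -/
def E (i : Fin (n - 1)) : MS n d :=
  ∑ X : DecMat n d with X.Δ = ∅ ∧
    ∃ b : Fin n → ℕ, X.A = Matrix.diagonal b + Matrix.single (lo i) (hi i) 1, std X

open Classical in
/-- `F_i = ∑ [C]_∅`, over all `C` such that `C - E_{i+1,i}` is diagonal. -/
def F (i : Fin (n - 1)) : MS n d :=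
  ∑ X : DecMat n d with X.Δ = ∅ ∧
    ∃ b : Fin n → ℕ, X.A = Matrix.diagonal b + Matrix.single (hi i) (lo i) 1, std X

open Classical in
/-- `H_a = ∑ v ^ {d_{aa}} [D]_∅`, over all diagonal `D`. -/
def H (a : Fin n) : MS n d :=
  ∑ X : DecMat n d with X.Δ = ∅ ∧ X.A.IsDiag,
    (LaurentPolynomial.T (X.A a a : ℤ) : Lau) • std X

open Classical in
/-- `H_a⁻¹ = ∑ v ^ {-d_{aa}} [D]_∅`, over all diagonal `D`. -/
def Hinv (a : Fin n) : MS n d :=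
  ∑ X : DecMat n d with X.Δ = ∅ ∧ X.A.IsDiag,
    (LaurentPolynomial.T (-(X.A a a : ℤ)) : Lau) • std X

open Classical in
/-- `L = ∑ v ^ {-2 d_{11}} [D]_∅ + ∑ v ^ {-d'_{11}} [D']_{(1,1)}`, over all diagonal `D`, and over
all diagonal `D'` with `d'_{11} > 0`. -/
def L [NeZero n] : MS n d :=
  (∑ X : DecMat n d with X.Δ = ∅ ∧ X.A.IsDiag,
    (LaurentPolynomial.T (-2 * (X.A 0 0 : ℤ)) : Lau) • std X) +
  ∑ X : DecMat n d with X.Δ = {((0 : Fin n), (0 : Fin n))} ∧ X.A.IsDiag,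
    (LaurentPolynomial.T (-(X.A 0 0 : ℤ)) : Lau) • std X

end MS

end Mirabolic

end

/-!
# The mirabolic quantum group surjects onto the mirabolic quantum Schur algebra

An element of `MS n d` is a family, indexed by the finite fields `F`, of convolution operators.
Such an operator is regarded as a matrix, with rows and columns indexed by the flags, whose
entries lie in the group algebra of the vector space `V`.

**The generators.** Let `Efam i` be the matrix whose entry at `(f, f')` is `1` if `f'` arises from
`f` by replacing the term at `mid i` by a hyperplane in it, let `Ffam i` be its transpose, and let
`Ifam s` be the diagonal matrix of the characteristic functions of the terms `f_s`. Up to diagonal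
matrices of powers of `v` whose exponents depend only on the dimensions of the flag, `E_i`, `F_i`
and `L` are `Efam i`, `Ffam i` and `Ifam 1` (`coe_E`, `coe_F`, `coe_L`), and the `H_a` are
diagonal matrices of this kind (`coe_H`, `coe_Hinv`).

**The relations.** For the operators without `L`, both sides of a relation count flags between two
given flags, so that the relation amounts to the number of lines or hyperplanes in a quotient of
two terms (`Efam_serre_of_succ`, `Efam_serre_of_pred`, `Efam_mul_Ffam_sub`). The operator `L` is
diagonal, and its entries are the averages over the first terms `f_1`; the average over a space
absorbs that over a subspace (`avg_mul_avg`), which gives `L² = L` and `L E_i = L E_i L`. The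
relation for `E_i L E_i` is one between averages over the subspaces between two terms
(`Efam_mul_Lgen_mul_Efam`). The relations for the `F_i` follow from those for the `E_i` by the
anti-automorphism `tau`, a transposition twisted by powers of `v`.

**Surjectivity.** The nonzero elements of `ℤ[v, v⁻¹]` are invertible in `ℚ(v)`, so that it suffices
to prove the following (`char_mem_integralRange`): a subalgebra `A` of the families which contains
the generators and is saturated, i.e. `p • x ∈ A` implies `x ∈ A` for each nonzero `p`, contains
the characteristic functions of all orbits (`e_mem_of_generators`).

* The `H_a` separate the finitely many possible dimensions of a flag, so that `A` contains all
  diagonal families whose entries are functions of the dimensions, by Lagrange interpolation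
  (`fdiag_mem_of_saturated`). Hence `A` contains all `Efam i`, all `Ffam i` and `Ifam 1`, and by a
  recursion (`Ifam_succ`) all `Ifam s`.
* Let `X` be a decorated matrix. Two flags `V` and `V'` in the relative position `X` are joined by
  the chain of flags `(V_s ∩ V'_{max(s, t)})_s`, which descends from `V` to the flag `(V_s ∩
  V'_s)_s` as `t` decreases, followed by the analogous ascending chain to `V'`. Let `glue X` be
  the product of the corresponding elementary operators, into which the indicators `Ifam s` of
  suitable terms are inserted, one for each circled position. All values of these operators are
  nonnegative, so no cancellation occurs, and the support of the product can be read off from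
  those of the factors (`Supp.mul`). It contains the orbit of `X` (`InOrbit.glueRel`), and apart
  from it only orbits whose relative position is more special, or whose decoration dominates fewer
  positions (`GlueRel.le`).
* The coefficients of `glue X` are rational functions of `v` which do not depend on the field
  (`Uniform.Eh_mul`): the elementary steps down from a flag are given by linear forms, and with
  respect to a basis adapted to a triple the orbit of the resulting triple depends only on which
  coordinates of the form are nonzero. So `glue X` is a combination of characteristic functions of
  orbits, triangular with respect to `Below` and with nonzero leading coefficient, and induction
  along this order proves that all of them lie in `A` (`e_mem_of_saturated`).
-/

open scoped TensorProduct LaurentPolynomial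

noncomputable section

namespace Mirabolic

/-! ### Adapted bases and relative position -/

section Adapted

open Submodule Module

variable {K : Type} [Field K] {n d : ℕ}

/-- The basis `b` is adapted to the flag `f`: the label `ρ x` is the step at which `b x` enters `f`,
so that `f_s` is spanned by the `b x` with `ρ x < s`. -/
def Adapted {ι : Type} (b : Basis ι K (Fin d → K)) (ρ : ι → Fin n) (f : Flag K n d) : Prop :=
  ∀ s : Fin (n + 1), f.1 s = span K (b '' {x | (ρ x : ℕ) < s})

lemma Adapted.mem_iff {ι : Type} {b : Basis ι K (Fin d → K)} {ρ : ι → Fin n} {f : Flag K n d}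
    (h : Adapted b ρ f) (s : Fin (n + 1)) (w : Fin d → K) :
    w ∈ f.1 s ↔ ∀ x, b.repr w x ≠ 0 → (ρ x : ℕ) < s := by
  rw [h s, b.mem_span_image]
  simp [Set.subset_def]

lemma Adapted.basis_mem_iff {ι : Type} {b : Basis ι K (Fin d → K)} {ρ : ι → Fin n}
    {f : Flag K n d} (h : Adapted b ρ f) (s : Fin (n + 1)) (x : ι) :
    b x ∈ f.1 s ↔ (ρ x : ℕ) < s := by
  classical
  rw [h.mem_iff]
  simp [Finsupp.single_apply]

lemma finrank_span_basis_image {ι : Type} [Fintype ι] (b : Basis ι K (Fin d → K)) (p : ι → Prop)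
    [DecidablePred p] :
    finrank K (span K (b '' {x | p x})) = (Finset.univ.filter p).card := by
  have h1 : LinearIndependent K (fun x : {x // p x} => b x) :=
    b.linearIndependent.comp _ Subtype.val_injective
  have h2 := finrank_span_eq_card h1
  rw [Fintype.card_subtype] at h2
  have h3 : b '' {x | p x} = Set.range fun x : {x // p x} => b x := by
    ext w
    simp
  rw [h3, h2]

lemma Adapted.finrank_eq {ι : Type} [Fintype ι] {b : Basis ι K (Fin d → K)} {ρ : ι → Fin n}
    {f : Flag K n d} (h : Adapted b ρ f) (s : Fin (n + 1)) :
    finrank K (f.1 s) = (Finset.univ.filter fun x => (ρ x : ℕ) < s).card := by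
  rw [h s, finrank_span_basis_image]

lemma Adapted.inf_eq {ι : Type} {b : Basis ι K (Fin d → K)} {ρ γ : ι → Fin n}
    {f f' : Flag K n d} (h : Adapted b ρ f) (h' : Adapted b γ f') (s t : Fin (n + 1)) :
    f.1 s ⊓ f'.1 t = span K (b '' {x | (ρ x : ℕ) < s ∧ (γ x : ℕ) < t}) := by
  ext w
  rw [mem_inf, h.mem_iff, h'.mem_iff, b.mem_span_image]
  simp only [Set.subset_def, Finset.mem_coe, Finsupp.mem_support_iff, Set.mem_ofPred_eq]
  exact ⟨fun H x hx => ⟨H.1 x hx, H.2 x hx⟩, fun H => ⟨fun x hx => (H x hx).1,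
    fun x hx => (H x hx).2⟩⟩

lemma Adapted.finrank_inf {ι : Type} [Fintype ι] {b : Basis ι K (Fin d → K)} {ρ γ : ι → Fin n}
    {f f' : Flag K n d} (h : Adapted b ρ f) (h' : Adapted b γ f') (s t : Fin (n + 1)) :
    finrank K (f.1 s ⊓ f'.1 t : Submodule K (Fin d → K)) =
      (Finset.univ.filter fun x => (ρ x : ℕ) < s ∧ (γ x : ℕ) < t).card := by
  rw [h.inf_eq h', finrank_span_basis_image]

lemma Adapted.mem_sup_iff {ι : Type} {b : Basis ι K (Fin d → K)} {ρ γ : ι → Fin n}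
    {f f' : Flag K n d} (h : Adapted b ρ f) (h' : Adapted b γ f') (s t : Fin (n + 1))
    (w : Fin d → K) :
    w ∈ f.1 s ⊔ f'.1 t ↔ ∀ x, b.repr w x ≠ 0 → (ρ x : ℕ) < s ∨ (γ x : ℕ) < t := by
  rw [h s, h' t, ← span_union, ← Set.image_union, b.mem_span_image]
  simp [Set.subset_def]

lemma Adapted.map {ι : Type} {b : Basis ι K (Fin d → K)} {ρ : ι → Fin n}
    {f f' : Flag K n d} (h : Adapted b ρ f) (g : (Fin d → K) ≃ₗ[K] (Fin d → K))
    (hg : ∀ s, (f.1 s).map (g : (Fin d → K) →ₗ[K] (Fin d → K)) = f'.1 s) :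
    Adapted (b.map g) ρ f' := by
  intro s
  rw [← hg s, h s, Submodule.map_span, ← Set.image_comp]
  rfl

lemma map_equiv_eq_of_le {U : Submodule K (Fin d → K)} (g : (Fin d → K) ≃ₗ[K] (Fin d → K))
    (h : U.map (g : (Fin d → K) →ₗ[K] (Fin d → K)) ≤ U) :
    U.map (g : (Fin d → K) →ₗ[K] (Fin d → K)) = U :=
  eq_of_le_of_finrank_eq h (LinearEquiv.finrank_map_eq g U)

open Classical in
/-- The decorated matrix attached to a labelled index set: `a_{ij}` counts the `x` with labels
`(i, j)`, and the circled positions are the maximal labels of elements of `T`. -/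
def typ {ι : Type} [Fintype ι] (hι : Fintype.card ι = d) (ρ γ : ι → Fin n) (T : Finset ι) :
    DecMat n d where
  A i j := (Finset.univ.filter fun x => ρ x = i ∧ γ x = j).card
  Δ := Finset.univ.filter fun p => Maximal (· ∈ T.image fun x => (ρ x, γ x)) p
  sum_eq := by
    rw [← Finset.sum_product', ← hι, ← Finset.card_univ,
      Finset.card_eq_sum_card_fiberwise (f := fun x => (ρ x, γ x)) (t := Finset.univ)
        (fun _ _ => Finset.mem_coe.2 (Finset.mem_univ _))]
    simp [Prod.ext_iff]
  pos := by
    intro p hp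
    obtain ⟨x, -, hx⟩ := Finset.mem_image.1 (Finset.mem_filter.1 hp).2.prop
    exact Finset.card_pos.2 ⟨x, by simp [← hx]⟩
  anti := by
    intro p hp r hr hne
    have hp := (Finset.mem_filter.1 hp).2
    have hr := (Finset.mem_filter.1 hr).2
    have h1 : ¬ p ≤ r := fun h => hne (hp.eq_of_le hr.prop h)
    have h2 : ¬ r ≤ p := fun h => hne (hr.eq_of_le hp.prop h).symm
    rw [Prod.le_def] at h1 h2
    simp only [not_and_or, not_le] at h1 h2
    rcases h1 with h1 | h1 <;> rcases h2 with h2 | h2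
    · exact absurd h1 h2.asymm
    · exact Or.inr ⟨h1, h2⟩
    · exact Or.inl ⟨h2, h1⟩
    · exact absurd h1 h2.asymm

/-- A triple is in the orbit determined by any basis adapted to both flags and the support of the
coordinates of the vector. The basis is corrected so that the coordinates of `ω` at non-maximal
labels are absorbed into vectors with a maximal label. -/
lemma inOrbit_typ {ι : Type} [Fintype ι] (hι : Fintype.card ι = d) {b : Basis ι K (Fin d → K)}
    {ρ γ : ι → Fin n} {f f' : Flag K n d} (h : Adapted b ρ f) (h' : Adapted b γ f')
    (ω : Fin d → K) (T : Finset ι) (hT : ∀ x, x ∈ T ↔ b.repr ω x ≠ 0) :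
    InOrbit (typ hι ρ γ T) f f' ω := by
  classical
  set X := typ hι ρ γ T with hX
  let pos : ι → Fin n × Fin n := fun x => (ρ x, γ x)
  have hΔ : ∀ p, p ∈ X.Δ ↔ Maximal (· ∈ T.image pos) p := fun p => by
    simp [hX, typ, pos]
  have hlead : ∀ δ ∈ X.Δ, ∃ x ∈ T, pos x = δ := fun δ hδ => by
    simpa using ((hΔ δ).1 hδ).prop
  choose xs hxsT hxs using hlead
  have hass : ∀ y ∈ T, ∃ δ ∈ X.Δ, pos y ≤ δ := fun y hy => by
    obtain ⟨δ, h1, h2⟩ := (T.image pos).exists_le_maximal (Finset.mem_image_of_mem pos hy)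
    exact ⟨δ, (hΔ δ).2 h2, h1⟩
  have hass' : ∀ y, ∃ δ, y ∈ T → δ ∈ X.Δ ∧ pos y ≤ δ := fun y => by
    by_cases hy : y ∈ T
    · obtain ⟨δ, h1, h2⟩ := hass y hy
      exact ⟨δ, fun _ => ⟨h1, h2⟩⟩
    · exact ⟨pos y, fun hy' => absurd hy' hy⟩
  -- `as y` is a maximal label above the label of `y ∈ T`, and `xs δ` is the leading vector of `δ`
  choose as has using hass'
  have has_eq : ∀ y ∈ T, pos y ∈ X.Δ → as y = pos y := fun y hy hp =>
    (((hΔ _).1 hp).eq_of_le (((hΔ _).1 (has y hy).1).prop) (has y hy).2).symm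
  let lead : ι → Prop := fun x => ∃ hp : pos x ∈ X.Δ, xs (pos x) hp = x
  have hleadxs : ∀ δ hδ, lead (xs δ hδ) := fun δ hδ => by
    have e := hxs δ hδ
    have : ∀ δ' (e' : δ' = δ), ∃ hp : δ' ∈ X.Δ, xs δ' hp = xs δ hδ := by
      rintro _ rfl; exact ⟨hδ, rfl⟩
    exact this _ e
  -- the new basis: the leading vector of a maximal label `δ` becomes the part of `ω` assigned to
  -- `δ`, and the other vectors are kept
  let im : ι → (Fin d → K) := fun x =>
    if lead x then ∑ y ∈ T with as y = pos x, b.repr ω y • b y else b x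
  let g0 : (Fin d → K) →ₗ[K] (Fin d → K) := b.constr K im
  have hg0 : ∀ x, g0 (b x) = im x := fun x => b.constr_basis K im x
  have hnl : ∀ x, ¬ lead x → b x ∈ LinearMap.range g0 := fun x hx =>
    ⟨b x, by rw [hg0]; simp [im, hx]⟩
  -- the coordinate of `ω` at a leading vector is nonzero, so the leading vectors can be recovered
  have hsurj : Function.Surjective g0 := by
    rw [← LinearMap.range_eq_top, eq_top_iff, ← b.span_eq, span_le]
    rintro _ ⟨x, rfl⟩
    by_cases hx : lead x
    · obtain ⟨hp, hxx⟩ := hx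
      have hxT : x ∈ T := hxx ▸ hxsT _ hp
      have hc : b.repr ω x ≠ 0 := (hT x).1 hxT
      have hmem : x ∈ T.filter (fun y => as y = pos x) := by
        simp [hxT, has_eq x hxT hp]
      have e1 : g0 (b x) = b.repr ω x • b x +
          ∑ y ∈ (T.filter (fun y => as y = pos x)).erase x, b.repr ω y • b y := by
        rw [hg0, Finset.add_sum_erase _ (fun y => b.repr ω y • b y) hmem]
        simp only [im]
        rw [if_pos ⟨hp, hxx⟩]
      have e2 : ∑ y ∈ (T.filter (fun y => as y = pos x)).erase x, b.repr ω y • b y ∈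
          LinearMap.range g0 := by
        refine sum_mem fun y hy => smul_mem _ _ (hnl y ?_)
        rintro ⟨hpy, hyy⟩
        simp only [Finset.mem_erase, Finset.mem_filter] at hy
        have : pos y = pos x := (has_eq y hy.2.1 hpy).symm.trans hy.2.2
        apply hy.1
        rw [← hyy, ← hxx]
        congr 1
      have e3 : b.repr ω x • b x ∈ LinearMap.range g0 := by
        rw [show b.repr ω x • b x = g0 (b x) -
          ∑ y ∈ (T.filter (fun y => as y = pos x)).erase x, b.repr ω y • b y by rw [e1]; abel]
        exact sub_mem ⟨_, rfl⟩ e2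
      exact (smul_mem_iff _ hc).1 e3
    · exact hnl x hx
  let g : (Fin d → K) ≃ₗ[K] (Fin d → K) :=
    LinearEquiv.ofBijective g0 ⟨LinearMap.injective_iff_surjective.2 hsurj, hsurj⟩
  have hgb : ∀ x, g (b x) = im x := hg0
  -- the vectors assigned to `δ` have labels `≤ δ`, so that the terms of both flags are preserved
  have himρ : ∀ x s, (ρ x : ℕ) < s → ∀ U : Submodule K (Fin d → K),
      (∀ y, (ρ y : ℕ) < s → b y ∈ U) → im x ∈ U := by
    intro x s hx U hU
    by_cases hl : lead x
    · simp only [im, if_pos hl]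
      refine sum_mem fun y hy => smul_mem _ _ (hU y ?_)
      simp only [Finset.mem_filter] at hy
      have := (has y hy.1).2
      rw [hy.2] at this
      exact lt_of_le_of_lt (Fin.le_def.1 (Prod.le_def.1 this).1) hx
    · simpa only [im, if_neg hl] using hU x hx
  have himγ : ∀ x s, (γ x : ℕ) < s → ∀ U : Submodule K (Fin d → K),
      (∀ y, (γ y : ℕ) < s → b y ∈ U) → im x ∈ U := by
    intro x s hx U hU
    by_cases hl : lead x
    · simp only [im, if_pos hl]
      refine sum_mem fun y hy => smul_mem _ _ (hU y ?_)
      simp only [Finset.mem_filter] at hy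
      have := (has y hy.1).2
      rw [hy.2] at this
      exact lt_of_le_of_lt (Fin.le_def.1 (Prod.le_def.1 this).2) hx
    · simpa only [im, if_neg hl] using hU x hx
  have hf : Adapted (b.map g) ρ f := h.map g fun s => map_equiv_eq_of_le g (by
    conv_lhs => rw [h s]
    rw [Submodule.map_span, span_le]
    rintro _ ⟨_, ⟨x, hx, rfl⟩, rfl⟩
    change g (b x) ∈ f.1 s
    rw [hgb]
    exact himρ x s hx _ fun y hy => (h.basis_mem_iff s y).2 hy)
  have hf' : Adapted (b.map g) γ f' := h'.map g fun s => map_equiv_eq_of_le g (by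
    conv_lhs => rw [h' s]
    rw [Submodule.map_span, span_le]
    rintro _ ⟨_, ⟨x, hx, rfl⟩, rfl⟩
    change g (b x) ∈ f'.1 s
    rw [hgb]
    exact himγ x s hx _ fun y hy => (h'.basis_mem_iff s y).2 hy)
  have hω : ω = ∑ p ∈ X.Δ.attach, g (b (xs p.1 p.2)) := by
    have e1 : ∀ p ∈ X.Δ.attach, g (b (xs p.1 p.2)) =
        (fun p => ∑ y ∈ T with as y = p, b.repr ω y • b y) p.1 := by
      intro p _
      rw [hgb]
      simp only [im, if_pos (hleadxs p.1 p.2)]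
      rw [hxs p.1 p.2]
    rw [Finset.sum_congr rfl e1,
      Finset.sum_attach X.Δ (fun p => ∑ y ∈ T with as y = p, b.repr ω y • b y),
      Finset.sum_fiberwise_of_maps_to (fun y hy => (has y hy).1)]
    conv_lhs => rw [← b.sum_repr ω]
    symm
    refine Finset.sum_subset (Finset.subset_univ _) fun y _ hy => ?_
    rw [hT, not_not] at hy
    rw [hy, zero_smul]
  -- the labelled index set is matched with the index set of `InOrbit`, leading vectors first
  have hfib : ∀ p : Fin n × Fin n, ∃ ep : {x // pos x = p} ≃ Fin (X.A p.1 p.2),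
      ∀ hp : p ∈ X.Δ, ep ⟨xs p hp, hxs p hp⟩ = ⟨0, X.pos p hp⟩ := by
    intro p
    have hc : Fintype.card {x // pos x = p} = X.A p.1 p.2 := by
      rw [Fintype.card_subtype]
      simp [hX, typ, pos, Prod.ext_iff]
    let e0 := Fintype.equivFinOfCardEq hc
    by_cases hp : p ∈ X.Δ
    · exact ⟨e0.trans (Equiv.swap (e0 ⟨xs p hp, hxs p hp⟩) ⟨0, X.pos p hp⟩), fun _ => by simp⟩
    · exact ⟨e0, fun h => absurd h hp⟩
  choose ep hep using hfib
  let eq : ι ≃ Σ p : Fin n × Fin n, Fin (X.A p.1 p.2) :=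
    (Equiv.sigmaFiberEquiv pos).symm.trans (Equiv.sigmaCongrRight ep)
  have heq1 : ∀ x, (eq x).1 = pos x := fun x => rfl
  have heqxs : ∀ p hp, eq (xs p hp) = ⟨p, ⟨0, X.pos p hp⟩⟩ := by
    intro p hp
    have : ∀ p' (e : pos (xs p hp) = p'), eq (xs p hp) = ⟨p', ep p' ⟨xs p hp, e⟩⟩ := by
      rintro _ rfl; rfl
    rw [this p (hxs p hp), hep]
  refine ⟨(b.map g).reindex eq, ?_, ?_, ?_⟩
  · intro s
    rw [hf s]
    congr 1
    ext w
    constructor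
    · rintro ⟨x, hx, rfl⟩
      exact ⟨eq x, by simpa [heq1] using hx, by simp⟩
    · rintro ⟨z, hz, rfl⟩
      obtain ⟨x, rfl⟩ := eq.surjective z
      exact ⟨x, by simpa [heq1] using hz, by simp⟩
  · intro s
    rw [hf' s]
    congr 1
    ext w
    constructor
    · rintro ⟨x, hx, rfl⟩
      exact ⟨eq x, by simpa [heq1] using hx, by simp⟩
    · rintro ⟨z, hz, rfl⟩
      obtain ⟨x, rfl⟩ := eq.surjective z
      exact ⟨x, by simpa [heq1] using hz, by simp⟩
  · conv_lhs => rw [hω]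
    refine Finset.sum_congr rfl fun p _ => ?_
    rw [Basis.reindex_apply, ← heqxs p.1 p.2, Equiv.symm_apply_apply, Basis.map_apply]

end Adapted

/-! ### Orbits and their invariants -/

section Orbits

open Submodule Module

variable {K : Type} [Field K] {n d : ℕ}

namespace DecMat

/-- The index set of the bases in the definition of the orbit `𝒪_{A,Δ}`. -/
abbrev Idx (X : DecMat n d) : Type := Σ p : Fin n × Fin n, Fin (X.A p.1 p.2)

/-- The first indices of the circled positions, whose basis vectors sum to `ω`. -/
def marked (X : DecMat n d) : Finset X.Idx :=
  Finset.univ.filter fun x => x.1 ∈ X.Δ ∧ (x.2 : ℕ) = 0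

lemma mem_marked {X : DecMat n d} {x : X.Idx} : x ∈ X.marked ↔ x.1 ∈ X.Δ ∧ (x.2 : ℕ) = 0 := by
  simp only [marked, Finset.mem_filter, Finset.mem_univ, true_and]

lemma card_idx (X : DecMat n d) : Fintype.card X.Idx = d := by
  refine Eq.trans ?_ X.sum_eq
  rw [Fintype.card_sigma, ← Finset.univ_product_univ, Finset.sum_product]
  exact Finset.sum_congr rfl fun i _ => Finset.sum_congr rfl fun j _ => Fintype.card_fin _

lemma marked_injOn_row (X : DecMat n d) {x y : X.Idx} (hx : x ∈ X.marked) (hy : y ∈ X.marked)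
    (h : x.1.1 = y.1.1) : x = y := by
  rw [mem_marked] at hx hy
  obtain ⟨p, k⟩ := x
  obtain ⟨r, l⟩ := y
  have e : p = r := by
    by_contra hne
    rcases X.anti p hx.1 r hy.1 hne with h1 | h1
    · exact absurd h h1.1.ne
    · exact absurd h h1.1.ne'
  subst e
  exact congrArg (Sigma.mk p) (Fin.ext (hx.2.trans hy.2.symm))

/-- Number of basis vectors in the rectangle of positions `(i, j)` with `i < s`, `j < t`. -/
def rk (X : DecMat n d) (s t : ℕ) : ℕ :=
  (Finset.univ.filter fun x : X.Idx => (x.1.1 : ℕ) < s ∧ (x.1.2 : ℕ) < t).card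

/-- The position `(i, j)` is dominated by some circled position. -/
def Dom (X : DecMat n d) (i j : Fin n) : Prop := ∃ p ∈ X.Δ, i ≤ p.1 ∧ j ≤ p.2

lemma card_cell (X : DecMat n d) (i j : Fin n) :
    (Finset.univ.filter fun x : X.Idx => x.1.1 = i ∧ x.1.2 = j).card = X.A i j := by
  classical
  have h := Finset.card_bij (s := (Finset.univ : Finset (Fin (X.A i j))))
    (t := Finset.univ.filter fun x : X.Idx => x.1.1 = i ∧ x.1.2 = j)
    (fun k _ => (⟨(i, j), k⟩ : X.Idx))
    (fun k _ => Finset.mem_filter.2 ⟨Finset.mem_univ _, rfl, rfl⟩)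
    (fun k _ l _ hkl => eq_of_heq (Sigma.mk.inj hkl).2) (by
      rintro ⟨⟨a, b⟩, k⟩ hx
      obtain ⟨-, h1, h2⟩ := Finset.mem_filter.1 hx
      change a = i at h1
      change b = j at h2
      subst h1 h2
      exact ⟨k, Finset.mem_univ _, rfl⟩)
  rw [← h, Finset.card_univ, Fintype.card_fin]

/-- The entries of the matrix are second differences of the rectangle counts. -/
lemma A_add_rk (X : DecMat n d) (i j : Fin n) :
    X.A i j + X.rk i (j + 1) + X.rk (i + 1) j = X.rk (i + 1) (j + 1) + X.rk i j := by
  rw [← X.card_cell i j]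
  simp only [rk, Finset.card_filter]
  rw [← Finset.sum_add_distrib, ← Finset.sum_add_distrib, ← Finset.sum_add_distrib]
  refine Finset.sum_congr rfl fun x _ => ?_
  simp only [Fin.ext_iff]
  split_ifs <;> omega

lemma A_eq_of_rk_eq {X Y : DecMat n d} (h : ∀ s t : Fin (n + 1), X.rk s t = Y.rk s t) :
    X.A = Y.A := by
  ext i j
  have h1 := X.A_add_rk i j
  have h2 := Y.A_add_rk i j
  have a1 := h i.castSucc j.succ
  have a2 := h i.succ j.castSucc
  have a3 := h i.succ j.succ
  have a4 := h i.castSucc j.castSucc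
  simp only [Fin.val_succ, Fin.val_castSucc] at a1 a2 a3 a4
  omega

lemma Δ_eq_of_dom_iff {X Y : DecMat n d} (h : ∀ i j, X.Dom i j ↔ Y.Dom i j) : X.Δ = Y.Δ := by
  have key : ∀ {X Y : DecMat n d}, (∀ i j, X.Dom i j ↔ Y.Dom i j) → X.Δ ⊆ Y.Δ := by
    intro X Y h p hp
    obtain ⟨r, hr, h1, h2⟩ := (h p.1 p.2).1 ⟨p, hp, le_rfl, le_rfl⟩
    obtain ⟨p', hp', h3, h4⟩ := (h r.1 r.2).2 ⟨r, hr, le_rfl, le_rfl⟩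
    have : p = p' := by
      by_contra hne
      rcases X.anti p hp p' hp' hne with h5 | h5
      · exact absurd (h2.trans h4) h5.2.not_ge
      · exact absurd (h1.trans h3) h5.1.not_ge
    subst this
    rwa [show p = r from Prod.ext (le_antisymm h1 h3) (le_antisymm h2 h4)]
  exact Finset.Subset.antisymm (key h) (key fun i j => (h i j).symm)

end DecMat

lemma inOrbit_iff_adapted {X : DecMat n d} {f f' : Flag K n d} {ω : Fin d → K} :
    InOrbit X f f' ω ↔ ∃ b : Basis X.Idx K (Fin d → K),
      Adapted b (fun x => x.1.1) f ∧ Adapted b (fun x => x.1.2) f' ∧ ω = ∑ x ∈ X.marked, b x := by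
  have e : ∀ b : Basis X.Idx K (Fin d → K),
      ∑ p ∈ X.Δ.attach, b ⟨p.1, ⟨0, X.pos p.1 p.2⟩⟩ = ∑ x ∈ X.marked, b x := fun b =>
    Finset.sum_bij (fun p _ => (⟨p.1, ⟨0, X.pos p.1 p.2⟩⟩ : X.Idx))
      (fun p _ => DecMat.mem_marked.2 ⟨p.2, rfl⟩)
      (fun p _ r _ h => Subtype.ext (Sigma.mk.inj h).1)
      (fun x hx => ⟨⟨x.1, (DecMat.mem_marked.1 hx).1⟩, Finset.mem_attach _ _,
        Sigma.ext rfl (heq_of_eq (Fin.ext (DecMat.mem_marked.1 hx).2.symm))⟩)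
      (fun _ _ => rfl)
  exact exists_congr fun b => and_congr Iff.rfl (and_congr Iff.rfl (by rw [e b]))

open Classical in
lemma repr_sum_basis {ι : Type} (b : Basis ι K (Fin d → K)) (T : Finset ι) (x : ι) :
    b.repr (∑ y ∈ T, b y) x = if x ∈ T then 1 else 0 := by
  simp [map_sum, Finsupp.finsetSum_apply, Finsupp.single_apply]

/-- The relative position of the two flags of a triple is that of its orbit. -/
lemma InOrbit.finrank_inf {X : DecMat n d} {f f' : Flag K n d} {ω : Fin d → K}
    (h : InOrbit X f f' ω) (s t : Fin (n + 1)) :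
    finrank K (f.1 s ⊓ f'.1 t : Submodule K (Fin d → K)) = X.rk s t := by
  obtain ⟨b, h1, h2, -⟩ := inOrbit_iff_adapted.1 h
  exact h1.finrank_inf h2 s t

/-- The circled positions of the orbit of a triple are read off from the sums `f_s + f'_t`
containing the vector. -/
lemma InOrbit.dom_iff {X : DecMat n d} {f f' : Flag K n d} {ω : Fin d → K}
    (h : InOrbit X f f' ω) (i j : Fin n) :
    X.Dom i j ↔ ω ∉ f.1 i.castSucc ⊔ f'.1 j.castSucc := by
  classical
  obtain ⟨b, h1, h2, rfl⟩ := inOrbit_iff_adapted.1 h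
  rw [h1.mem_sup_iff h2]
  simp only [repr_sum_basis]
  push Not
  constructor
  · rintro ⟨p, hp, h3, h4⟩
    refine ⟨⟨p, ⟨0, X.pos p hp⟩⟩, ?_, h3, h4⟩
    rw [if_pos (DecMat.mem_marked.2 ⟨hp, rfl⟩)]
    exact one_ne_zero
  · rintro ⟨x, hx, h3, h4⟩
    have hx' : x ∈ X.marked := by
      by_contra hc
      rw [if_neg hc] at hx
      exact hx rfl
    exact ⟨x.1, (DecMat.mem_marked.1 hx').1, h3, h4⟩

/-- Distinct orbits are disjoint. -/
lemma InOrbit.unique {X Y : DecMat n d} {f f' : Flag K n d} {ω : Fin d → K}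
    (hX : InOrbit X f f' ω) (hY : InOrbit Y f f' ω) : X = Y :=
  DecMat.ext
    (DecMat.A_eq_of_rk_eq fun s t => by rw [← hX.finrank_inf, ← hY.finrank_inf])
    (DecMat.Δ_eq_of_dom_iff fun i j => by rw [hX.dom_iff, hY.dom_iff])

/-- The flag spanned by a labelled basis. -/
def flagOf {ι : Type} (b : Basis ι K (Fin d → K)) (ρ : ι → Fin n) : Flag K n d :=
  ⟨fun s => span K (b '' {x | (ρ x : ℕ) < s}), by
    refine ⟨?_, ?_, ?_⟩
    · intro s t hst
      refine span_mono (Set.image_mono fun x (hx : (ρ x : ℕ) < s) => ?_)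
      exact lt_of_lt_of_le hx (Fin.le_def.1 hst)
    · have : {x | (ρ x : ℕ) < ((0 : Fin (n + 1)) : ℕ)} = (∅ : Set ι) := by
        ext x; simp
      beta_reduce
      rw [this, Set.image_empty, span_empty]
    · have : {x | (ρ x : ℕ) < (Fin.last n : ℕ)} = (Set.univ : Set ι) := by
        ext x; simp
      beta_reduce
      rw [this, Set.image_univ, b.span_eq]⟩

lemma adapted_flagOf {ι : Type} (b : Basis ι K (Fin d → K)) (ρ : ι → Fin n) :
    Adapted b ρ (flagOf b ρ) := fun _ => rfl

/-- Orbits are nonempty over every field. -/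
lemma exists_inOrbit (K : Type) [Field K] (X : DecMat n d) :
    ∃ (f f' : Flag K n d) (ω : Fin d → K), InOrbit X f f' ω := by
  let b : Basis X.Idx K (Fin d → K) :=
    (Pi.basisFun K (Fin d)).reindex (Fintype.equivFinOfCardEq X.card_idx).symm
  exact ⟨_, _, _, inOrbit_iff_adapted.2 ⟨b, adapted_flagOf b _, adapted_flagOf b _, rfl⟩⟩

lemma Flag.ext' {f f' : Flag K n d} (h : ∀ s, f.1 s = f'.1 s) : f = f' :=
  Subtype.ext (funext h)

end Orbits

/-! ### Elementary steps between flags -/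

section Steps

open Submodule Module

variable {K : Type} [Field K] {n d : ℕ}

/-- The position of `V_{i+1}`, the term of a flag that is moved by `E_i` and `F_i`. -/
def mid (i : Fin (n - 1)) : Fin (n + 1) := (hi i).castSucc

lemma val_mid (i : Fin (n - 1)) : (mid i : ℕ) = i + 1 := rfl
lemma val_lo (i : Fin (n - 1)) : (lo i : ℕ) = i := rfl
lemma val_hi (i : Fin (n - 1)) : (hi i : ℕ) = i + 1 := rfl

lemma succ_lo (i : Fin (n - 1)) : (lo i).succ = mid i := rfl
lemma castSucc_hi (i : Fin (n - 1)) : (hi i).castSucc = mid i := rfl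

/-- `f'` is obtained from `f` by shrinking the term at `mid i` to a hyperplane of it. -/
def EStep (i : Fin (n - 1)) (f f' : Flag K n d) : Prop :=
  (∀ s, s ≠ mid i → f.1 s = f'.1 s) ∧ f'.1 (mid i) ≤ f.1 (mid i) ∧
    finrank K (f.1 (mid i)) = finrank K (f'.1 (mid i)) + 1

lemma castSucc_lo_ne_mid (i : Fin (n - 1)) : (lo i).castSucc ≠ mid i := by
  simp [Fin.ext_iff, val_mid, val_lo]

lemma succ_hi_ne_mid (i : Fin (n - 1)) : (hi i).succ ≠ mid i := by
  simp [Fin.ext_iff, val_mid, val_hi]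

lemma castSucc_lo_lt_mid (i : Fin (n - 1)) : (lo i).castSucc < mid i := by
  simp [Fin.lt_def, val_mid, val_lo]

lemma mid_lt_succ_hi (i : Fin (n - 1)) : mid i < (hi i).succ := by
  simp [Fin.lt_def, val_mid, val_hi]

lemma le_castSucc_lo_of_lt {i : Fin (n - 1)} {s : Fin (n + 1)} (h : s < mid i) :
    s ≤ (lo i).castSucc := by
  rw [Fin.lt_def, val_mid] at h
  rw [Fin.le_def, Fin.val_castSucc, val_lo]
  omega

lemma succ_hi_le_of_lt {i : Fin (n - 1)} {s : Fin (n + 1)} (h : mid i < s) :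
    (hi i).succ ≤ s := by
  rw [Fin.lt_def, val_mid] at h
  rw [Fin.le_def, Fin.val_succ, val_hi]
  omega

namespace Flag

lemma mono (f : Flag K n d) {s t : Fin (n + 1)} (h : s ≤ t) : f.1 s ≤ f.1 t := f.2.1 h

/-- Replace the term at `mid i`. -/
def replace (f : Flag K n d) (i : Fin (n - 1)) (W : Submodule K (Fin d → K))
    (h1 : f.1 (lo i).castSucc ≤ W) (h2 : W ≤ f.1 (hi i).succ) : Flag K n d :=
  ⟨fun s => if s = mid i then W else f.1 s, by
    refine ⟨?_, ?_, ?_⟩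
    · intro s t hst
      by_cases hs : s = mid i <;> by_cases ht : t = mid i
      · simp [hs, ht]
      · simp only [if_pos hs, if_neg ht]
        exact h2.trans (f.mono (succ_hi_le_of_lt (lt_of_le_of_ne (hs ▸ hst) (Ne.symm ht))))
      · simp only [if_neg hs, if_pos ht]
        exact (f.mono (le_castSucc_lo_of_lt (lt_of_le_of_ne (ht ▸ hst) hs))).trans h1
      · simpa only [if_neg hs, if_neg ht] using f.mono hst
    · have h0 : (0 : Fin (n + 1)) ≠ mid i := fun h => by
        have := congrArg Fin.val h
        rw [val_mid, Fin.val_zero] at this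
        omega
      exact (if_neg h0).trans f.2.2.1
    · have h0 : Fin.last n ≠ mid i := fun h => by
        have := congrArg Fin.val h
        rw [val_mid, Fin.val_last] at this
        omega
      exact (if_neg h0).trans f.2.2.2⟩

variable (f : Flag K n d) (i : Fin (n - 1)) (W : Submodule K (Fin d → K))
    (h1 : f.1 (lo i).castSucc ≤ W) (h2 : W ≤ f.1 (hi i).succ)

lemma replace_mid : (f.replace i W h1 h2).1 (mid i) = W := if_pos rfl

lemma replace_of_ne {s : Fin (n + 1)} (hs : s ≠ mid i) :
    (f.replace i W h1 h2).1 s = f.1 s := if_neg hs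

lemma ext_mid {i : Fin (n - 1)} {f f' : Flag K n d} (h : ∀ s, s ≠ mid i → f.1 s = f'.1 s)
    (hm : f.1 (mid i) = f'.1 (mid i)) : f = f' :=
  Flag.ext' fun s => if hs : s = mid i then hs ▸ hm else h s hs

end Flag

lemma eStep_replace (f : Flag K n d) (i : Fin (n - 1)) (W : Submodule K (Fin d → K))
    (h1 : f.1 (lo i).castSucc ≤ W) (h2 : W ≤ f.1 (mid i))
    (h3 : finrank K (f.1 (mid i)) = finrank K W + 1) :
    EStep i f (f.replace i W h1 (h2.trans (f.mono (mid_lt_succ_hi i).le))) := by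
  refine ⟨fun s hs => (f.replace_of_ne i W _ _ hs).symm, ?_, ?_⟩
  · rwa [f.replace_mid]
  · rwa [f.replace_mid]

lemma EStep.castSucc_lo {i : Fin (n - 1)} {f f' : Flag K n d} (h : EStep i f f') :
    f.1 (lo i).castSucc = f'.1 (lo i).castSucc := h.1 _ (castSucc_lo_ne_mid i)

lemma EStep.succ_hi {i : Fin (n - 1)} {f f' : Flag K n d} (h : EStep i f f') :
    f.1 (hi i).succ = f'.1 (hi i).succ := h.1 _ (succ_hi_ne_mid i)

lemma finrank_inf_ker_add_one {U : Submodule K (Fin d → K)} {ξ : Dual K (Fin d → K)}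
    (h : ¬ U ≤ LinearMap.ker ξ) :
    finrank K (U ⊓ LinearMap.ker ξ : Submodule K (Fin d → K)) + 1 = finrank K U := by
  have hne : ξ.comp U.subtype ≠ 0 := by
    intro h0
    exact h fun u hu => LinearMap.congr_fun h0 ⟨u, hu⟩
  have e := LinearEquiv.finrank_eq
    (Submodule.equivSubtypeMap U (Submodule.comap U.subtype (LinearMap.ker ξ)))
  rw [Submodule.map_comap_subtype] at e
  rw [← Module.Dual.finrank_ker_add_one_of_ne_zero hne, LinearMap.ker_comp, e]

lemma EStep.le {i : Fin (n - 1)} {f f' : Flag K n d} (h : EStep i f f') (s : Fin (n + 1)) :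
    f'.1 s ≤ f.1 s := by
  by_cases hs : s = mid i
  · exact hs ▸ h.2.1
  · exact (h.1 s hs).ge

/-- A hyperplane of `f_{mid i}` is the kernel of a linear form. -/
lemma EStep.exists_dual {i : Fin (n - 1)} {f f' : Flag K n d} (h : EStep i f f') :
    ∃ ξ : Dual K (Fin d → K), f'.1 (mid i) ≤ LinearMap.ker ξ ∧
      ¬ f.1 (mid i) ≤ LinearMap.ker ξ := by
  have hlt : ¬ f.1 (mid i) ≤ f'.1 (mid i) := fun hle => by
    have := Submodule.finrank_mono hle
    have := h.2.2
    omega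
  obtain ⟨x, hx, hx'⟩ := Set.not_subset.1 hlt
  obtain ⟨ξ, h1, h2⟩ := Submodule.exists_le_ker_of_notMem hx'
  exact ⟨ξ, h2, fun hle => h1 (hle hx)⟩

lemma EStep.mid_eq {i : Fin (n - 1)} {f f' : Flag K n d} (h : EStep i f f')
    {ξ : Dual K (Fin d → K)} (h1 : f'.1 (mid i) ≤ LinearMap.ker ξ)
    (h2 : ¬ f.1 (mid i) ≤ LinearMap.ker ξ) : f'.1 (mid i) = f.1 (mid i) ⊓ LinearMap.ker ξ := by
  refine eq_of_le_of_finrank_eq (le_inf h.2.1 h1) ?_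
  have := finrank_inf_ker_add_one h2
  have := h.2.2
  omega

/-- The linear forms that cut out an elementary step. -/
lemma existsUnique_eStep_of_dual (i : Fin (n - 1)) (f : Flag K n d) {ξ : Dual K (Fin d → K)}
    (h1 : f.1 (lo i).castSucc ≤ LinearMap.ker ξ) (h2 : ¬ f.1 (mid i) ≤ LinearMap.ker ξ) :
    ∃! f' : Flag K n d, EStep i f f' ∧ f'.1 (mid i) ≤ LinearMap.ker ξ := by
  refine ⟨_, ⟨eStep_replace f i (f.1 (mid i) ⊓ LinearMap.ker ξ)
    (le_inf (f.mono (castSucc_lo_lt_mid i).le) h1) inf_le_left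
    (finrank_inf_ker_add_one h2).symm, ?_⟩, ?_⟩
  · rw [f.replace_mid]
    exact inf_le_right
  · rintro f' ⟨h3, h4⟩
    refine Flag.ext_mid (i := i) (fun s hs => ?_) ?_
    · rw [f.replace_of_ne _ _ _ _ hs, h3.1 s hs]
    · rw [f.replace_mid, h3.mid_eq h4 h2]

/-- The change of adapted basis in an elementary step: if `p` has minimal second label among the
basis vectors of the moved row on which the form `ξ` is nonzero, subtracting multiples of `b p`
moves all other vectors of the row into the hyperplane, and `p` passes to the next row. -/
lemma EStep.exists_adapted {ι : Type} [Fintype ι] [DecidableEq ι] {i : Fin (n - 1)}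
    {f f₂ f' : Flag K n d} (h : EStep i f f₂) {b : Basis ι K (Fin d → K)} {ρ γ : ι → Fin n}
    (hρ : Adapted b ρ f) (hγ : Adapted b γ f') {ξ : Dual K (Fin d → K)}
    (h1 : f₂.1 (mid i) ≤ LinearMap.ker ξ) (h2 : ¬ f.1 (mid i) ≤ LinearMap.ker ξ) {p : ι}
    (hp : ρ p = lo i) (hpξ : ξ (b p) ≠ 0)
    (hmin : ∀ y, ρ y = lo i → ξ (b y) ≠ 0 → γ p ≤ γ y) :
    ∃ b' : Basis ι K (Fin d → K), Adapted b' (Function.update ρ p (hi i)) f₂ ∧ Adapted b' γ f' ∧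
      ∀ ω x, b'.repr ω x = if x = p then
        (∑ y with ρ y = lo i, b.repr ω y * ξ (b y)) / ξ (b p) else b.repr ω x := by
  classical
  -- the transvection `x ↦ x - φ x • b p`, where `φ (b y) = ξ (b y) / ξ (b p)` for the other vectors
  -- of the moved row
  let φ : Dual K (Fin d → K) :=
    b.constr K fun y => if ρ y = lo i ∧ y ≠ p then ξ (b y) / ξ (b p) else 0
  have hφ : ∀ y, φ (b y) = if ρ y = lo i ∧ y ≠ p then ξ (b y) / ξ (b p) else 0 := fun y =>
    b.constr_basis K _ y
  have hφp : (-φ) (b p) = 0 := by simp [hφ]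
  let g : (Fin d → K) ≃ₗ[K] (Fin d → K) := LinearEquiv.transvection hφp
  have hg : ∀ x, g x = x - φ x • b p := fun x => by
    change x + (-φ) x • b p = _
    rw [LinearMap.neg_apply, neg_smul, sub_eq_add_neg]
  have hgs : ∀ x, g.symm x = x + φ x • b p := fun x => by
    rw [LinearEquiv.symm_apply_eq, hg, map_add, map_smul]
    have : φ (b p) = 0 := by simpa using hφp
    rw [this]; simp
  have hker : ∀ y, (ρ y : ℕ) < lo i → ξ (b y) = 0 := fun y hy => by
    have : b y ∈ f.1 (lo i).castSucc := (hρ.basis_mem_iff _ _).2 (by simpa using hy)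
    rw [h.castSucc_lo] at this
    exact h1 (f₂.mono (castSucc_lo_lt_mid i).le this)
  have hstab : ∀ (U : Submodule K (Fin d → K)), (b p ∈ U ∨ ∀ u ∈ U, φ u = 0) →
      U.map (g : (Fin d → K) →ₗ[K] (Fin d → K)) = U := fun U hU => by
    refine map_equiv_eq_of_le g ?_
    rintro _ ⟨u, hu, rfl⟩
    change g u ∈ U
    rw [hg]
    rcases hU with hU | hU
    · exact sub_mem hu (smul_mem _ _ hU)
    · rw [hU u hu, zero_smul, sub_zero]
      exact hu
  have hspan : ∀ (q : ι → Prop), (∀ y, q y → φ (b y) = 0) →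
      ∀ u ∈ span K (b '' {x | q x}), φ u = 0 := fun q hq u hu => by
    have : span K (b '' {x | q x}) ≤ LinearMap.ker φ := by
      rw [span_le]
      rintro _ ⟨y, hy, rfl⟩
      exact hq y hy
    exact this hu
  have hf : ∀ s, (f.1 s).map (g : (Fin d → K) →ₗ[K] (Fin d → K)) = f.1 s := fun s => by
    apply hstab
    by_cases hs : (ρ p : ℕ) < s
    · exact Or.inl ((hρ.basis_mem_iff s p).2 hs)
    · right
      rw [hρ s]
      refine hspan _ fun y hy => ?_
      rw [hφ, if_neg]
      rintro ⟨e, -⟩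
      rw [e, ← hp] at hy
      exact hs hy
  -- here the minimality of the second label of `p` is needed
  have hf' : ∀ s, (f'.1 s).map (g : (Fin d → K) →ₗ[K] (Fin d → K)) = f'.1 s := fun s => by
    apply hstab
    by_cases hs : (γ p : ℕ) < s
    · exact Or.inl ((hγ.basis_mem_iff s p).2 hs)
    · right
      rw [hγ s]
      refine hspan _ fun y hy => ?_
      rw [hφ]
      split_ifs with hc
      · by_cases h0 : ξ (b y) = 0
        · rw [h0, zero_div]
        · exact absurd (lt_of_le_of_lt (Fin.le_def.1 (hmin y hc.1 h0)) hy) hs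
      · rfl
  have hb1 : Adapted (b.map g) ρ f := hρ.map g hf
  refine ⟨b.map g, ?_, hγ.map g hf', ?_⟩
  · intro s
    by_cases hs : s = mid i
    · subst hs
      symm
      refine eq_of_le_of_finrank_eq ?_ ?_
      · rw [h.mid_eq h1 h2, span_le]
        rintro _ ⟨y, hy, rfl⟩
        change ((Function.update ρ p (hi i) y : Fin n) : ℕ) < _ at hy
        have hyp : y ≠ p := by
          rintro rfl
          simp [val_hi, val_mid] at hy
        rw [Function.update_of_ne hyp] at hy
        refine ⟨(hb1.basis_mem_iff _ _).2 hy, ?_⟩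
        change ξ (g (b y)) = 0
        rw [hg, map_sub, map_smul, hφ]
        rw [val_mid] at hy
        by_cases hr : ρ y = lo i
        · rw [if_pos ⟨hr, hyp⟩, smul_eq_mul, div_mul_cancel₀ _ hpξ, sub_self]
        · rw [if_neg (fun hc => hr hc.1), hker y, zero_smul, sub_zero]
          rw [Fin.ext_iff, val_lo] at hr
          rw [val_lo]
          omega
      · have e1 := hρ.finrank_eq (mid i)
        have e2 := h.2.2
        rw [finrank_span_basis_image]
        have e3 : (Finset.univ.filter fun x => (ρ x : ℕ) < mid i) = insert p
            (Finset.univ.filter fun x => ((Function.update ρ p (hi i) x : Fin n) : ℕ) < mid i) := by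
          ext x
          by_cases hx : x = p
          · subst hx
            simp [hp, val_lo, val_mid]
          · simp [hx]
        rw [e3, Finset.card_insert_of_notMem (by simp [val_hi, val_mid])] at e1
        omega
    · rw [← h.1 s hs, hb1 s]
      congr 2
      ext x
      change (ρ x : ℕ) < s ↔ ((Function.update ρ p (hi i) x : Fin n) : ℕ) < s
      by_cases hx : x = p
      · subst hx
        rw [Function.update_self, hp, val_lo, val_hi]
        rw [Fin.ext_iff, val_mid] at hs
        omega
      · rw [Function.update_of_ne hx]
  · intro ω x
    rw [Basis.map_repr, LinearEquiv.trans_apply, hgs, map_add, map_smul, b.repr_self]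
    simp only [Finsupp.coe_add, Finsupp.coe_smul, Pi.add_apply, Pi.smul_apply, smul_eq_mul,
      Finsupp.single_apply]
    by_cases hx : x = p
    · subst hx
      rw [if_pos rfl, if_pos rfl, mul_one]
      have e : φ ω = ∑ y, b.repr ω y * φ (b y) := by
        conv_lhs => rw [← b.sum_repr ω, map_sum]
        simp
      rw [e, ← Finset.add_sum_erase (Finset.univ.filter fun y => ρ y = lo i) _
        (show x ∈ _ by simp [hp]), add_div, mul_div_assoc, div_self hpξ, mul_one, Finset.sum_div]
      congr 1
      rw [← Finset.sum_subset (Finset.subset_univ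
        ((Finset.univ.filter fun y => ρ y = lo i).erase x))]
      · refine Finset.sum_congr rfl fun y hy => ?_
        simp only [Finset.mem_erase, Finset.mem_filter, Finset.mem_univ, true_and] at hy
        rw [hφ, if_pos ⟨hy.2, hy.1⟩, mul_div_assoc]
      · intro y _ hy
        simp only [Finset.mem_erase, Finset.mem_filter, Finset.mem_univ, true_and] at hy
        rw [hφ, if_neg (fun hc => hy ⟨hc.2, hc.1⟩), mul_zero]
    · rw [if_neg (Ne.symm hx), if_neg hx, mul_zero, add_zero]

lemma EStep.exists_row {ι : Type} [Fintype ι] {i : Fin (n - 1)}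
    {f f₂ : Flag K n d} (h : EStep i f f₂) {b : Basis ι K (Fin d → K)} {ρ : ι → Fin n}
    (hρ : Adapted b ρ f) {ξ : Dual K (Fin d → K)}
    (h1 : f₂.1 (mid i) ≤ LinearMap.ker ξ) (h2 : ¬ f.1 (mid i) ≤ LinearMap.ker ξ) :
    ∃ y, ρ y = lo i ∧ ξ (b y) ≠ 0 := by
  by_contra hc
  push Not at hc
  apply h2
  rw [hρ, span_le]
  rintro _ ⟨y, hy, rfl⟩
  change (ρ y : ℕ) < _ at hy
  rw [val_mid] at hy
  by_cases hr : ρ y = lo i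
  · exact hc y hr
  · refine h1 (f₂.mono (castSucc_lo_lt_mid i).le ?_)
    rw [← h.castSucc_lo, hρ.basis_mem_iff]
    rw [Fin.ext_iff, val_lo] at hr
    rw [Fin.val_castSucc, val_lo]
    omega

/-- A flag that lies strictly below another one lies below one of its elementary steps. -/
lemma exists_eStep_of_le {f f' : Flag K n d} (hle : ∀ s, f'.1 s ≤ f.1 s) (hne : f ≠ f') :
    ∃ i f₂, EStep i f f₂ ∧ ∀ s, f'.1 s ≤ f₂.1 s := by
  classical
  have hex : ∃ k : ℕ, ∃ hk : k < n + 1, f.1 ⟨k, hk⟩ ≠ f'.1 ⟨k, hk⟩ := by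
    by_contra hc
    push Not at hc
    exact hne (Flag.ext' fun s => hc s.1 s.2)
  -- at the first index at which the flags differ, a linear form vanishing on the term of `f'` but
  -- not on that of `f` cuts out the step
  obtain ⟨hk, hk'⟩ := Nat.find_spec hex
  have hmin := fun m => Nat.find_min hex (m := m)
  set k := Nat.find hex
  have hk0 : k ≠ 0 := by
    intro h0
    apply hk'
    have : (⟨k, hk⟩ : Fin (n + 1)) = 0 := Fin.ext h0
    rw [this, f.2.2.1, f'.2.2.1]
  have hkn : k ≠ n := by
    intro h0
    apply hk'
    have : (⟨k, hk⟩ : Fin (n + 1)) = Fin.last n := Fin.ext h0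
    rw [this, f.2.2.2, f'.2.2.2]
  let i : Fin (n - 1) := ⟨k - 1, by omega⟩
  have hmid : (⟨k, hk⟩ : Fin (n + 1)) = mid i :=
    Fin.ext (by rw [val_mid]; change k = k - 1 + 1; omega)
  rw [hmid] at hk'
  have hlo : f.1 (lo i).castSucc = f'.1 (lo i).castSucc := by
    by_contra hc
    exact hmin (k - 1) (by omega) ⟨by omega, hc⟩
  have hnot : ¬ f.1 (mid i) ≤ f'.1 (mid i) := fun hc => hk' (le_antisymm hc (hle _))
  obtain ⟨x, hx, hx'⟩ := Set.not_subset.1 hnot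
  obtain ⟨ξ, h1, h2⟩ := Submodule.exists_le_ker_of_notMem hx'
  have h3 : f.1 (lo i).castSucc ≤ LinearMap.ker ξ :=
    hlo.le.trans ((f'.mono (castSucc_lo_lt_mid i).le).trans h2)
  have h4 : ¬ f.1 (mid i) ≤ LinearMap.ker ξ := fun hc => h1 (hc hx)
  obtain ⟨f₂, ⟨h5, h6⟩, -⟩ := existsUnique_eStep_of_dual i f h3 h4
  refine ⟨i, f₂, h5, fun s => ?_⟩
  by_cases hs : s = mid i
  · rw [hs, h5.mid_eq h6 h4]
    exact le_inf (hle _) h2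
  · rw [← h5.1 s hs]
    exact hle s

/-- `f'` is reached from `f` by `k` elementary steps. -/
def Reach : ℕ → Flag K n d → Flag K n d → Prop
  | 0, f, f' => f = f'
  | k + 1, f, f' => ∃ f₂, (∃ i, EStep i f f₂) ∧ Reach k f₂ f'

lemma Reach.le {k : ℕ} {f f' : Flag K n d} (h : Reach k f f') (s : Fin (n + 1)) :
    f'.1 s ≤ f.1 s := by
  induction k generalizing f with
  | zero => cases h; exact le_rfl
  | succ k ih =>
    obtain ⟨f₂, ⟨i, h1⟩, h2⟩ := h
    exact (ih h2).trans (h1.le s)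

/-- The sum of the dimensions of the terms of a flag. -/
def size (f : Flag K n d) : ℕ := ∑ s, finrank K (f.1 s)

lemma EStep.size_eq {i : Fin (n - 1)} {f f' : Flag K n d} (h : EStep i f f') :
    size f = size f' + 1 := by
  unfold size
  rw [← Finset.add_sum_erase _ _ (Finset.mem_univ (mid i)),
    ← Finset.add_sum_erase _ (fun s => finrank K (f'.1 s)) (Finset.mem_univ (mid i)), h.2.2,
    Finset.sum_congr rfl fun s hs => by rw [h.1 s (Finset.ne_of_mem_erase hs)]]
  omega

lemma reach_of_le {k : ℕ} {f f' : Flag K n d} (hle : ∀ s, f'.1 s ≤ f.1 s)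
    (hk : size f = size f' + k) : Reach k f f' := by
  induction k generalizing f with
  | zero =>
    by_contra hne
    obtain ⟨i, f₂, h1, h2⟩ := exists_eStep_of_le hle hne
    have h3 := h1.size_eq
    have h4 : size f' ≤ size f₂ := Finset.sum_le_sum fun s _ => Submodule.finrank_mono (h2 s)
    omega
  | succ k ih =>
    have hne : f ≠ f' := by rintro rfl; omega
    obtain ⟨i, f₂, h1, h2⟩ := exists_eStep_of_le hle hne
    exact ⟨f₂, ⟨i, h1⟩, ih h2 (by have := h1.size_eq; omega)⟩

/-- A basis adapted to `f` and `f'` can be followed along elementary steps from `f` to `g`. -/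
lemma Reach.exists_adapted {k : ℕ} {f g f' : Flag K n d} (h : Reach k f g)
    (hb : ∃ (b : Basis (Fin d) K (Fin d → K)) (ρ γ : Fin d → Fin n),
      Adapted b ρ f ∧ Adapted b γ f') :
    ∃ (b : Basis (Fin d) K (Fin d → K)) (ρ γ : Fin d → Fin n),
      Adapted b ρ g ∧ Adapted b γ f' := by
  classical
  induction k generalizing f with
  | zero => cases h; exact hb
  | succ k ih =>
    obtain ⟨f₂, ⟨i, h1⟩, h2⟩ := h
    obtain ⟨b, ρ, γ, hρ, hγ⟩ := hb
    obtain ⟨ξ, h3, h4⟩ := h1.exists_dual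
    obtain ⟨y, hy⟩ := h1.exists_row hρ h3 h4
    obtain ⟨p, hp, hmin⟩ := Finset.exists_min_image
      (Finset.univ.filter fun y => ρ y = lo i ∧ ξ (b y) ≠ 0) γ ⟨y, by simpa using hy⟩
    simp only [Finset.mem_filter, Finset.mem_univ, true_and] at hp hmin
    obtain ⟨b', h5, h6, -⟩ := h1.exists_adapted hρ hγ h3 h4 hp.1 hp.2
      fun y hy1 hy2 => hmin y ⟨hy1, hy2⟩
    exact ih h2 ⟨b', _, _, h5, h6⟩

/-- Any two flags have a common adapted basis. -/
lemma exists_adapted [NeZero n] (f f' : Flag K n d) :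
    ∃ (b : Basis (Fin d) K (Fin d → K)) (ρ γ : Fin d → Fin n),
      Adapted b ρ f ∧ Adapted b γ f' := by
  -- both flags lie below the flag `0 ⊆ V ⊆ ⋯ ⊆ V`, to which every basis is adapted; an
  -- adapted basis is carried along a descent to `f`, and then along a descent to `f'`
  let b := Pi.basisFun K (Fin d)
  let T : Flag K n d := flagOf b (fun _ => 0)
  have hT : ∀ (f : Flag K n d) s, f.1 s ≤ T.1 s := fun f s => by
    by_cases hs : s = 0
    · rw [hs, f.2.2.1]; exact bot_le
    · have : T.1 s = ⊤ := by
        change span K (b '' {x | ((0 : Fin n) : ℕ) < s}) = ⊤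
        have hs' : ((0 : Fin n) : ℕ) < s := by
          have : (s : ℕ) ≠ 0 := fun h => hs (Fin.ext h)
          rw [Fin.val_zero]
          omega
        have : {x : Fin d | ((0 : Fin n) : ℕ) < s} = Set.univ :=
          Set.eq_univ_of_forall fun _ => hs'
        rw [this, Set.image_univ, b.span_eq]
      rw [this]; exact le_top
  have hR : ∀ f : Flag K n d, Reach (size T - size f) T f := fun f => by
    refine reach_of_le (hT f) ?_
    have : size f ≤ size T := Finset.sum_le_sum fun s _ => Submodule.finrank_mono (hT f s)
    omega
  obtain ⟨b1, ρ, γ, h1, h2⟩ := (hR f).exists_adapted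
    ⟨b, fun _ => 0, fun _ => 0, adapted_flagOf b _, adapted_flagOf b _⟩
  obtain ⟨b2, ρ2, γ2, h3, h4⟩ := (hR f').exists_adapted ⟨b1, γ, ρ, h2, h1⟩
  exact ⟨b2, γ2, ρ2, h4, h3⟩

/-- Every triple lies in some orbit. -/
lemma exists_orbit [NeZero n] (f f' : Flag K n d) (ω : Fin d → K) :
    ∃ X : DecMat n d, InOrbit X f f' ω := by
  classical
  obtain ⟨b, ρ, γ, h1, h2⟩ := exists_adapted f f'
  exact ⟨_, inOrbit_typ (Fintype.card_fin d) h1 h2 ω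
    (Finset.univ.filter fun x => b.repr ω x ≠ 0) (by simp)⟩

end Steps

/-! ### Counting elementary steps and translates by type -/

section Counting

open Submodule Module

variable {K : Type} [Field K] {n d : ℕ}

open Classical in
/-- The type of the triple obtained by an elementary step at `i` from a triple of type `X`, when the
step is cut out by a linear form whose set of nonzero coordinates is `σ`. The vector `p` that
changes its row is one with minimal column among those of `σ` in the row `i`. When `σ` does
not meet this row, the value is irrelevant. -/
def nextTyp (X : DecMat n d) (i : Fin (n - 1)) (σ : Finset X.Idx) : DecMat n d :=
  if h : (σ.filter fun y => y.1.1 = lo i).Nonempty then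
    let p := (Finset.exists_min_image _ (fun y : X.Idx => y.1.2) h).choose
    typ X.card_idx (Function.update (fun x : X.Idx => x.1.1) p (hi i)) (fun x => x.1.2)
      (X.marked.erase p ∪ if ∃ y ∈ X.marked, y.1.1 = lo i ∧ y ∈ σ then {p} else ∅)
  else X

open Classical in
lemma EStep.inOrbit_nextTyp {X : DecMat n d} {i : Fin (n - 1)} {f f₂ f' : Flag K n d}
    (h : EStep i f f₂) {b : Basis X.Idx K (Fin d → K)} (hρ : Adapted b (fun x => x.1.1) f)
    (hγ : Adapted b (fun x => x.1.2) f') {ξ : Dual K (Fin d → K)}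
    (h1 : f₂.1 (mid i) ≤ LinearMap.ker ξ) (h2 : ¬ f.1 (mid i) ≤ LinearMap.ker ξ) :
    InOrbit (nextTyp X i (Finset.univ.filter fun y => ξ (b y) ≠ 0)) f₂ f'
      (∑ x ∈ X.marked, b x) := by
  set σ : Finset X.Idx := Finset.univ.filter fun y => ξ (b y) ≠ 0 with hσ
  have hne : (σ.filter fun y => y.1.1 = lo i).Nonempty := by
    obtain ⟨y, hy1, hy2⟩ := h.exists_row hρ h1 h2
    exact ⟨y, by simp [hσ, hy1, hy2]⟩
  rw [nextTyp, dif_pos hne]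
  have hp := (Finset.exists_min_image _ (fun y : X.Idx => y.1.2) hne).choose_spec
  set p := (Finset.exists_min_image _ (fun y : X.Idx => y.1.2) hne).choose
  obtain ⟨hp1, hmin⟩ := hp
  simp only [hσ, Finset.mem_filter, Finset.mem_univ, true_and] at hp1 hmin
  obtain ⟨b', h3, h4, h5⟩ := h.exists_adapted hρ hγ h1 h2 hp1.2 hp1.1
    (fun y hy1 hy2 => hmin y ⟨hy2, hy1⟩)
  refine inOrbit_typ X.card_idx h3 h4 _ _ fun x => ?_
  rw [h5]
  simp only [repr_sum_basis, Finset.mem_union, Finset.mem_erase]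
  by_cases hx : x = p
  · subst hx
    rw [if_pos rfl, div_ne_zero_iff]
    simp only [ne_eq, not_true_eq_false, false_and, false_or]
    by_cases hex : ∃ y ∈ X.marked, y.1.1 = lo i ∧ y ∈ σ
    · rw [if_pos hex]
      obtain ⟨y, hy1, hy2, hy3⟩ := hex
      simp only [Finset.mem_singleton, true_iff]
      refine ⟨?_, hp1.1⟩
      -- there is at most one marked vector in a row, so no cancellation can occur
      rw [Finset.sum_eq_single y]
      · rw [if_pos hy1, one_mul]
        exact (Finset.mem_filter.1 hy3).2
      · intro z hz hzy
        simp only [Finset.mem_filter, Finset.mem_univ, true_and] at hz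
        rw [if_neg, zero_mul]
        intro hz1
        exact hzy (X.marked_injOn_row hz1 hy1 (hz.trans hy2.symm))
      · intro hy
        exact absurd (by simpa using hy2) hy
    · rw [if_neg hex]
      simp only [Finset.notMem_empty, false_iff, not_and_or, not_not]
      left
      refine Finset.sum_eq_zero fun z hz => ?_
      simp only [Finset.mem_filter, Finset.mem_univ, true_and] at hz
      by_cases hz1 : z ∈ X.marked
      · have : z ∉ σ := fun hz2 => hex ⟨z, hz1, hz, hz2⟩
        simp only [hσ, Finset.mem_filter, Finset.mem_univ, true_and, not_not] at this
        rw [this, mul_zero]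
      · rw [if_neg hz1, zero_mul]
  · rw [if_neg hx]
    have : x ∉ (if ∃ y ∈ X.marked, y.1.1 = lo i ∧ y ∈ σ then {p} else ∅ : Finset X.Idx) := by
      split_ifs <;> simp [hx]
    rw [eq_false this, or_false]
    simp only [ne_eq, hx, not_false_eq_true, true_and, ite_eq_right_iff, one_ne_zero, imp_false,
      not_not]

/-- Whether a linear form cuts out an elementary step can be read off from its nonzero
coordinates. -/
lemma dual_cuts_iff {ι : Type} [Fintype ι] {i : Fin (n - 1)} {f : Flag K n d}
    {b : Basis ι K (Fin d → K)} {ρ : ι → Fin n} (hρ : Adapted b ρ f) (ξ : Dual K (Fin d → K)) :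
    (f.1 (lo i).castSucc ≤ LinearMap.ker ξ ∧ ¬ f.1 (mid i) ≤ LinearMap.ker ξ) ↔
      (∀ y, ξ (b y) ≠ 0 → lo i ≤ ρ y) ∧ ∃ y, ξ (b y) ≠ 0 ∧ ρ y = lo i := by
  have key : ∀ s, f.1 s ≤ LinearMap.ker ξ ↔ ∀ y, (ρ y : ℕ) < s → ξ (b y) = 0 := fun s => by
    rw [hρ s, span_le]
    constructor
    · intro h y hy
      exact h ⟨y, hy, rfl⟩
    · rintro h _ ⟨y, hy, rfl⟩
      exact h y hy
  rw [key, key]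
  constructor
  · rintro ⟨h1, h2⟩
    push Not at h2
    obtain ⟨y, hy1, hy2⟩ := h2
    refine ⟨fun z hz => ?_, y, hy2, ?_⟩
    · by_contra hc
      rw [not_le, Fin.lt_def] at hc
      exact hz (h1 z hc)
    · by_contra hc
      rw [Fin.ext_iff, val_lo] at hc
      rw [val_mid] at hy1
      exact hy2 (h1 y (by rw [Fin.val_castSucc, val_lo]; omega))
  · rintro ⟨h1, y, hy1, hy2⟩
    refine ⟨fun z hz => ?_, fun h => hy1 (h y ?_)⟩
    · by_contra hc
      have := Fin.le_def.1 (h1 z hc)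
      rw [Fin.val_castSucc] at hz
      omega
    · rw [hy2, val_lo, val_mid]
      omega

/-- Vectors of coordinates with prescribed values outside `S`, counted by support. -/
lemma sum_by_support {ι R : Type*} [Fintype ι] [DecidableEq ι] [CommRing R] [Fintype K]
    [DecidableEq K] (S : Finset ι) (t : ι → K) (h : Finset ι → R) :
    (∑ c : ι → K with ∀ x ∉ S, c x = t x, h (Finset.univ.filter fun x => c x ≠ 0)) =
      ∑ σ : Finset ι with ∀ x ∉ S, (x ∈ σ ↔ t x ≠ 0),
        ((Nat.card K : R) - 1) ^ (σ ∩ S).card * h σ := by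
  have hmaps : ∀ c ∈ Finset.univ.filter (fun c : ι → K => ∀ x ∉ S, c x = t x),
      (Finset.univ.filter fun x => c x ≠ 0) ∈
        Finset.univ.filter fun σ : Finset ι => ∀ x ∉ S, (x ∈ σ ↔ t x ≠ 0) := by
    intro c hc
    simp only [Finset.mem_filter, Finset.mem_univ, true_and] at hc ⊢
    intro x hx
    rw [hc x hx]
  rw [← Finset.sum_fiberwise_of_maps_to hmaps]
  refine Finset.sum_congr rfl fun σ hσ => ?_
  simp only [Finset.mem_filter, Finset.mem_univ, true_and] at hσ
  have hfib : (Finset.univ.filter fun c : ι → K => ∀ x ∉ S, c x = t x).filter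
      (fun c => (Finset.univ.filter fun x => c x ≠ 0) = σ) =
      Fintype.piFinset fun x =>
        if x ∈ S then (if x ∈ σ then Finset.univ.erase 0 else {0}) else {t x} := by
    ext c
    simp only [Finset.mem_filter, Finset.mem_univ, true_and, Fintype.mem_piFinset,
      Finset.ext_iff]
    constructor
    · rintro ⟨h1, h2⟩ x
      split_ifs with hx hxσ
      · simpa using (h2 x).2 hxσ
      · simpa using fun hc => hxσ ((h2 x).1 hc)
      · simpa using h1 x hx
    · intro h1
      have h2 : ∀ x ∉ S, c x = t x := fun x hx => by
        have := h1 x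
        rwa [if_neg hx, Finset.mem_singleton] at this
      refine ⟨h2, fun x => ?_⟩
      by_cases hx : x ∈ S
      · have := h1 x
        rw [if_pos hx] at this
        by_cases hxσ : x ∈ σ
        · rw [if_pos hxσ] at this
          simp only [Finset.mem_erase, Finset.mem_univ, and_true] at this
          simp [hxσ, this]
        · rw [if_neg hxσ, Finset.mem_singleton] at this
          simp [hxσ, this]
      · rw [h2 x hx, hσ x hx]
  rw [Finset.sum_congr rfl fun c hc => by rw [(Finset.mem_filter.1 hc).2], Finset.sum_const, hfib,
    Fintype.card_piFinset, nsmul_eq_mul]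
  congr 1
  have hcard : ∀ x, (if x ∈ S then (if x ∈ σ then (Finset.univ.erase (0 : K)) else {0})
      else {t x}).card = if x ∈ σ ∩ S then Fintype.card K - 1 else 1 := by
    intro x
    by_cases hx : x ∈ S <;> by_cases hxσ : x ∈ σ <;> simp [hx, hxσ, Finset.card_erase_of_mem]
  simp only [hcard]
  rw [Finset.prod_ite_mem, Finset.univ_inter, Finset.prod_const, Nat.cast_pow,
    Nat.cast_sub Fintype.card_pos, Nat.cast_one, Nat.card_eq_fintype_card]

/-- The number of linear forms that vanish on `W` but not on `U`. -/
lemma card_duals_of_le [Finite K] {R : Type*} [CommRing R] {U W : Submodule K (Fin d → K)}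
    (hWU : W ≤ U) :
    (Nat.card {ξ : Dual K (Fin d → K) // W ≤ LinearMap.ker ξ ∧ ¬ U ≤ LinearMap.ker ξ} : R) =
      (Nat.card K : R) ^ (d - finrank K W) - (Nat.card K : R) ^ (d - finrank K U) := by
  classical
  have hfin : Finite (Dual K (Fin d → K)) := Module.finite_of_finite K
  have hann : ∀ Z : Submodule K (Fin d → K),
      Nat.card {ξ : Dual K (Fin d → K) // Z ≤ LinearMap.ker ξ} =
        Nat.card K ^ (d - finrank K Z) := fun Z => by
    have e1 := Subspace.finrank_add_finrank_dualAnnihilator_eq Z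
    rw [Module.finrank_fin_fun] at e1
    have e2 := Module.natCard_eq_pow_finrank (K := K) (V := Z.dualAnnihilator)
    rw [show d - finrank K Z = finrank K Z.dualAnnihilator by omega, ← e2]
    refine Nat.card_congr (Equiv.subtypeEquivRight fun ξ => ?_)
    rw [mem_dualAnnihilator]
    exact Iff.rfl
  have hsum : Nat.card {ξ : Dual K (Fin d → K) // W ≤ LinearMap.ker ξ} =
      Nat.card {ξ : Dual K (Fin d → K) // W ≤ LinearMap.ker ξ ∧ ¬ U ≤ LinearMap.ker ξ} +
      Nat.card {ξ : Dual K (Fin d → K) // U ≤ LinearMap.ker ξ} := by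
    have := Fintype.ofFinite (Dual K (Fin d → K))
    simp only [Nat.card_eq_fintype_card, Fintype.card_subtype]
    rw [← Finset.card_filter_add_card_filter_not 
      (s := Finset.univ.filter fun ξ : Dual K (Fin d → K) => W ≤ LinearMap.ker ξ)
      (fun ξ => ¬ U ≤ LinearMap.ker ξ), Finset.filter_filter,
      Finset.filter_filter]
    congr 2
    ext ξ
    simp only [Finset.mem_filter, Finset.mem_univ, true_and, not_not]
    exact ⟨fun h => h.2, fun h => ⟨hWU.trans h, h⟩⟩
  rw [hann, hann] at hsum
  have hsum' := congrArg (Nat.cast : ℕ → R) hsum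
  push_cast at hsum'
  linear_combination -hsum'

/-- The number of linear forms that cut out a given elementary step. -/
lemma card_duals [Finite K] {R : Type*} [CommRing R] {U W : Submodule K (Fin d → K)} (hWU : W ≤ U)
    (hd : finrank K U = finrank K W + 1) :
    (Nat.card {ξ : Dual K (Fin d → K) // W ≤ LinearMap.ker ξ ∧ ¬ U ≤ LinearMap.ker ξ} : R) =
      (Nat.card K : R) ^ (d - finrank K U) * ((Nat.card K : R) - 1) := by
  have hU : finrank K U ≤ d := (Submodule.finrank_le U).trans_eq (Module.finrank_fin_fun K)
  rw [card_duals_of_le hWU, show d - finrank K W = d - finrank K U + 1 by omega]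
  ring

open Classical in
/-- The sum over elementary steps of a function that depends only on the type of the resulting
triple. -/
lemma sum_eStep [Finite K] {R : Type*} [CommRing R] {X : DecMat n d} {i : Fin (n - 1)}
    {f f' : Flag K n d} {ω : Fin d → K} (hX : InOrbit X f f' ω) (G : Flag K n d → R)
    (c : DecMat n d → R) (hG : ∀ Y f₂, InOrbit Y f₂ f' ω → G f₂ = c Y) :
    (Nat.card K : R) ^ (d - X.rk (i + 1) n) * ((Nat.card K : R) - 1) *
      ∑ f₂ with EStep i f f₂, G f₂ =
    ∑ σ : Finset X.Idx, if (∀ y ∈ σ, lo i ≤ y.1.1) ∧ ∃ y ∈ σ, y.1.1 = lo i then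
      ((Nat.card K : R) - 1) ^ σ.card * c (nextTyp X i σ) else 0 := by
  obtain ⟨b, hρ, hγ, rfl⟩ := inOrbit_iff_adapted.1 hX
  have hfin : Finite (Dual K (Fin d → K)) := Module.finite_of_finite K
  have := Fintype.ofFinite (Dual K (Fin d → K))
  have := Fintype.ofFinite K
  have hrk : finrank K (f.1 (mid i)) = X.rk (i + 1) n := by
    have := hX.finrank_inf (mid i) (Fin.last n)
    rwa [f'.2.2.2, inf_top_eq, val_mid, Fin.val_last] at this
  let good : Finset X.Idx → Prop := fun σ =>
    (∀ y ∈ σ, lo i ≤ y.1.1) ∧ ∃ y ∈ σ, y.1.1 = lo i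
  let sp : Dual K (Fin d → K) → Finset X.Idx := fun ξ => Finset.univ.filter fun y => ξ (b y) ≠ 0
  have hgood : ∀ ξ, good (sp ξ) ↔
      f.1 (lo i).castSucc ≤ LinearMap.ker ξ ∧ ¬ f.1 (mid i) ≤ LinearMap.ker ξ := fun ξ => by
    rw [dual_cuts_iff hρ]
    simp [good, sp]
  -- the sum over the steps is replaced by a sum over the linear forms that cut them out, and the
  -- forms are sorted by their sets of nonzero coordinates
  have step1 : (Nat.card K : R) ^ (d - X.rk (i + 1) n) * ((Nat.card K : R) - 1) *
      ∑ f₂ with EStep i f f₂, G f₂ =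
      ∑ f₂ with EStep i f f₂, ∑ ξ : Dual K (Fin d → K),
        if f₂.1 (mid i) ≤ LinearMap.ker ξ ∧ ¬ f.1 (mid i) ≤ LinearMap.ker ξ then G f₂ else 0 := by
    rw [Finset.mul_sum]
    refine Finset.sum_congr rfl fun f₂ hf₂ => ?_
    have h := (Finset.mem_filter.1 hf₂).2
    rw [← hrk, ← card_duals (R := R) h.2.1 h.2.2, ← Finset.sum_filter, Finset.sum_const,
      nsmul_eq_mul, Nat.card_eq_fintype_card, Fintype.card_subtype]
  have step2 : ∀ ξ : Dual K (Fin d → K), (∑ f₂ with EStep i f f₂,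
      if f₂.1 (mid i) ≤ LinearMap.ker ξ ∧ ¬ f.1 (mid i) ≤ LinearMap.ker ξ then G f₂ else 0) =
      if good (sp ξ) then c (nextTyp X i (sp ξ)) else 0 := fun ξ => by
    by_cases hg : good (sp ξ)
    · rw [if_pos hg]
      obtain ⟨h1, h2⟩ := (hgood ξ).1 hg
      obtain ⟨f₂, ⟨h3, h4⟩, h5⟩ := existsUnique_eStep_of_dual i f h1 h2
      rw [Finset.sum_eq_single f₂]
      · rw [if_pos ⟨h4, h2⟩]
        exact hG _ _ (h3.inOrbit_nextTyp hρ hγ h4 h2)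
      · intro f₃ hf₃ hne
        rw [if_neg]
        intro h6
        exact hne (h5 _ ⟨(Finset.mem_filter.1 hf₃).2, h6.1⟩)
      · intro hf₂
        exact absurd (Finset.mem_filter.2 ⟨Finset.mem_univ _, h3⟩) hf₂
    · rw [if_neg hg]
      refine Finset.sum_eq_zero fun f₂ hf₂ => if_neg fun h => hg ((hgood ξ).2 ⟨?_, h.2⟩)
      have h3 := (Finset.mem_filter.1 hf₂).2
      rw [h3.castSucc_lo]
      exact (f₂.mono (castSucc_lo_lt_mid i).le).trans h.1
  rw [step1, Finset.sum_comm, Finset.sum_congr rfl fun ξ _ => step2 ξ]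
  have step3 := sum_by_support (K := K) (R := R) (Finset.univ : Finset X.Idx) 0
    (fun σ => if good σ then c (nextTyp X i σ) else 0)
  simp only [Finset.mem_univ, not_true_eq_false, false_imp_iff, implies_true, Finset.filter_true,
    Finset.inter_univ] at step3
  rw [← (b.constr K (M' := K)).toEquiv.sum_comp]
  refine Eq.trans ?_ (step3.trans (Finset.sum_congr rfl fun σ _ => by rw [mul_ite, mul_zero]))
  refine Finset.sum_congr rfl fun t _ => ?_
  have : sp ((b.constr K (M' := K)).toEquiv t) = Finset.univ.filter fun x => t x ≠ 0 := by
    refine Finset.filter_congr fun y _ => ?_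
    change (b.constr K t) (b y) ≠ 0 ↔ _
    rw [b.constr_basis]
  rw [this]

open Classical in
/-- The sum over a coset of a term of the flag of a function that depends only on the type of the
triple. -/
lemma sum_coset [Fintype K] {R : Type*} [CommRing R] {X : DecMat n d} {s : Fin (n + 1)}
    {f f' : Flag K n d} {ω : Fin d → K} (hX : InOrbit X f f' ω) (G : (Fin d → K) → R)
    (c : DecMat n d → R) (hG : ∀ Y ν, InOrbit Y f f' ν → G ν = c Y) :
    (∑ ν with ν - ω ∈ f.1 s, G ν) =
      ∑ σ : Finset X.Idx with ∀ x ∉ Finset.univ.filter (fun x : X.Idx => (x.1.1 : ℕ) < s),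
          (x ∈ σ ↔ x ∈ X.marked),
        ((Nat.card K : R) - 1) ^ (σ ∩ Finset.univ.filter fun x : X.Idx => (x.1.1 : ℕ) < s).card *
          c (typ X.card_idx (fun x : X.Idx => x.1.1) (fun x => x.1.2) σ) := by
  obtain ⟨b, hρ, hγ, rfl⟩ := inOrbit_iff_adapted.1 hX
  have h := sum_by_support (K := K) (R := R)
    (Finset.univ.filter fun x : X.Idx => (x.1.1 : ℕ) < s)
    (fun x => if x ∈ X.marked then 1 else 0)
    (fun σ => c (typ X.card_idx (fun x : X.Idx => x.1.1) (fun x => x.1.2) σ))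
  simp only [ne_eq, ite_eq_right_iff, one_ne_zero, imp_false, not_not] at h
  refine Eq.trans ?_ (h.trans (by congr!))
  rw [Finset.sum_filter, Finset.sum_filter, ← b.equivFun.symm.toEquiv.sum_comp]
  refine Finset.sum_congr rfl fun t _ => ?_
  have hrepr : ∀ x, b.repr (b.equivFun.symm t) x = t x := fun x => by
    rw [← b.equivFun_apply, LinearEquiv.apply_symm_apply]
  have h1 : (b.equivFun.symm t - ∑ x ∈ X.marked, b x ∈ f.1 s) ↔
      ∀ x ∉ Finset.univ.filter (fun x : X.Idx => (x.1.1 : ℕ) < s),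
        t x = if x ∈ X.marked then 1 else 0 := by
    rw [hρ.mem_iff]
    refine forall_congr' fun x => ?_
    rw [map_sub, Finsupp.sub_apply, hrepr, repr_sum_basis, sub_ne_zero]
    simp only [Finset.mem_filter, Finset.mem_univ, true_and]
    rw [Ne, not_imp_comm]
    congr!
  refine if_congr h1 ?_ rfl
  refine hG _ _ (inOrbit_typ X.card_idx hρ hγ _ _ fun x => ?_)
  rw [show b.equivFun.symm.toEquiv t = b.equivFun.symm t from rfl, hrepr]
  simp

end Counting

/-! ### Subspaces in the group algebra -/

section GroupAlgebra

open Submodule Module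

lemma finrank_sup_span_singleton {K : Type} [Field K] {d : ℕ}
    {N : Submodule K (Fin d → K)} {x : Fin d → K} (hx : x ∉ N) :
    finrank K (N ⊔ span K {x} : Submodule K (Fin d → K)) = finrank K N + 1 := by
  have h1 := Submodule.finrank_sup_add_finrank_inf_eq N (span K {x})
  have h2 : N ⊓ span K {x} = ⊥ := by
    rw [eq_bot_iff]
    rintro y ⟨hy, hy'⟩
    obtain ⟨a, rfl⟩ := mem_span_singleton.1 hy'
    by_cases ha : a = 0
    · simp [ha]
    · exact absurd ((smul_mem_iff _ ha).1 hy) hx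
  have hx0 : x ≠ 0 := fun h => hx (h ▸ zero_mem _)
  rw [h2, finrank_bot, finrank_span_singleton hx0] at h1
  omega


variable {K : Type} [Field K] [Fintype K] {R : Type} [CommRing R] {d : ℕ}

instance instFintypeSubmodule : Fintype (Submodule K (Fin d → K)) :=
  have : Finite (Submodule K (Fin d → K)) :=
    Finite.of_injective (fun S : Submodule K (Fin d → K) => (S : Set (Fin d → K)))
      SetLike.coe_injective
  Fintype.ofFinite _

open Classical in
/-- The characteristic function of a subspace, as an element of the group algebra. -/
def ind (R : Type) [CommRing R] (U : Submodule K (Fin d → K)) : AddMonoidAlgebra R (Fin d → K) :=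
  ∑ u with u ∈ U, AddMonoidAlgebra.single u 1

open Classical in
lemma coeff_ind (U : Submodule K (Fin d → K)) (ω : Fin d → K) :
    (ind R U).coeff ω = if ω ∈ U then 1 else 0 := by
  rw [ind, AddMonoidAlgebra.coeff_sum, Finsupp.finsetSum_apply]
  simp only [AddMonoidAlgebra.coeff_single, Finsupp.single_apply]
  rw [Finset.sum_ite_eq']
  simp

open Classical in
lemma coeff_ind_mul (U : Submodule K (Fin d → K)) (y : AddMonoidAlgebra R (Fin d → K))
    (ω : Fin d → K) : (ind R U * y).coeff ω = ∑ ν with ν - ω ∈ U, y.coeff ν := by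
  rw [ind, Finset.sum_mul, AddMonoidAlgebra.coeff_sum, Finsupp.finsetSum_apply]
  simp only [AddMonoidAlgebra.coeff_single_mul_apply, one_mul]
  refine Finset.sum_nbij' (fun u => -u + ω) (fun ν => ω - ν) ?_ ?_ ?_ ?_ ?_
  · intro u hu
    simpa using hu
  · intro ν hν
    simp only [Finset.mem_filter, Finset.mem_univ, true_and] at hν ⊢
    rw [← neg_sub]
    exact neg_mem hν
  · intro u _; simp
  · intro ν _; simp
  · intro u _; rfl

lemma ind_mul_ind (U W : Submodule K (Fin d → K)) :
    ind R U * ind R W = (Nat.card (U ⊓ W : Submodule K (Fin d → K)) : R) • ind R (U ⊔ W) := by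
  classical
  refine AddMonoidAlgebra.ext (Finsupp.ext fun ω => ?_)
  rw [coeff_ind_mul, AddMonoidAlgebra.coeff_smul, Finsupp.smul_apply, coeff_ind]
  simp only [coeff_ind]
  rw [Finset.sum_boole, Finset.filter_filter]
  split_ifs with h
  · rw [smul_eq_mul, mul_one]
    congr 1
    obtain ⟨u, hu, w, hw, rfl⟩ := Submodule.mem_sup.1 h
    rw [← Fintype.card_subtype, ← Nat.card_eq_fintype_card]
    refine Nat.card_congr
      { toFun := fun ν => ⟨ν.1 - w, ?_, sub_mem ν.2.2 hw⟩
        invFun := fun x => ⟨x.1 + w, ?_, add_mem x.2.2 hw⟩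
        left_inv := fun ν => Subtype.ext (sub_add_cancel _ _)
        right_inv := fun x => Subtype.ext (add_sub_cancel_right _ _) }
    · have := add_mem ν.2.1 hu
      rwa [show ν.1 - (u + w) + u = ν.1 - w by abel] at this
    · rw [show x.1 + w - (u + w) = x.1 - u by abel]
      exact sub_mem x.2.1 hu
  · rw [smul_zero, Finset.filter_eq_empty_iff.2, Finset.card_empty, Nat.cast_zero]
    rintro ν - ⟨h1, h2⟩
    apply h
    rw [show ω = -(ν - ω) + ν by abel]
    exact Submodule.add_mem_sup (neg_mem h1) h2

lemma ind_mul_ind_of_le {U W : Submodule K (Fin d → K)} (h : U ≤ W) :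
    ind R U * ind R W = (Nat.card U : R) • ind R W := by
  rw [ind_mul_ind, inf_eq_left.2 h, sup_eq_right.2 h]

open Classical in
/-- The subspaces `Z` with `N ≤ Z ≤ U` of dimension one more than `N`. -/
def between (N U : Submodule K (Fin d → K)) : Finset (Submodule K (Fin d → K)) :=
  Finset.univ.filter fun Z => N ≤ Z ∧ Z ≤ U ∧ finrank K Z = finrank K N + 1

lemma mem_between {N U Z : Submodule K (Fin d → K)} :
    Z ∈ between N U ↔ N ≤ Z ∧ Z ≤ U ∧ finrank K Z = finrank K N + 1 := by
  simp [between]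

lemma sum_ind_between {N U : Submodule K (Fin d → K)} (hNU : N ≤ U) :
    ∑ Z ∈ between N U, ind R Z = ind R U + (((between N U).card : R) - 1) • ind R N := by
  classical
  refine AddMonoidAlgebra.ext (Finsupp.ext fun ω => ?_)
  rw [AddMonoidAlgebra.coeff_sum, Finsupp.finsetSum_apply, AddMonoidAlgebra.coeff_add,
    AddMonoidAlgebra.coeff_smul, Finsupp.add_apply, Finsupp.smul_apply]
  simp only [coeff_ind]
  by_cases h1 : ω ∈ N
  · rw [if_pos h1, if_pos (hNU h1), Finset.sum_congr rfl fun Z hZ =>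
      if_pos ((mem_between.1 hZ).1 h1)]
    simp
  · rw [if_neg h1, smul_zero, add_zero]
    by_cases h2 : ω ∈ U
    · rw [if_pos h2, Finset.sum_eq_single (N ⊔ span K {ω})]
      · rw [if_pos (mem_sup_right (mem_span_singleton_self ω))]
      · intro Z hZ hne
        rw [if_neg]
        intro hω
        obtain ⟨h3, h4, h5⟩ := mem_between.1 hZ
        refine hne (eq_of_le_of_finrank_eq (sup_le h3 ?_) ?_).symm
        · rwa [span_singleton_le_iff_mem]
        · rw [finrank_sup_span_singleton h1, h5]
      · intro hc
        refine absurd (mem_between.2 ⟨le_sup_left, sup_le hNU ?_, ?_⟩) hc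
        · rwa [span_singleton_le_iff_mem]
        · exact finrank_sup_span_singleton h1
    · rw [if_neg h2]
      exact Finset.sum_eq_zero fun Z hZ => if_neg fun hω => h2 ((mem_between.1 hZ).2.1 hω)

lemma card_between {N U : Submodule K (Fin d → K)} (hNU : N ≤ U) :
    ((Nat.card K : R) - 1) * (between N U).card =
      (Nat.card K : R) ^ (finrank K U - finrank K N) - 1 := by
  classical
  -- the sums of the values of the two sides of `sum_ind_between` are compared
  have hq : (Nat.card K : ℚ) ≠ 0 := by
    rw [Nat.card_eq_fintype_card]; exact_mod_cast Fintype.card_ne_zero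
  have hsum : ∀ Z : Submodule K (Fin d → K),
      ∑ ω, (ind ℚ Z).coeff ω = (Nat.card K : ℚ) ^ finrank K Z := fun Z => by
    simp only [coeff_ind]
    rw [Finset.sum_boole, ← Fintype.card_subtype, ← Nat.card_eq_fintype_card, ← Nat.cast_pow,
      ← Module.natCard_eq_pow_finrank]
  have h := congrArg (fun y => ∑ ω, (AddMonoidAlgebra.coeff y) ω) (sum_ind_between (R := ℚ) hNU)
  simp only [AddMonoidAlgebra.coeff_sum, Finsupp.finsetSum_apply, AddMonoidAlgebra.coeff_add,
    AddMonoidAlgebra.coeff_smul, Finsupp.add_apply, Finsupp.smul_apply, Finset.sum_add_distrib,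
    hsum, smul_eq_mul] at h
  rw [Finset.sum_comm] at h
  simp only [hsum] at h
  rw [← Finset.mul_sum, hsum] at h
  rw [Finset.sum_congr rfl fun Z hZ => by rw [(mem_between.1 hZ).2.2], Finset.sum_const,
    nsmul_eq_mul] at h
  have hle := Submodule.finrank_mono hNU
  have e : ((Nat.card K : ℚ) - 1) * (between N U).card =
      (Nat.card K : ℚ) ^ (finrank K U - finrank K N) - 1 := by
    have e1 : (Nat.card K : ℚ) ^ finrank K U =
        (Nat.card K : ℚ) ^ (finrank K U - finrank K N) * (Nat.card K : ℚ) ^ finrank K N := by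
      rw [← pow_add, Nat.sub_add_cancel hle]
    have hN : (Nat.card K : ℚ) ^ finrank K N ≠ 0 := pow_ne_zero _ hq
    rw [e1, pow_succ] at h
    apply mul_right_cancel₀ hN
    linear_combination h
  have e2 : (((Nat.card K : ℤ) - 1) * (between N U).card : ℤ) =
      (Nat.card K : ℤ) ^ (finrank K U - finrank K N) - 1 := by exact_mod_cast e
  exact_mod_cast congrArg (Int.cast : ℤ → R) e2

end GroupAlgebra

/-! ### Operators of the convolution algebra -/

section Coefficients

variable {K : Type} [Field K] {R : Type} [CommRing R] {n d : ℕ}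

/-- The convolution algebra over `K` with coefficients in `R`. -/
abbrev CV (K R : Type) [Field K] [CommRing R] (n d : ℕ) : Type :=
  Matrix (Flag K n d) (Flag K n d) (AddMonoidAlgebra R (Fin d → K))

/-- The value of an element of the convolution algebra at a triple. -/
def cf {K R : Type} [Field K] [CommRing R] {n d : ℕ} (x : CV K R n d) (f f' : Flag K n d)
    (ω : Fin d → K) : R :=
  (x f f').coeff ω

lemma cf_ext {x y : CV K R n d} (h : ∀ f f' ω, cf x f f' ω = cf y f f' ω) : x = y := by
  refine Matrix.ext fun f f' => ?_
  exact AddMonoidAlgebra.ext (Finsupp.ext fun ω => h f f' ω)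

lemma cf_add (x y : CV K R n d) (f f' : Flag K n d) (ω : Fin d → K) :
    cf (x + y) f f' ω = cf x f f' ω + cf y f f' ω := rfl

lemma cf_zero (f f' : Flag K n d) (ω : Fin d → K) : cf (0 : CV K R n d) f f' ω = 0 := rfl

lemma cf_sum {ι : Type*} (S : Finset ι) (x : ι → CV K R n d) (f f' : Flag K n d)
    (ω : Fin d → K) : cf (∑ i ∈ S, x i) f f' ω = ∑ i ∈ S, cf (x i) f f' ω := by
  classical
  induction S using Finset.induction_on with
  | empty => rfl
  | insert a S ha ih => rw [Finset.sum_insert ha, Finset.sum_insert ha, cf_add, ih]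

lemma cf_transpose (x : CV K R n d) (f f' : Flag K n d) (ω : Fin d → K) :
    cf x.transpose f f' ω = cf x f' f ω := rfl

lemma algebraMap_mul_coeff (r : R) (y : AddMonoidAlgebra R (Fin d → K)) (ω : Fin d → K) :
    (algebraMap R (AddMonoidAlgebra R (Fin d → K)) r * y).coeff ω = r * y.coeff ω := by
  rw [← Algebra.smul_def, AddMonoidAlgebra.coeff_smul, Finsupp.smul_apply, smul_eq_mul]

end Coefficients

section Operators

open Submodule Module

variable {K : Type} [Field K] [Fintype K] {R : Type} [CommRing R] {n d : ℕ}

open Classical in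
/-- The characteristic function of the pairs `f' ⊂ f` that form an elementary step at `i`. -/
def Eh (K R : Type) [Field K] [CommRing R] {n d : ℕ} (i : Fin (n - 1)) :
    Matrix (Flag K n d) (Flag K n d) R :=
  Matrix.of fun f f' => if EStep i f f' then 1 else 0

/-- A matrix of scalars as an element of the convolution algebra, supported at `ω = 0`. -/
def sc : Matrix (Flag K n d) (Flag K n d) R →+* CV K R n d :=
  (algebraMap R (AddMonoidAlgebra R (Fin d → K))).mapMatrix

/-- The diagonal matrix of the characteristic functions of the terms `f_s`. -/
def Ind (K R : Type) [Field K] [Fintype K] [CommRing R] {n d : ℕ} (s : Fin (n + 1)) : CV K R n d :=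
  Matrix.diagonal fun f => ind R (f.1 s)

lemma cf_sc_mul (M : Matrix (Flag K n d) (Flag K n d) R) (x : CV K R n d) (f f' : Flag K n d)
    (ω : Fin d → K) : cf (sc M * x) f f' ω = ∑ f₂, M f f₂ * cf x f₂ f' ω := by
  unfold cf
  rw [Matrix.mul_apply, AddMonoidAlgebra.coeff_sum, Finsupp.finsetSum_apply]
  exact Finset.sum_congr rfl fun f₂ _ => algebraMap_mul_coeff _ _ _

open Classical in
lemma cf_Eh_mul (i : Fin (n - 1)) (x : CV K R n d) (f f' : Flag K n d)
    (ω : Fin d → K) : cf (sc (Eh K R i) * x) f f' ω = ∑ f₂ with EStep i f f₂, cf x f₂ f' ω := by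
  rw [cf_sc_mul, Finset.sum_filter]
  refine Finset.sum_congr rfl fun f₂ _ => ?_
  rw [Eh, Matrix.of_apply, ite_mul, one_mul, zero_mul]

lemma cf_diagonal_mul (φ : Flag K n d → R) (x : CV K R n d) (f f' : Flag K n d)
    (ω : Fin d → K) : cf (sc (Matrix.diagonal φ) * x) f f' ω = φ f * cf x f f' ω := by
  rw [cf_sc_mul, Finset.sum_eq_single f]
  · rw [Matrix.diagonal_apply_eq]
  · intro f₂ _ h
    rw [Matrix.diagonal_apply_ne _ h.symm, zero_mul]
  · exact fun h => absurd (Finset.mem_univ _) h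

open Classical in
lemma cf_Ind_mul (s : Fin (n + 1)) (x : CV K R n d) (f f' : Flag K n d)
    (ω : Fin d → K) : cf (Ind K R s * x) f f' ω = ∑ ν with ν - ω ∈ f.1 s, cf x f f' ν := by
  unfold cf Ind
  rw [Matrix.diagonal_mul, coeff_ind_mul]

/-- The product of the convolution algebra. -/
lemma cf_mul (x y : CV K R n d) (f f' : Flag K n d) (ω : Fin d → K) :
    cf (x * y) f f' ω = ∑ f₂, ∑ μ, cf x f f₂ μ * cf y f₂ f' (ω - μ) := by
  classical
  unfold cf
  rw [Matrix.mul_apply, AddMonoidAlgebra.coeff_sum, Finsupp.finsetSum_apply]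
  refine Finset.sum_congr rfl fun f₂ _ => ?_
  rw [AddMonoidAlgebra.coeff_mul_antidiag _ _ ω
    (Finset.univ.image fun μ : Fin d → K => (μ, ω - μ))]
  · rw [Finset.sum_image]
    intro a _ b _ h
    exact (Prod.ext_iff.1 h).1
  · intro p
    simp only [Finset.mem_image, Finset.mem_univ, true_and]
    constructor
    · rintro ⟨μ, rfl⟩
      simp
    · intro h
      exact ⟨p.1, Prod.ext rfl (by rw [← h]; simp)⟩

lemma sc_transpose (M : Matrix (Flag K n d) (Flag K n d) R) :
    (sc M : CV K R n d).transpose = sc M.transpose := rfl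

lemma cf_sc [DecidableEq (Fin d → K)] (M : Matrix (Flag K n d) (Flag K n d) R) (f f' : Flag K n d)
    (ω : Fin d → K) : cf (sc M) f f' ω = if ω = 0 then M f f' else 0 := by
  change (algebraMap R (AddMonoidAlgebra R (Fin d → K)) (M f f')).coeff ω = _
  rw [AddMonoidAlgebra.coe_algebraMap]
  simp only [Function.comp_apply, AddMonoidAlgebra.coeff_single, Finsupp.single_apply]
  exact if_congr eq_comm rfl rfl

lemma Ind_transpose (s : Fin (n + 1)) : (Ind K R s : CV K R n d).transpose = Ind K R s :=
  Matrix.diagonal_transpose _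

end Operators

/-! ### Families over all finite fields -/

section Families

open Submodule Module

namespace PrimePow

instance instFintypeF (Q : PrimePow) : Fintype Q.F := Fintype.ofFinite _

instance instLinearOrderVal (Q : PrimePow) : LinearOrder Q.Val := inferInstanceAs (LinearOrder ℝ)

instance instIsStrictOrderedRingVal (Q : PrimePow) : IsStrictOrderedRing Q.Val :=
  inferInstanceAs (IsStrictOrderedRing ℝ)

/-- The specialization of Laurent polynomials at `v = √q`. -/
def ev (Q : PrimePow) : Lau →+* Q.Val := algebraMap Lau Q.Val

/-- The number `√q`. -/
def rt (Q : PrimePow) : Q.Val := Real.sqrt Q.q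

lemma rt_pos (Q : PrimePow) : 0 < Q.rt :=
  Real.sqrt_pos.2 (by exact_mod_cast pow_pos Q.prime.pos _)

lemma rt_ne_zero (Q : PrimePow) : Q.rt ≠ 0 := Q.rt_pos.ne'

lemma natCard_F (Q : PrimePow) : Nat.card Q.F = Q.q := GaloisField.card Q.p Q.k Q.k_ne_zero

lemma rt_sq (Q : PrimePow) : Q.rt ^ 2 = (Nat.card Q.F : Q.Val) := by
  rw [natCard_F]
  exact Real.sq_sqrt (Nat.cast_nonneg _)

lemma ev_T (Q : PrimePow) (k : ℤ) : Q.ev (LaurentPolynomial.T k) = Q.rt ^ k := by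
  have h : Q.ev (LaurentPolynomial.T k) =
      (((Units.mk0 (Real.sqrt Q.q) Q.sqrt_q_ne_zero) ^ k : ℝˣ) : ℝ) :=
    LaurentPolynomial.eval₂_T (Int.castRingHom ℝ) (Units.mk0 (Real.sqrt Q.q) Q.sqrt_q_ne_zero) k
  rw [h, Units.val_zpow_eq_zpow_val, Units.val_mk0]
  rfl

lemma ev_T_two (Q : PrimePow) : Q.ev (LaurentPolynomial.T 2) = (Nat.card Q.F : Q.Val) := by
  rw [ev_T, ← rt_sq]
  rfl

/-- A Laurent polynomial is determined by its values at the numbers `√q`. -/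
lemma eq_zero_of_ev {p : Lau} (h : ∀ Q : PrimePow, Q.ev p = 0) : p = 0 := by
  obtain ⟨m, p', hp'⟩ := LaurentPolynomial.exists_T_pow p
  have hroot : ∀ k : ℕ,
      (p'.map (Int.castRingHom ℝ)).eval (Real.sqrt ((2 ^ (k + 1) : ℕ) : ℝ)) = 0 := by
    intro k
    let Q : PrimePow := ⟨2, k + 1, Nat.prime_two, by omega⟩
    have h1 : Q.ev (Polynomial.toLaurent p') = 0 := by rw [hp', map_mul, h Q, zero_mul]
    have h2 : Q.ev (Polynomial.toLaurent p') =
        Polynomial.eval₂ (Int.castRingHom ℝ) (Real.sqrt Q.q) p' :=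
      LaurentPolynomial.eval₂_toLaurent (Int.castRingHom ℝ)
        (Units.mk0 (Real.sqrt Q.q) Q.sqrt_q_ne_zero) p'
    rw [Polynomial.eval_map]
    exact h2.symm.trans h1
  have hinj : Function.Injective fun k : ℕ => Real.sqrt ((2 ^ (k + 1) : ℕ) : ℝ) := by
    intro a b hab
    have h1 := (Real.sqrt_inj (Nat.cast_nonneg _) (Nat.cast_nonneg _)).1 hab
    have h2 : 2 ^ (a + 1) = 2 ^ (b + 1) := by exact_mod_cast h1
    have := Nat.pow_right_injective le_rfl h2
    omega
  have h0 : p'.map (Int.castRingHom ℝ) = 0 :=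
    Polynomial.eq_zero_of_infinite_isRoot _
      ((Set.infinite_range_of_injective hinj).mono (by rintro _ ⟨k, rfl⟩; exact hroot k))
  have h1 : p' = 0 := by
    apply Polynomial.map_injective (Int.castRingHom ℝ) Int.cast_injective
    rw [h0, Polynomial.map_zero]
  rw [h1, map_zero] at hp'
  have := (LaurentPolynomial.isUnit_T (R := ℤ) m).mul_left_eq_zero.1 hp'.symm
  exact this

end PrimePow

variable {n d : ℕ}

lemma cf_smul (p : Lau) (Q : PrimePow) (x : Conv n d Q) (f f' : Flag Q.F n d) (ω : Fin d → Q.F) :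
    cf (R := Q.Val) (p • x) f f' ω = Q.ev p * cf (R := Q.Val) x f f' ω := by
  change (p • (x f f')).coeff ω = _
  rw [AddMonoidAlgebra.coeff_smul, Finsupp.smul_apply, Algebra.smul_def]
  rfl

open Classical in
lemma cf_e (X : DecMat n d) (Q : PrimePow) (f f' : Flag Q.F n d) (ω : Fin d → Q.F) :
    cf (R := Q.Val) (e X Q) f f' ω = if InOrbit X f f' ω then 1 else 0 := by
  unfold cf e
  simp [Finsupp.equivFunOnFinite]

/-- The values of the family on the orbits `𝒪_X` are given by elements of the fraction field of `𝒜`,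
independent of the finite field, with a common denominator. -/
def Uniform (x : ∀ Q, Conv n d Q) : Prop :=
  ∃ p : Lau, p ≠ 0 ∧ ∃ c : DecMat n d → Lau, ∀ (Q : PrimePow) (X : DecMat n d)
    (f f' : Flag Q.F n d) (ω : Fin d → Q.F), InOrbit X f f' ω →
      Q.ev p * cf (R := Q.Val) (x Q) f f' ω = Q.ev (c X)

lemma Uniform.add {x y : ∀ Q, Conv n d Q} (hx : Uniform x) (hy : Uniform y) : Uniform (x + y) := by
  obtain ⟨p, hp, c, hc⟩ := hx
  obtain ⟨p', hp', c', hc'⟩ := hy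
  refine ⟨p * p', mul_ne_zero hp hp', fun X => p' * c X + p * c' X, fun Q X f f' ω h => ?_⟩
  have h1 := hc Q X f f' ω h
  have h2 := hc' Q X f f' ω h
  rw [Pi.add_apply, cf_add, map_add, map_mul, map_mul, map_mul, ← h1, ← h2]
  ring

lemma uniform_zero : Uniform (0 : ∀ Q, Conv n d Q) :=
  ⟨1, one_ne_zero, 0, fun Q X f f' ω _ => by simp [cf_zero]⟩

/-- Transposition of the flags. -/
def DecMat.swap (X : DecMat n d) : DecMat n d where
  A := X.A.transpose
  Δ := X.Δ.map ⟨Prod.swap, Prod.swap_injective⟩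
  sum_eq := by
    exact Finset.sum_comm.trans X.sum_eq
  pos := by
    intro p hp
    obtain ⟨r, hr, rfl⟩ := Finset.mem_map.1 hp
    exact X.pos r hr
  anti := by
    intro p hp r hr hne
    obtain ⟨p', hp', rfl⟩ := Finset.mem_map.1 hp
    obtain ⟨r', hr', rfl⟩ := Finset.mem_map.1 hr
    rcases X.anti p' hp' r' hr' (fun h => hne (h ▸ rfl)) with h | h
    · exact Or.inr ⟨h.2, h.1⟩
    · exact Or.inl ⟨h.2, h.1⟩

lemma InOrbit.swap {K : Type} [Field K] {X : DecMat n d} {f f' : Flag K n d} {ω : Fin d → K}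
    (h : InOrbit X f f' ω) : InOrbit X.swap f' f ω := by
  obtain ⟨b, h1, h2, h3⟩ := h
  let eq : (Σ p : Fin n × Fin n, Fin (X.A p.1 p.2)) ≃
      Σ p : Fin n × Fin n, Fin (X.swap.A p.1 p.2) :=
    { toFun := fun x => ⟨x.1.swap, x.2⟩
      invFun := fun x => ⟨x.1.swap, x.2⟩
      left_inv := fun _ => rfl
      right_inv := fun _ => rfl }
  refine ⟨b.reindex eq, fun s => ?_, fun s => ?_, ?_⟩
  · rw [h2 s]
    congr 1
    ext w
    constructor
    · rintro ⟨x, hx, rfl⟩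
      exact ⟨eq x, hx, by simp⟩
    · rintro ⟨z, hz, rfl⟩
      exact ⟨eq.symm z, hz, by simp⟩
  · rw [h1 s]
    congr 1
    ext w
    constructor
    · rintro ⟨x, hx, rfl⟩
      exact ⟨eq x, hx, by simp⟩
    · rintro ⟨z, hz, rfl⟩
      exact ⟨eq.symm z, hz, by simp⟩
  · rw [h3]
    refine Finset.sum_bij (fun p _ => ⟨p.1.swap, Finset.mem_map_of_mem _ p.2⟩)
      (fun _ _ => Finset.mem_attach _ _) (fun p _ r _ h => ?_) (fun p _ => ?_) (fun p _ => ?_)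
    · exact Subtype.ext (Prod.swap_injective (congrArg Subtype.val h))
    · obtain ⟨r, hr, hrp⟩ := Finset.mem_map.1 p.2
      exact ⟨⟨r, hr⟩, Finset.mem_attach _ _, Subtype.ext hrp⟩
    · rw [Basis.reindex_apply]
      rfl

lemma Uniform.transpose {x : ∀ Q, Conv n d Q} (hx : Uniform x) :
    Uniform fun Q => (x Q).transpose := by
  obtain ⟨p, hp, c, hc⟩ := hx
  exact ⟨p, hp, fun X => c X.swap, fun Q X f f' ω h => hc Q X.swap f' f ω h.swap⟩

lemma ev_T_two_sub_one (Q : PrimePow) :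
    Q.ev (LaurentPolynomial.T 2 - 1) = (Nat.card Q.F : Q.Val) - 1 := by
  rw [map_sub, map_one, Q.ev_T_two]

lemma T_two_sub_one_ne_zero : (LaurentPolynomial.T 2 - 1 : Lau) ≠ 0 := by
  intro h
  have h1 := ev_T_two_sub_one ⟨2, 1, Nat.prime_two, one_ne_zero⟩
  rw [h, map_zero, PrimePow.natCard_F] at h1
  norm_num [PrimePow.q] at h1

open Classical in
/-- Uniformity is preserved by `Eh`: the sum over the elementary steps is a sum over subsets of the
index set of a basis, whose terms are polynomials in `q`. -/
lemma Uniform.Eh_mul {x : ∀ Q, Conv n d Q} (hx : Uniform x) (i : Fin (n - 1)) :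
    Uniform (n := n) (d := d) fun Q => sc (Eh Q.F Q.Val i) * x Q := by
  obtain ⟨p, hp, c, hc⟩ := hx
  refine ⟨(LaurentPolynomial.T 2 - 1) * p, mul_ne_zero T_two_sub_one_ne_zero hp, fun X =>
    LaurentPolynomial.T (-2 * ((d - X.rk (i + 1) n : ℕ) : ℤ)) *
    ∑ σ : Finset X.Idx, if (∀ y ∈ σ, lo i ≤ y.1.1) ∧ ∃ y ∈ σ, y.1.1 = lo i then
      (LaurentPolynomial.T 2 - 1) ^ σ.card * c (nextTyp X i σ) else 0, fun Q X f f' ω h => ?_⟩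
  have h1 := sum_eStep (R := Q.Val) (i := i) h
    (fun f₂ => Q.ev p * cf (R := Q.Val) (x Q) f₂ f' ω) (fun Y => Q.ev (c Y))
    (fun Y f₂ hY => hc Q Y f₂ f' ω hY)
  rw [cf_Eh_mul, map_mul, map_mul, ev_T_two_sub_one, map_sum]
  have h2 : ∀ σ : Finset X.Idx, Q.ev (if (∀ y ∈ σ, lo i ≤ y.1.1) ∧ ∃ y ∈ σ, y.1.1 = lo i then
      (LaurentPolynomial.T 2 - 1) ^ σ.card * c (nextTyp X i σ) else 0) =
      if (∀ y ∈ σ, lo i ≤ y.1.1) ∧ ∃ y ∈ σ, y.1.1 = lo i then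
        ((Nat.card Q.F : Q.Val) - 1) ^ σ.card * Q.ev (c (nextTyp X i σ)) else 0 := fun σ => by
    split_ifs
    · rw [map_mul, map_pow, ev_T_two_sub_one]
    · rw [map_zero]
  rw [Finset.sum_congr rfl fun σ _ => h2 σ, ← h1, ← Finset.mul_sum]
  have h3 : Q.ev (LaurentPolynomial.T (-2 * ((d - X.rk (i + 1) n : ℕ) : ℤ))) *
      (Nat.card Q.F : Q.Val) ^ (d - X.rk (i + 1) n) = 1 := by
    rw [Q.ev_T, ← Q.rt_sq, ← pow_mul, ← zpow_natCast, ← zpow_add₀ Q.rt_ne_zero]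
    push_cast
    rw [show -2 * ((d - X.rk (i + 1) n : ℕ) : ℤ) + 2 * ((d - X.rk (i + 1) n : ℕ) : ℤ) = 0 by ring,
      zpow_zero]
  linear_combination (-((Nat.card Q.F : Q.Val) - 1) * (Q.ev p *
    ∑ f₂ with EStep i f f₂, cf (R := Q.Val) (x Q) f₂ f' ω)) * h3

open Classical in
lemma Uniform.Ind_mul {x : ∀ Q, Conv n d Q} (hx : Uniform x) (s : Fin (n + 1)) :
    Uniform (n := n) (d := d) fun Q => Ind Q.F Q.Val s * x Q := by
  obtain ⟨p, hp, c, hc⟩ := hx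
  refine ⟨p, hp, fun X =>
    ∑ σ : Finset X.Idx with ∀ x ∉ Finset.univ.filter (fun x : X.Idx => (x.1.1 : ℕ) < s),
          (x ∈ σ ↔ x ∈ X.marked),
        (LaurentPolynomial.T 2 - 1) ^
          (σ ∩ Finset.univ.filter fun x : X.Idx => (x.1.1 : ℕ) < s).card *
          c (typ X.card_idx (fun x : X.Idx => x.1.1) (fun x => x.1.2) σ), fun Q X f f' ω h => ?_⟩
  have h1 := sum_coset (R := Q.Val) (s := s) h
    (fun ν => Q.ev p * cf (R := Q.Val) (x Q) f f' ν) (fun Y => Q.ev (c Y))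
    (fun Y ν hY => hc Q Y f f' ν hY)
  rw [cf_Ind_mul, Finset.mul_sum, h1, map_sum]
  refine Finset.sum_congr rfl fun σ _ => ?_
  rw [map_mul, map_pow, ev_T_two_sub_one]

/-- The dimensions of the terms of a flag. -/
def dims {K : Type} [Field K] (f : Flag K n d) (s : Fin (n + 1)) : ℕ := finrank K (f.1 s)

/-- The family of diagonal matrices given by a function of the dimensions of the flag. -/
def fdiag (φ : (Fin (n + 1) → ℕ) → Lau) : ∀ Q, Conv n d Q := fun Q =>
  sc (Matrix.diagonal fun f : Flag Q.F n d => Q.ev (φ (dims f)))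

lemma InOrbit.dims_left {K : Type} [Field K] {X : DecMat n d} {f f' : Flag K n d} {ω : Fin d → K}
    (h : InOrbit X f f' ω) : dims f = fun s : Fin (n + 1) => X.rk s n := by
  funext s
  have := h.finrank_inf s (Fin.last n)
  rwa [f'.2.2.2, inf_top_eq, Fin.val_last] at this

lemma InOrbit.dims_right {K : Type} [Field K] {X : DecMat n d} {f f' : Flag K n d} {ω : Fin d → K}
    (h : InOrbit X f f' ω) : dims f' = fun s : Fin (n + 1) => X.rk n s := by
  funext s
  have := h.finrank_inf (Fin.last n) s
  rwa [f.2.2.2, top_inf_eq, Fin.val_last] at this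

lemma Uniform.fdiag_mul {x : ∀ Q, Conv n d Q} (hx : Uniform x) (φ : (Fin (n + 1) → ℕ) → Lau) :
    Uniform (fdiag φ * x) := by
  obtain ⟨p, hp, c, hc⟩ := hx
  refine ⟨p, hp, fun X => φ (fun s : Fin (n + 1) => X.rk s n) * c X, fun Q X f f' ω h => ?_⟩
  rw [Pi.mul_apply, fdiag, cf_diagonal_mul, h.dims_left, map_mul, ← hc Q X f f' ω h]
  ring

lemma InOrbit.vec_eq_zero_iff {K : Type} [Field K] {X : DecMat n d} {f f' : Flag K n d}
    {ω : Fin d → K} (h : InOrbit X f f' ω) : ω = 0 ↔ X.Δ = ∅ := by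
  constructor
  · rintro rfl
    rw [Finset.eq_empty_iff_forall_notMem]
    intro p hp
    exact (h.dom_iff p.1 p.2).1 ⟨p, hp, le_rfl, le_rfl⟩ (zero_mem _)
  · intro h0
    obtain ⟨b, -, -, rfl⟩ := inOrbit_iff_adapted.1 h
    refine Finset.sum_eq_zero fun x hx => ?_
    have := (DecMat.mem_marked.1 hx).1
    rw [h0] at this
    exact absurd this (Finset.notMem_empty _)

lemma InOrbit.flag_eq_iff {K : Type} [Field K] {X : DecMat n d} {f f' : Flag K n d}
    {ω : Fin d → K} (h : InOrbit X f f' ω) : f = f' ↔ X.A.IsDiag := by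
  obtain ⟨b, h1, h2, -⟩ := inOrbit_iff_adapted.1 h
  constructor
  · rintro rfl i j hij
    by_contra hc
    let x : X.Idx := ⟨(i, j), ⟨0, Nat.pos_of_ne_zero hc⟩⟩
    have key : ∀ s : Fin (n + 1), (i : ℕ) < s ↔ (j : ℕ) < s := fun s =>
      (h1.basis_mem_iff s x).symm.trans (h2.basis_mem_iff s x)
    have k1 := key i.succ
    have k2 := key j.succ
    rw [Fin.val_succ] at k1 k2
    exact hij (Fin.ext (by omega))
  · intro hd
    refine Flag.ext' fun s => ?_
    rw [h1 s, h2 s]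
    congr 2
    ext x
    have hx : x.1.1 = x.1.2 := by
      by_contra hc
      have h3 : X.A x.1.1 x.1.2 = 0 := hd hc
      exact (Fin.cast h3 x.2).elim0
    change (x.1.1 : ℕ) < s ↔ (x.1.2 : ℕ) < s
    rw [hx]

open Classical in
lemma uniform_one : Uniform (1 : ∀ Q, Conv n d Q) := by
  refine ⟨1, one_ne_zero, fun X => if X.A.IsDiag ∧ X.Δ = ∅ then 1 else 0, fun Q X f f' ω h => ?_⟩
  rw [map_one, one_mul, Pi.one_apply, ← map_one (sc (K := Q.F) (R := Q.Val)), cf_sc,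
    Matrix.one_apply]
  beta_reduce
  simp only [← h.flag_eq_iff, ← h.vec_eq_zero_iff]
  by_cases h1 : ω = 0 <;> by_cases h2 : f = f' <;> simp [h1, h2]

end Families

/-! ### Chains of flags -/

section Chains

open Submodule Module

variable {n d : ℕ}

/-- The term of `f` with index `s`, or zero if there is no index. -/
def optSpace {K : Type} [Field K] (f : Flag K n d) : Option (Fin (n + 1)) → Submodule K (Fin d → K)
  | none => ⊥
  | some s => f.1 s

/-- There is a descending chain of flags `f = g_t ≥ ⋯ ≥ g_0 = h` with prescribed dimensions
`dims g_u = r u`, and `ω` is a sum of vectors from the spaces `optSpace g_u (J u)`, `1 ≤ u ≤ t`. -/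
def ChainRel {K : Type} [Field K] (r : ℕ → Fin (n + 1) → ℕ) (J : ℕ → Option (Fin (n + 1))) :
    ℕ → Flag K n d → Flag K n d → (Fin d → K) → Prop
  | 0, f, h, ω => f = h ∧ ω = 0 ∧ dims f = r 0
  | t + 1, f, h, ω => dims f = r (t + 1) ∧ ∃ w ∈ optSpace f (J (t + 1)), ∃ g : Flag K n d,
      (∀ s, g.1 s ≤ f.1 s) ∧ ChainRel r J t g h (ω - w)

variable {K : Type} [Field K] {r : ℕ → Fin (n + 1) → ℕ} {J : ℕ → Option (Fin (n + 1))}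

lemma ChainRel.dims_eq {t : ℕ} {f h : Flag K n d} {ω : Fin d → K} (H : ChainRel r J t f h ω) :
    dims f = r t := by
  cases t with
  | zero => exact H.2.2
  | succ t => exact H.1

lemma ChainRel.exists_flags {t : ℕ} {f h : Flag K n d} {ω : Fin d → K}
    (H : ChainRel r J t f h ω) :
    ∃ g : ℕ → Flag K n d, (∀ u ≤ t, (∀ s, (g u).1 s ≤ f.1 s) ∧ (∀ s, h.1 s ≤ (g u).1 s) ∧
      dims (g u) = r u) ∧ g 0 = h ∧
      ∀ U : Submodule K (Fin d → K), (∀ u ≤ t, u ≠ 0 → optSpace (g u) (J u) ≤ U) → ω ∈ U := by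
  induction t generalizing f ω with
  | zero =>
    obtain ⟨rfl, rfl, h3⟩ := H
    refine ⟨fun _ => f, fun u hu => ⟨fun _ => le_rfl, fun _ => le_rfl, ?_⟩, rfl,
      fun U _ => zero_mem U⟩
    rw [Nat.le_zero.1 hu, h3]
  | succ t ih =>
    obtain ⟨h1, w, hw, g, hg, hrec⟩ := H
    obtain ⟨g', h2, h2', h3⟩ := ih hrec
    have hfh : ∀ s, h.1 s ≤ f.1 s := fun s =>
      (((h2 0 (Nat.zero_le _)).2.1 s).trans ((h2 0 (Nat.zero_le _)).1 s)).trans (hg s)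
    refine ⟨Function.update g' (t + 1) f, fun u hu => ?_, ?_, fun U hU => ?_⟩
    · by_cases hut : u = t + 1
      · subst hut
        rw [Function.update_self]
        exact ⟨fun _ => le_rfl, hfh, h1⟩
      · rw [Function.update_of_ne hut]
        obtain ⟨h4, h5, h6⟩ := h2 u (by omega)
        exact ⟨fun s => (h4 s).trans (hg s), h5, h6⟩
    · rw [Function.update_of_ne (by omega), h2']
    · have e1 : ω - w ∈ U := h3 U fun u hu hu0 => by
        have := hU u (by omega) hu0
        rwa [Function.update_of_ne (by omega)] at this
      have e2 : w ∈ U := by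
        have := hU (t + 1) le_rfl (by omega)
        rw [Function.update_self] at this
        exact this hw
      rw [show ω = (ω - w) + w by abel]
      exact add_mem e1 e2

lemma chainRel_of_flags (g : ℕ → Flag K n d) (w : ℕ → Fin d → K) (t : ℕ)
    (h1 : ∀ u ≤ t, dims (g u) = r u) (h2 : ∀ u < t, ∀ s, (g u).1 s ≤ (g (u + 1)).1 s)
    (h3 : ∀ u < t, w u ∈ optSpace (g (u + 1)) (J (u + 1))) :
    ChainRel r J t (g t) (g 0) (∑ u ∈ Finset.range t, w u) := by
  induction t with
  | zero => exact ⟨rfl, rfl, h1 0 le_rfl⟩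
  | succ t ih =>
    refine ⟨h1 _ le_rfl, w t, h3 t (Nat.lt_succ_self t), g t, h2 t (Nat.lt_succ_self t), ?_⟩
    rw [Finset.sum_range_succ, add_sub_cancel_right]
    exact ih (fun u hu => h1 u (by omega)) (fun u hu => h2 u (by omega))
      (fun u hu => h3 u (by omega))

namespace DecMat

variable (X : DecMat n d)

/-- The dimensions of the flag `V_s ∩ V'_{max(s, t)}` in the relative position `X`. -/
def table (t : ℕ) (s : Fin (n + 1)) : ℕ := X.rk s (max s (min t n))

open Classical in
/-- The term of the `t`-th flag of a chain to which a circled position `(i, j)` with `i ≤ j` in the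
column `t = j + 1` gives rise. -/
def jump (t : ℕ) : Option (Fin (n + 1)) :=
  if h : ∃ i : Fin n, ∃ j : Fin n, (i, j) ∈ X.Δ ∧ i ≤ j ∧ (j : ℕ) + 1 = t then
    some h.choose.succ else none

lemma jump_eq_some {i j : Fin n} (h : (i, j) ∈ X.Δ) (hij : i ≤ j) :
    X.jump ((j : ℕ) + 1) = some i.succ := by
  have hex : ∃ i : Fin n, ∃ j' : Fin n, (i, j') ∈ X.Δ ∧ i ≤ j' ∧ (j' : ℕ) + 1 = (j : ℕ) + 1 :=
    ⟨i, j, h, hij, rfl⟩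
  rw [jump, dif_pos hex]
  obtain ⟨j', h1, -, h2⟩ := hex.choose_spec
  have hj : j' = j := Fin.ext (by omega)
  subst hj
  congr 2
  by_contra hne
  rcases X.anti _ h1 _ h (fun e => hne (congrArg Prod.fst e)) with h3 | h3
  · exact lt_irrefl _ h3.2
  · exact lt_irrefl _ h3.2

lemma exists_of_jump_eq_some {t : ℕ} {s : Fin (n + 1)} (h : X.jump t = some s) :
    ∃ i j : Fin n, (i, j) ∈ X.Δ ∧ i ≤ j ∧ (j : ℕ) + 1 = t ∧ s = i.succ := by
  unfold jump at h
  split_ifs at h with hex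
  obtain ⟨j, h1, h2, h3⟩ := hex.choose_spec
  exact ⟨_, j, h1, h2, h3, (Option.some.inj h).symm⟩

end DecMat

/-- The flag `V_s ∩ V'_{max(s, t)}`. -/
def meetFlag (f f' : Flag K n d) (t : ℕ) : Flag K n d :=
  ⟨fun s => f.1 s ⊓ f'.1 ⟨max s (min t n), by omega⟩, by
    refine ⟨?_, ?_, ?_⟩
    · intro a b hab
      refine inf_le_inf (f.mono hab) (f'.mono ?_)
      rw [Fin.le_def] at hab ⊢
      exact max_le_max hab le_rfl
    · change f.1 0 ⊓ _ = ⊥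
      rw [f.2.2.1, bot_inf_eq]
    · change f.1 (Fin.last n) ⊓ f'.1 _ = ⊤
      have e : (⟨max (Fin.last n : ℕ) (min t n), by rw [Fin.val_last]; omega⟩ : Fin (n + 1)) =
          Fin.last n := Fin.ext (by change max n (min t n) = n; omega)
      rw [f.2.2.2, top_inf_eq]
      exact (congrArg f'.1 e).trans f'.2.2.2⟩

lemma meetFlag_apply (f f' : Flag K n d) (t : ℕ) (s : Fin (n + 1)) :
    (meetFlag f f' t).1 s = f.1 s ⊓ f'.1 ⟨max s (min t n), by omega⟩ := rfl

lemma meetFlag_last (f f' : Flag K n d) : meetFlag f f' n = f := by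
  refine Flag.ext' fun s => ?_
  rw [meetFlag_apply]
  have : (⟨max s (min n n), by omega⟩ : Fin (n + 1)) = Fin.last n :=
    Fin.ext (by change max (s : ℕ) (min n n) = n; omega)
  rw [this, f'.2.2.2, inf_top_eq]

lemma meetFlag_zero_comm (f f' : Flag K n d) : meetFlag f f' 0 = meetFlag f' f 0 := by
  refine Flag.ext' fun s => ?_
  rw [meetFlag_apply, meetFlag_apply]
  have : (⟨max s (min 0 n), by omega⟩ : Fin (n + 1)) = s :=
    Fin.ext (by change max (s : ℕ) (min 0 n) = s; omega)
  rw [this, inf_comm]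

/-- For a triple of type `X` the chain of flags `V_s ∩ V'_{max(s, t)}` exists. -/
lemma InOrbit.chainRel {X : DecMat n d} {f f' : Flag K n d} {ω : Fin d → K}
    (h : InOrbit X f f' ω) (w : Fin n × Fin n → Fin d → K)
    (hw : ∀ p ∈ X.Δ, p.1 ≤ p.2 → w p ∈ f.1 p.1.succ ⊓ f'.1 p.2.succ) :
    ChainRel X.table X.jump n f (meetFlag f f' 0) (∑ p ∈ X.Δ with p.1 ≤ p.2, w p) := by
  classical
  have H := chainRel_of_flags (r := X.table) (J := X.jump) (meetFlag f f')
    (fun u => ∑ p ∈ X.Δ with p.1 ≤ p.2 ∧ (p.2 : ℕ) = u, w p) n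
    (fun u _ => by
      funext s
      exact h.finrank_inf s ⟨max s (min u n), by omega⟩)
    (fun u hu s => by
      refine inf_le_inf le_rfl (f'.mono ?_)
      rw [Fin.le_def]
      change max (s : ℕ) (min u n) ≤ max (s : ℕ) (min (u + 1) n)
      omega)
    (fun u hu => by
      refine sum_mem fun p hp => ?_
      simp only [Finset.mem_filter] at hp
      obtain ⟨h1, h2, h3⟩ := hp
      rw [← h3, X.jump_eq_some (i := p.1) (j := p.2) h1 h2]
      have h4 := hw p h1 h2
      refine ⟨h4.1, ?_⟩
      have : (⟨max p.1.succ (min ((p.2 : ℕ) + 1) n), by omega⟩ : Fin (n + 1)) = p.2.succ := by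
        refine Fin.ext ?_
        have := Fin.le_def.1 h2
        have := p.2.2
        change max ((p.1 : ℕ) + 1) (min ((p.2 : ℕ) + 1) n) = (p.2 : ℕ) + 1
        omega
      change w p ∈ f'.1 ⟨max p.1.succ (min ((p.2 : ℕ) + 1) n), _⟩
      rw [this]
      exact h4.2)
  rw [meetFlag_last] at H
  convert H using 1
  rw [← Finset.sum_fiberwise_of_maps_to (t := Finset.range n) (g := fun p => (p.2 : ℕ))
    (fun p _ => Finset.mem_range.2 p.2.2)]
  refine Finset.sum_congr rfl fun u _ => ?_
  rw [Finset.filter_filter]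

/-- The relative position of `f` and a flag `f'` above the last term of a chain starting at `f`: the
term `s` of the `t`-th flag lies in `f_s ∩ f'_t`, and it is all of it if the dimensions agree. -/
lemma ChainRel.le_inf {X : DecMat n d} {f f' h : Flag K n d} {ω : Fin d → K}
    (H : ChainRel X.table X.jump n f h ω) (hh : ∀ s, h.1 s ≤ f'.1 s) :
    (∀ s t : Fin (n + 1), s ≤ t →
      X.rk s t ≤ finrank K (f.1 s ⊓ f'.1 t : Submodule K (Fin d → K))) ∧
    ((∀ s t : Fin (n + 1), finrank K (f.1 s ⊓ f'.1 t : Submodule K (Fin d → K)) = X.rk s t) →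
      ∀ U : Submodule K (Fin d → K),
        (∀ p ∈ X.Δ, f.1 p.1.succ ⊓ f'.1 p.2.succ ≤ U) → ω ∈ U) := by
  obtain ⟨g, h1, h2, h3⟩ := H.exists_flags
  have hdim : ∀ u ≤ n, ∀ s : Fin (n + 1), finrank K ((g u).1 s) = X.table u s := fun u hu s =>
    congrFun (h1 u hu).2.2 s
  have key : ∀ s t : Fin (n + 1), s ≤ t → (g t).1 s ≤ f.1 s ⊓ f'.1 t := by
    intro s t hst
    have ht : (t : ℕ) ≤ n := by omega
    refine _root_.le_inf ((h1 t ht).1 s) (((g t).mono hst).trans ?_)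
    -- the `t`-th term has the same prescribed dimension in `g_t` and in `g_0 = h`
    have e : h.1 t = (g t).1 t := by
      refine eq_of_le_of_finrank_eq ((h1 t ht).2.1 t) ?_
      have e1 := hdim t ht t
      have e2 := hdim 0 (Nat.zero_le _) t
      rw [h2] at e2
      rw [e1, e2, DecMat.table, DecMat.table]
      congr 1
      omega
    rw [← e]
    exact hh t
  have hrk : ∀ s t : Fin (n + 1), s ≤ t → finrank K ((g t).1 s) = X.rk s t := by
    intro s t hst
    have ht : (t : ℕ) ≤ n := by omega
    rw [hdim t ht, DecMat.table]
    congr 1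
    have := Fin.le_def.1 hst
    omega
  refine ⟨fun s t hst => ?_, fun heq U hU => h3 U fun u hu hu0 => ?_⟩
  · rw [← hrk s t hst]
    exact Submodule.finrank_mono (key s t hst)
  · cases hj : X.jump u with
    | none => exact bot_le
    | some s =>
      obtain ⟨i, j, h4, h5, h6, rfl⟩ := X.exists_of_jump_eq_some hj
      have hij : i.succ ≤ j.succ := Fin.succ_le_succ_iff.2 h5
      have e : (g u).1 i.succ = f.1 i.succ ⊓ f'.1 j.succ := by
        have hu' : ((j.succ : Fin (n + 1)) : ℕ) = u := by rw [Fin.val_succ, h6]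
        rw [← hu']
        refine eq_of_le_of_finrank_eq (key _ _ hij) ?_
        rw [hrk _ _ hij, heq]
      change (g u).1 i.succ ≤ U
      rw [e]
      exact hU _ h4

lemma DecMat.swap_rk (X : DecMat n d) (s t : ℕ) : X.swap.rk s t = X.rk t s := by
  unfold DecMat.rk
  refine Finset.card_bij (fun x _ => (⟨x.1.swap, x.2⟩ : X.Idx)) ?_ ?_ ?_
  · intro x hx
    simp only [Finset.mem_filter, Finset.mem_univ, true_and] at hx ⊢
    exact ⟨hx.2, hx.1⟩
  · rintro ⟨⟨a, b⟩, k⟩ _ ⟨⟨a', b'⟩, k'⟩ _ h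
    have h1 := (Sigma.mk.inj h).1
    simp only [Prod.swap_prod_mk, Prod.mk.injEq] at h1
    obtain ⟨rfl, rfl⟩ := h1
    have h2 := eq_of_heq (Sigma.mk.inj h).2
    exact congrArg (Sigma.mk (a, b)) h2
  · rintro ⟨⟨a, b⟩, k⟩ hx
    simp only [Finset.mem_filter, Finset.mem_univ, true_and] at hx ⊢
    exact ⟨⟨(b, a), k⟩, ⟨hx.2, hx.1⟩, rfl⟩

lemma DecMat.mem_swap_Δ {X : DecMat n d} {p : Fin n × Fin n} : p ∈ X.swap.Δ ↔ p.swap ∈ X.Δ := by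
  constructor
  · intro h
    obtain ⟨r, hr, rfl⟩ := Finset.mem_map.1 h
    exact hr
  · intro h
    exact Finset.mem_map.2 ⟨p.swap, h, Prod.swap_swap p⟩

/-- The relation satisfied by a triple in the support of the product of the two chains of `X`. -/
def GlueRel (X : DecMat n d) (f f' : Flag K n d) (ω : Fin d → K) : Prop :=
  ∃ h μ, ChainRel X.table X.jump n f h μ ∧ ChainRel X.swap.table X.swap.jump n f' h (ω - μ)

/-- A triple of type `X` is in the support of the product of the chains of `X`; the circled
positions on or above the diagonal are taken care of by the first chain, the others by the
second chain. -/
lemma InOrbit.glueRel {X : DecMat n d} {f f' : Flag K n d} {ω : Fin d → K}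
    (h : InOrbit X f f' ω) : GlueRel X f f' ω := by
  classical
  obtain ⟨b, h1, h2, h3⟩ := inOrbit_iff_adapted.1 h
  let w : Fin n × Fin n → Fin d → K := fun p => ∑ x ∈ X.marked with x.1 = p, b x
  have hw : ∀ p, w p ∈ f.1 p.1.succ ⊓ f'.1 p.2.succ := fun p => by
    refine sum_mem fun x hx => ?_
    obtain ⟨-, rfl⟩ := Finset.mem_filter.1 hx
    refine ⟨(h1.basis_mem_iff _ _).2 ?_, (h2.basis_mem_iff _ _).2 ?_⟩
    · rw [Fin.val_succ]; omega
    · rw [Fin.val_succ]; omega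
  have hω : ω = ∑ p ∈ X.Δ, w p := by
    rw [h3]
    exact (Finset.sum_fiberwise_of_maps_to (fun x hx => (DecMat.mem_marked.1 hx).1) _).symm
  have c1 := h.chainRel w (fun p _ _ => hw p)
  have c2 := h.swap.chainRel (fun p => if p.1 = p.2 then 0 else w p.swap) (fun p _ _ => by
    split_ifs
    · exact zero_mem _
    · exact ⟨(hw p.swap).2, (hw p.swap).1⟩)
  refine ⟨_, _, c1, ?_⟩
  rw [meetFlag_zero_comm]
  convert c2 using 1
  rw [hω, sub_eq_iff_eq_add, ← Finset.sum_filter_add_sum_filter_not X.Δ (fun p => p.1 ≤ p.2),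
    add_comm]
  congr 1
  symm
  rw [Finset.sum_ite, Finset.sum_const_zero, zero_add, Finset.filter_filter]
  refine Finset.sum_bij (fun p _ => p.swap) ?_ (fun _ _ _ _ h => Prod.swap_injective h) ?_ ?_
  · intro p hp
    simp only [Finset.mem_filter, DecMat.mem_swap_Δ] at hp ⊢
    exact ⟨hp.1, not_le.2 (lt_of_le_of_ne hp.2.1 hp.2.2)⟩
  · intro p hp
    simp only [Finset.mem_filter, not_le] at hp
    refine ⟨p.swap, ?_, Prod.swap_swap p⟩
    simp only [Finset.mem_filter, DecMat.mem_swap_Δ, Prod.swap_swap]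
    exact ⟨hp.1, hp.2.le, hp.2.ne⟩
  · intro p _
    rfl

/-- A triple in the support of the product of the chains of `X` lies in an orbit whose relative
position is at least as special as that of `X`, and which, in case of equality, dominates no
position that `X` does not dominate. -/
lemma GlueRel.le {X Y : DecMat n d} {f f' : Flag K n d} {ω : Fin d → K}
    (H : GlueRel X f f' ω) (hY : InOrbit Y f f' ω) :
    (∀ s t : Fin (n + 1), X.rk s t ≤ Y.rk s t) ∧
      ((∀ s t : Fin (n + 1), Y.rk s t = X.rk s t) → ∀ i j, Y.Dom i j → X.Dom i j) := by
  obtain ⟨h, μ, c1, c2⟩ := H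
  obtain ⟨g, h1, h2, -⟩ := c1.exists_flags
  obtain ⟨g', h1', h2', -⟩ := c2.exists_flags
  have hf : ∀ s, h.1 s ≤ f.1 s := fun s => h2 ▸ (h1 0 (Nat.zero_le _)).1 s
  have hf' : ∀ s, h.1 s ≤ f'.1 s := fun s => h2' ▸ (h1' 0 (Nat.zero_le _)).1 s
  obtain ⟨a1, a2⟩ := c1.le_inf hf'
  obtain ⟨b1, b2⟩ := c2.le_inf hf
  refine ⟨fun s t => ?_, fun heq i j hd => ?_⟩
  · rw [← hY.finrank_inf]
    rcases le_total s t with hst | hst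
    · exact a1 s t hst
    · have := b1 t s hst
      rwa [X.swap_rk, inf_comm] at this
  · by_contra hn
    rw [hY.dom_iff] at hd
    -- the vector is a sum of vectors of the spaces `f_{i'+1} ∩ f'_{j'+1}`, `(i', j') ∈ Δ`, which
    -- lie in `f_i + f'_j` unless `(i', j')` dominates `(i, j)`
    have hU : ∀ p ∈ X.Δ, f.1 p.1.succ ⊓ f'.1 p.2.succ ≤ f.1 i.castSucc ⊔ f'.1 j.castSucc := by
      intro p hp
      have : p.1 < i ∨ p.2 < j := by
        by_contra hc
        push Not at hc
        exact hn ⟨p, hp, hc⟩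
      rcases this with h3 | h3
      · refine inf_le_left.trans ((f.mono ?_).trans le_sup_left)
        rw [Fin.le_def, Fin.val_succ, Fin.val_castSucc]
        exact h3
      · refine inf_le_right.trans ((f'.mono ?_).trans le_sup_right)
        rw [Fin.le_def, Fin.val_succ, Fin.val_castSucc]
        exact h3
    have e1 := a2 (fun s t => by rw [hY.finrank_inf, heq]) _ hU
    have e2 := b2 (fun s t => by rw [inf_comm, hY.finrank_inf, heq, X.swap_rk]) _
      (fun p hp => by
        rw [inf_comm]
        exact hU p.swap (DecMat.mem_swap_Δ.1 hp))
    apply hd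
    rw [show ω = μ + (ω - μ) by abel]
    exact add_mem e1 e2

end Chains

/-! ### Triangularity -/

section Triangularity

open Submodule Module

variable {n d : ℕ}

/-- The values of the family `x` are nonnegative, and its support is described by `S`. Nonnegativity
excludes cancellation, so that supports of products can be computed. -/
def Supp (x : ∀ Q, Conv n d Q)
    (S : ∀ Q : PrimePow, Flag Q.F n d → Flag Q.F n d → (Fin d → Q.F) → Prop) : Prop :=
  ∀ Q f f' ω, 0 ≤ cf (R := Q.Val) (x Q) f f' ω ∧ (cf (R := Q.Val) (x Q) f f' ω ≠ 0 ↔ S Q f f' ω)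

variable {x y : ∀ Q, Conv n d Q}
  {S T : ∀ Q : PrimePow, Flag Q.F n d → Flag Q.F n d → (Fin d → Q.F) → Prop}

lemma Supp.congr (hx : Supp x S) (h : ∀ Q f f' ω, S Q f f' ω ↔ T Q f f' ω) : Supp x T :=
  fun Q f f' ω => ⟨(hx Q f f' ω).1, (hx Q f f' ω).2.trans (h Q f f' ω)⟩

lemma Supp.mul (hx : Supp x S) (hy : Supp y T) :
    Supp (x * y) fun Q f f' ω => ∃ f₂ μ, S Q f f₂ μ ∧ T Q f₂ f' (ω - μ) := by
  intro Q f f' ω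
  have h0 : ∀ f₂ μ, 0 ≤ cf (R := Q.Val) (x Q) f f₂ μ * cf (R := Q.Val) (y Q) f₂ f' (ω - μ) :=
    fun f₂ μ => mul_nonneg (hx Q _ _ _).1 (hy Q _ _ _).1
  rw [Pi.mul_apply, cf_mul]
  refine ⟨Finset.sum_nonneg fun f₂ _ => Finset.sum_nonneg fun μ _ => h0 f₂ μ, ?_⟩
  rw [Ne, Finset.sum_eq_zero_iff_of_nonneg fun f₂ _ => Finset.sum_nonneg fun μ _ => h0 f₂ μ]
  push Not
  refine exists_congr fun f₂ => ?_
  rw [Ne, Finset.sum_eq_zero_iff_of_nonneg fun μ _ => h0 f₂ μ]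
  push Not
  simp only [Finset.mem_univ, true_and]
  refine exists_congr fun μ => ?_
  rw [mul_ne_zero_iff, (hx Q f f₂ μ).2, (hy Q f₂ f' (ω - μ)).2]

lemma Supp.add (hx : Supp x S) (hy : Supp y T) :
    Supp (x + y) fun Q f f' ω => S Q f f' ω ∨ T Q f f' ω := by
  intro Q f f' ω
  change _ ∧ (_ ↔ S Q f f' ω ∨ T Q f f' ω)
  rw [Pi.add_apply, cf_add, ← (hx Q f f' ω).2, ← (hy Q f f' ω).2]
  refine ⟨add_nonneg (hx Q f f' ω).1 (hy Q f f' ω).1, ?_⟩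
  rw [Ne, add_eq_zero_iff_of_nonneg (hx Q f f' ω).1 (hy Q f f' ω).1]
  tauto

lemma supp_zero : Supp (0 : ∀ Q, Conv n d Q) fun _ _ _ _ => False :=
  fun _ _ _ _ => ⟨le_rfl, by simp [cf_zero]⟩

lemma supp_sum {ι : Type*} (I : Finset ι) (x : ι → ∀ Q, Conv n d Q)
    (S : ι → ∀ Q : PrimePow, Flag Q.F n d → Flag Q.F n d → (Fin d → Q.F) → Prop)
    (h : ∀ i ∈ I, Supp (x i) (S i)) :
    Supp (∑ i ∈ I, x i) fun Q f f' ω => ∃ i ∈ I, S i Q f f' ω := by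
  classical
  induction I using Finset.induction_on with
  | empty => simpa using supp_zero
  | insert a I ha ih =>
    rw [Finset.sum_insert ha]
    refine ((h a (Finset.mem_insert_self _ _)).add
      (ih fun i hi => h i (Finset.mem_insert_of_mem hi))).congr fun Q f f' ω => ?_
    simp

lemma Supp.transpose (hx : Supp x S) :
    Supp (fun Q => (x Q).transpose) fun Q f f' ω => S Q f' f ω :=
  fun Q f f' ω => hx Q f' f ω

open Classical in
lemma supp_sc {M : ∀ Q : PrimePow, Matrix (Flag Q.F n d) (Flag Q.F n d) Q.Val}
    {P : ∀ Q : PrimePow, Flag Q.F n d → Flag Q.F n d → Prop}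
    (h : ∀ Q f f', M Q f f' = if P Q f f' then 1 else 0) :
    Supp (n := n) (d := d) (fun Q => sc (M Q)) fun Q f f' ω => P Q f f' ∧ ω = 0 := by
  intro Q f f' ω
  rw [cf_sc, h]
  by_cases h1 : ω = 0 <;> by_cases h2 : P Q f f' <;> simp [h1, h2]

/-- The family of the elements `Eh`. -/
def Efam (i : Fin (n - 1)) : ∀ Q, Conv n d Q := fun Q => sc (Eh Q.F Q.Val i)

/-- The family of the transposes of the elements `Eh`. -/
def Ffam (i : Fin (n - 1)) : ∀ Q, Conv n d Q := fun Q => sc (Eh Q.F Q.Val i).transpose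

/-- The family of the elements `Ind`. -/
def Ifam (s : Fin (n + 1)) : ∀ Q, Conv n d Q := fun Q => Ind Q.F Q.Val s

open Classical in
/-- The projection to the flags with prescribed dimensions. -/
def fwt (r : Fin (n + 1) → ℕ) : ∀ Q, Conv n d Q := fdiag fun δ => if δ = r then 1 else 0

lemma supp_one : Supp (1 : ∀ Q, Conv n d Q) fun _ f f' ω => f = f' ∧ ω = 0 := by
  classical
  have := supp_sc (n := n) (d := d) (M := fun Q => 1) (P := fun _ f f' => f = f')
    (fun Q f f' => Matrix.one_apply)
  convert this using 1
  funext Q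
  exact (map_one _).symm

lemma supp_Efam (i : Fin (n - 1)) :
    Supp (Efam i : ∀ Q, Conv n d Q) fun _ f f' ω => EStep i f f' ∧ ω = 0 :=
  supp_sc fun _ _ _ => rfl

lemma supp_Efam_sum_pow (k : ℕ) :
    Supp ((∑ i, Efam i : ∀ Q, Conv n d Q) ^ k) fun _ f f' ω => Reach k f f' ∧ ω = 0 := by
  induction k with
  | zero => rw [pow_zero]; exact supp_one
  | succ k ih =>
    rw [pow_succ']
    refine ((supp_sum _ _ _ fun i _ => supp_Efam i).mul ih).congr fun Q f f' ω => ?_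
    constructor
    · rintro ⟨f₂, μ, ⟨i, -, h1, rfl⟩, h2, h3⟩
      exact ⟨⟨f₂, ⟨i, h1⟩, h2⟩, by simpa using h3⟩
    · rintro ⟨⟨f₂, ⟨i, h1⟩, h2⟩, rfl⟩
      exact ⟨f₂, 0, ⟨i, Finset.mem_univ _, h1, rfl⟩, h2, sub_zero 0⟩

lemma supp_fwt (r : Fin (n + 1) → ℕ) :
    Supp (fwt r : ∀ Q, Conv n d Q) fun _ f f' ω => (f = f' ∧ dims f = r) ∧ ω = 0 := by
  classical
  refine supp_sc fun Q f f' => ?_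
  rw [Matrix.diagonal_apply]
  by_cases h1 : f = f' <;> by_cases h2 : dims f = r <;> simp [h1, h2]

/-- The family of the characteristic functions of `optSpace`. -/
def optInd : Option (Fin (n + 1)) → ∀ Q, Conv n d Q
  | none => 1
  | some s => Ifam s

lemma supp_optInd (J : Option (Fin (n + 1))) :
    Supp (optInd J : ∀ Q, Conv n d Q) fun _ f f' ω => f = f' ∧ ω ∈ optSpace f J := by
  classical
  cases J with
  | none => exact supp_one.congr fun Q f f' ω => by rw [optSpace, Submodule.mem_bot]
  | some s =>
    intro Q f f' ω
    have h : cf (R := Q.Val) (optInd (some s) Q) f f' ω =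
        if f = f' ∧ ω ∈ f.1 s then 1 else 0 := by
      change (Matrix.diagonal (fun f : Flag Q.F n d => ind Q.Val (f.1 s)) f f').coeff ω = _
      rw [Matrix.diagonal_apply]
      by_cases h1 : f = f'
      · rw [if_pos h1, coeff_ind]
        simp [h1]
      · rw [if_neg h1, if_neg fun h => h1 h.1]
        rfl
    rw [h]
    change _ ∧ (_ ↔ f = f' ∧ ω ∈ f.1 s)
    split_ifs with h1
    · exact ⟨zero_le_one, iff_of_true one_ne_zero h1⟩
    · exact ⟨le_rfl, iff_of_false (not_not.2 rfl) h1⟩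

/-- The product of operators whose support is `ChainRel r J t`. -/
def chain (r : ℕ → Fin (n + 1) → ℕ) (J : ℕ → Option (Fin (n + 1))) : ℕ → ∀ Q, Conv n d Q
  | 0 => fwt (r 0)
  | t + 1 => fwt (r (t + 1)) * (optInd (J (t + 1)) *
      ((∑ i, Efam i) ^ (∑ s, r (t + 1) s - ∑ s, r t s) * chain r J t))

lemma supp_chain (r : ℕ → Fin (n + 1) → ℕ) (J : ℕ → Option (Fin (n + 1))) (t : ℕ) :
    Supp (chain r J t : ∀ Q, Conv n d Q) fun _ f f' ω => ChainRel r J t f f' ω := by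
  induction t with
  | zero =>
    refine (supp_fwt _).congr fun Q f f' ω => ?_
    simp only [ChainRel]
    tauto
  | succ t ih =>
    refine ((supp_fwt _).mul ((supp_optInd _).mul ((supp_Efam_sum_pow _).mul ih))).congr
      fun Q f f' ω => ?_
    constructor
    · rintro ⟨_, _, ⟨⟨rfl, h1⟩, rfl⟩, _, w, ⟨rfl, h2⟩, g, _, ⟨h3, rfl⟩, h4⟩
      refine ⟨h1, w, h2, g, h3.le, ?_⟩
      simpa only [sub_zero] using h4
    · rintro ⟨h1, w, h2, g, h3, h4⟩
      refine ⟨f, 0, ⟨⟨rfl, h1⟩, rfl⟩, f, w, ⟨rfl, h2⟩, g, 0, ⟨reach_of_le h3 ?_, rfl⟩, ?_⟩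
      · have h5 : size g ≤ size f := Finset.sum_le_sum fun s _ => Submodule.finrank_mono (h3 s)
        have e1 : size f = ∑ s, r (t + 1) s := Finset.sum_congr rfl fun s _ => congrFun h1 s
        have e2 : size g = ∑ s, r t s := Finset.sum_congr rfl fun s _ => congrFun h4.dims_eq s
        omega
      · simpa only [sub_zero] using h4

/-- The product of the two chains of `X`. -/
def glue (X : DecMat n d) : ∀ Q, Conv n d Q := fun Q =>
  chain X.table X.jump n Q * (chain X.swap.table X.swap.jump n Q).transpose

lemma supp_glue (X : DecMat n d) :
    Supp (glue X : ∀ Q, Conv n d Q) fun _ f f' ω => GlueRel X f f' ω :=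
  (supp_chain _ _ n).mul (supp_chain _ _ n).transpose

/-- A family which preserves uniformity under multiplication from the left, and which lies in the
subalgebra `A` together with its transpose. -/
structure Good (A : Subalgebra Lau (∀ Q, Conv n d Q)) (x : ∀ Q, Conv n d Q) : Prop where
  uniform_mul : ∀ y, Uniform y → Uniform (x * y)
  mem : x ∈ A
  transpose_mem : (fun Q => (x Q).transpose) ∈ A

variable {A : Subalgebra Lau (∀ Q, Conv n d Q)}

lemma Good.mul (hx : Good A x) (hy : Good A y) : Good A (x * y) where
  uniform_mul z hz := by
    rw [mul_assoc]
    exact hx.uniform_mul _ (hy.uniform_mul _ hz)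
  mem := mul_mem hx.mem hy.mem
  transpose_mem := by
    have := mul_mem hy.transpose_mem hx.transpose_mem
    convert this using 1
    funext Q
    refine Matrix.ext fun f f' => ?_
    rw [Pi.mul_apply, Pi.mul_apply, Matrix.transpose_apply, Matrix.mul_apply, Matrix.mul_apply]
    exact Finset.sum_congr rfl fun f₂ _ => mul_comm _ _

lemma good_one : Good A 1 where
  uniform_mul y hy := by rwa [one_mul]
  mem := one_mem _
  transpose_mem := by
    convert one_mem A using 1
    funext Q
    exact Matrix.transpose_one

lemma Good.add (hx : Good A x) (hy : Good A y) : Good A (x + y) where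
  uniform_mul z hz := by
    rw [add_mul]
    exact (hx.uniform_mul _ hz).add (hy.uniform_mul _ hz)
  mem := add_mem hx.mem hy.mem
  transpose_mem := add_mem hx.transpose_mem hy.transpose_mem

lemma good_zero : Good A 0 where
  uniform_mul y hy := by
    rw [zero_mul]
    exact uniform_zero
  mem := zero_mem _
  transpose_mem := zero_mem A

lemma Good.pow (hx : Good A x) (k : ℕ) : Good A (x ^ k) := by
  induction k with
  | zero => rw [pow_zero]; exact good_one
  | succ k ih => rw [pow_succ]; exact ih.mul hx

/-- The order on relative positions with respect to which the products `glue X` are triangular. -/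
def Below (Y X : DecMat n d) : Prop :=
  (∀ s t : Fin (n + 1), X.rk s t ≤ Y.rk s t) ∧
    ((∀ s t : Fin (n + 1), Y.rk s t = X.rk s t) → ∀ i j, Y.Dom i j → X.Dom i j)

lemma Below.trans {X Y Z : DecMat n d} (h1 : Below Z Y) (h2 : Below Y X) : Below Z X := by
  refine ⟨fun s t => (h2.1 s t).trans (h1.1 s t), fun h i j hd => ?_⟩
  have hY : ∀ s t : Fin (n + 1), Y.rk s t = X.rk s t := fun s t =>
    le_antisymm ((h1.1 s t).trans (h s t).le) (h2.1 s t)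
  exact h2.2 hY i j (h1.2 (fun s t => (h s t).trans (hY s t).symm) i j hd)

lemma Below.antisymm {X Y : DecMat n d} (h1 : Below Y X) (h2 : Below X Y) : Y = X := by
  have hr : ∀ s t : Fin (n + 1), Y.rk s t = X.rk s t := fun s t =>
    le_antisymm (h2.1 s t) (h1.1 s t)
  exact DecMat.ext (DecMat.A_eq_of_rk_eq hr)
    (DecMat.Δ_eq_of_dom_iff fun i j => ⟨h1.2 hr i j, h2.2 (fun s t => (hr s t).symm) i j⟩)

lemma wellFounded_below : WellFounded fun Y X : DecMat n d => Below Y X ∧ Y ≠ X := by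
  have : IsTrans (DecMat n d) fun Y X => Below Y X ∧ Y ≠ X :=
    ⟨fun Z Y X h1 h2 => ⟨h1.1.trans h2.1, by
      rintro rfl
      exact h1.2 (h1.1.antisymm h2.1)⟩⟩
  have : Std.Irrefl fun Y X : DecMat n d => Below Y X ∧ Y ≠ X := ⟨fun X h => h.2 rfl⟩
  exact Finite.wellFounded_of_trans_of_irrefl _

/-- A saturated subalgebra which contains the elementary operators contains the characteristic
functions of all orbits: `glue X` is a combination of the functions `e Y` with `Y` below `X`, in
which `e X` has a nonzero coefficient. -/
theorem e_mem_of_saturated [NeZero n]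
    (hsat : ∀ (p : Lau) (x : ∀ Q, Conv n d Q), p ≠ 0 → p • x ∈ A → x ∈ A)
    (hE : ∀ i, Efam i ∈ A) (hF : ∀ i, Ffam i ∈ A) (hI : ∀ s, Ifam s ∈ A)
    (hD : ∀ φ, fdiag φ ∈ A) (X : DecMat n d) : e X ∈ A := by
  classical
  have gE : ∀ i, Good A (Efam i) := fun i => ⟨fun y hy => hy.Eh_mul i, hE i, hF i⟩
  have gO : ∀ J, Good A (optInd J) := by
    rintro (_ | s)
    · exact good_one
    · refine ⟨fun y hy => hy.Ind_mul s, hI s, ?_⟩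
      convert hI s using 1
      funext Q
      exact Ind_transpose s
  have gD : ∀ r, Good A (fwt r) := fun r => ⟨fun y hy => hy.fdiag_mul _, hD _, by
    convert hD (fun δ => if δ = r then 1 else 0) using 1
    funext Q
    exact (sc_transpose _).trans (congrArg _ (Matrix.diagonal_transpose _))⟩
  have gC : ∀ r J t, Good A (chain r J t) := by
    intro r J t
    induction t with
    | zero => exact gD _
    | succ t ih =>
      exact (gD _).mul ((gO _).mul (((Finset.sum_induction _ (Good A) (fun _ _ => Good.add)
        good_zero fun i _ => gE i).pow _).mul ih))
  induction X using wellFounded_below.induction with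
  | _ X ih =>
  have hmem : glue X ∈ A := mul_mem (gC _ _ _).mem (gC _ _ _).transpose_mem
  have hunif : Uniform (glue X) := by
    refine (gC X.table X.jump n).uniform_mul
      (fun Q => (chain X.swap.table X.swap.jump n Q).transpose) (Uniform.transpose ?_)
    have := (gC X.swap.table X.swap.jump n).uniform_mul 1 uniform_one
    rwa [mul_one] at this
  obtain ⟨p, hp, c, hc⟩ := hunif
  have hexp : p • glue X = ∑ Y, c Y • e Y := by
    funext Q
    refine cf_ext (R := Q.Val) fun f f' ω => ?_
    obtain ⟨Y, hY⟩ := exists_orbit f f' ω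
    rw [Pi.smul_apply, cf_smul, hc Q Y f f' ω hY, Finset.sum_apply, cf_sum,
      Finset.sum_eq_single Y]
    · rw [Pi.smul_apply, cf_smul, cf_e, if_pos hY, mul_one]
    · intro Z _ hZ
      rw [Pi.smul_apply, cf_smul, cf_e, if_neg fun h => hZ (h.unique hY), mul_zero]
    · exact fun h => absurd (Finset.mem_univ _) h
  have hbelow : ∀ Y, c Y ≠ 0 → Below Y X := by
    intro Y hY
    by_contra hn
    refine hY (PrimePow.eq_zero_of_ev fun Q => ?_)
    obtain ⟨f, f', ω, h⟩ := exists_inOrbit Q.F Y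
    rw [← hc Q Y f f' ω h]
    have : cf (R := Q.Val) (glue X Q) f f' ω = 0 := by
      by_contra h1
      exact hn (((supp_glue X Q f f' ω).2.1 h1).le h)
    rw [this, mul_zero]
  have hX : c X ≠ 0 := by
    intro h0
    refine hp (PrimePow.eq_zero_of_ev fun Q => ?_)
    obtain ⟨f, f', ω, h⟩ := exists_inOrbit Q.F X
    have h1 := hc Q X f f' ω h
    rw [h0, map_zero] at h1
    exact (mul_eq_zero.1 h1).resolve_right ((supp_glue X Q f f' ω).2.2 h.glueRel)
  refine hsat (c X) _ hX ?_
  have : c X • e X = p • glue X - ∑ Y ∈ Finset.univ.erase X, c Y • e Y := by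
    rw [hexp, ← Finset.add_sum_erase _ _ (Finset.mem_univ X), add_sub_cancel_right]
  rw [this]
  refine sub_mem (A.smul_mem hmem p) (sum_mem fun Y hY => ?_)
  by_cases h0 : c Y = 0
  · rw [h0, zero_smul]
    exact zero_mem _
  · exact A.smul_mem (ih Y ⟨hbelow Y h0, Finset.ne_of_mem_erase hY⟩) _

end Triangularity

/-! ### The generators as families of operators -/

section Generators

open Submodule Module

variable {n d : ℕ}

/-- The dimension of the `a`-th subquotient of a flag with dimensions `δ`. -/
def gr (δ : Fin (n + 1) → ℕ) (a : Fin n) : ℤ := (δ a.succ : ℤ) - δ a.castSucc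

namespace DecMat

lemma rk_col_succ (X : DecMat n d) (j : Fin n) :
    X.rk n (j + 1) = X.rk n j + ∑ i, X.A i j := by
  have h : ∀ m : ℕ, (hm : m ≤ n) → X.rk m (j + 1) =
      X.rk m j + ∑ i : Fin m, X.A (Fin.castLE hm i) j := by
    intro m
    induction m with
    | zero => intro _; simp [rk]
    | succ m ih =>
      intro hm
      have h1 := X.A_add_rk ⟨m, hm⟩ j
      have h2 := ih (by omega)
      rw [Fin.sum_univ_castSucc]
      have e : Fin.castLE hm (Fin.last m) = ⟨m, hm⟩ := rfl
      rw [e]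
      have e2 : ∑ i : Fin m, X.A (Fin.castLE hm i.castSucc) j =
        ∑ i : Fin m, X.A (Fin.castLE (by omega) i) j := rfl
      rw [e2]
      change X.A ⟨m, hm⟩ j + X.rk m (j + 1) + X.rk (m + 1) j = _ at h1
      change _ = X.rk (m + 1) (j + 1) + X.rk m j at h1
      omega
  exact h n le_rfl

lemma gr_col (X : DecMat n d) (j : Fin n) :
    gr (fun s : Fin (n + 1) => X.rk n s) j = ∑ i, (X.A i j : ℤ) := by
  have := X.rk_col_succ j
  change ((X.rk n (j + 1) : ℕ) : ℤ) - (X.rk n j : ℕ) = _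
  rw [this]
  push_cast
  ring

lemma gr_row (X : DecMat n d) (i : Fin n) :
    gr (fun s : Fin (n + 1) => X.rk s n) i = ∑ j, (X.A i j : ℤ) := by
  have := X.swap.gr_col i
  simp only [swap_rk] at this
  exact this

lemma dimFlag_sub_dimOrbit (X : DecMat n d) (hΔ : X.Δ = ∅) :
    -(X.dimOrbit : ℤ) + X.dimFlag =
      -∑ i, ∑ j, ∑ k, ∑ l, if k ≤ i ∧ j < l then (X.A i j : ℤ) * X.A k l else 0 := by
  classical
  rw [neg_add_eq_iff_eq_add, ← sub_eq_add_neg, eq_sub_iff_add_eq]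
  unfold dimFlag dimOrbit
  push_cast
  simp only [hΔ, Finset.notMem_empty, false_and, exists_false, if_false, Finset.sum_const_zero,
    add_zero, ← Finset.sum_add_distrib]
  refine Finset.sum_congr rfl fun i _ => Finset.sum_congr rfl fun j _ =>
    Finset.sum_congr rfl fun k _ => Finset.sum_congr rfl fun l _ => ?_
  by_cases h1 : i < k
  · simp [h1]
  · by_cases h2 : j < l
    · simp [h1, h2, not_lt.1 h1]
    · simp [h1, h2]

lemma dimFlag_sub_dimOrbit_of_isDiag (X : DecMat n d) (hΔ : X.Δ = ∅) (hA : X.A.IsDiag) :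
    -(X.dimOrbit : ℤ) + X.dimFlag = 0 := by
  rw [X.dimFlag_sub_dimOrbit hΔ, neg_eq_zero]
  refine Finset.sum_eq_zero fun i _ => Finset.sum_eq_zero fun j _ => Finset.sum_eq_zero fun k _ =>
    Finset.sum_eq_zero fun l _ => ?_
  split_ifs with h
  · by_contra hne
    rw [mul_eq_zero, not_or] at hne
    have h1 : i = j := by
      by_contra hc
      exact hne.1 (by exact_mod_cast hA hc)
    have h2 : k = l := by
      by_contra hc
      exact hne.2 (by exact_mod_cast hA hc)
    subst h1; subst h2
    exact absurd h.2 (not_lt.2 h.1)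
  · rfl

/-- The exponent is computed by a single pair of positions. -/
lemma dimFlag_sub_dimOrbit_of_single (X : DecMat n d) (hΔ : X.Δ = ∅) (p r : Fin n × Fin n)
    (h0 : r.1 ≤ p.1 ∧ p.2 < r.2)
    (h : ∀ i j k l, k ≤ i → j < l → X.A i j ≠ 0 → X.A k l ≠ 0 → (i, j) = p ∧ (k, l) = r) :
    -(X.dimOrbit : ℤ) + X.dimFlag = -(X.A p.1 p.2 * X.A r.1 r.2 : ℤ) := by
  rw [X.dimFlag_sub_dimOrbit hΔ]
  congr 1
  have key : ∀ i j k l, ¬ ((i, j) = p ∧ (k, l) = r) →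
      (if k ≤ i ∧ j < l then (X.A i j : ℤ) * X.A k l else 0) = 0 := by
    intro i j k l hne
    split_ifs with h1
    · by_contra h2
      rw [mul_eq_zero, not_or] at h2
      exact hne (h i j k l h1.1 h1.2 (by exact_mod_cast h2.1) (by exact_mod_cast h2.2))
    · rfl
  obtain ⟨a, b⟩ := p
  obtain ⟨c, f⟩ := r
  rw [Finset.sum_eq_single a, Finset.sum_eq_single b, Finset.sum_eq_single c,
    Finset.sum_eq_single f]
  · exact if_pos h0
  · exact fun l _ hl => key _ _ _ _ fun h => hl (Prod.ext_iff.1 h.2).2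
  · exact fun h => absurd (Finset.mem_univ _) h
  · exact fun k _ hk => Finset.sum_eq_zero fun l _ => key _ _ _ _ fun h => hk (Prod.ext_iff.1 h.2).1
  · exact fun h => absurd (Finset.mem_univ _) h
  · exact fun j _ hj => Finset.sum_eq_zero fun k _ => Finset.sum_eq_zero fun l _ =>
      key _ _ _ _ fun h => hj (Prod.ext_iff.1 h.1).2
  · exact fun h => absurd (Finset.mem_univ _) h
  · exact fun i _ hi => Finset.sum_eq_zero fun j _ => Finset.sum_eq_zero fun k _ =>
      Finset.sum_eq_zero fun l _ => key _ _ _ _ fun h => hi (Prod.ext_iff.1 h.1).1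
  · exact fun h => absurd (Finset.mem_univ _) h

lemma lo_ne_hi (i : Fin (n - 1)) : lo i ≠ hi i := by
  simp [Fin.ext_iff, val_lo, val_hi]

/-- The condition in the definition of `MS.E` and `MS.F`, in terms of the entries. -/
lemma exists_diagonal_add_single_iff {M : Matrix (Fin n) (Fin n) ℕ} {p r : Fin n} (hpr : p ≠ r) :
    (∃ b : Fin n → ℕ, M = Matrix.diagonal b + Matrix.single p r 1) ↔
      (∀ k l, M k l ≠ 0 → k = l ∨ (k = p ∧ l = r)) ∧ M p r = 1 := by
  constructor
  · rintro ⟨b, rfl⟩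
    refine ⟨fun k l h => ?_, ?_⟩
    · by_contra hc
      push Not at hc
      apply h
      rw [Matrix.add_apply, Matrix.diagonal_apply_ne _ hc.1, Matrix.single_apply,
        if_neg fun h => hc.2 h.1.symm h.2.symm, add_zero]
    · rw [Matrix.add_apply, Matrix.diagonal_apply_ne _ hpr, Matrix.single_apply_same]
  · rintro ⟨h1, h2⟩
    refine ⟨fun k => M k k, ?_⟩
    ext k l
    rw [Matrix.add_apply, Matrix.single_apply]
    by_cases hkl : k = l
    · subst hkl
      rw [Matrix.diagonal_apply_eq, if_neg fun h => hpr (h.1.trans h.2.symm), add_zero]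
    · rw [Matrix.diagonal_apply_ne _ hkl, zero_add]
      split_ifs with h
      · rw [← h.1, ← h.2, h2]
      · by_contra hc
        rcases h1 k l hc with h3 | h3
        · exact hkl h3
        · exact h ⟨h3.1.symm, h3.2.symm⟩

end DecMat

section Steps

variable {K : Type} [Field K] {X : DecMat n d} {f f' : Flag K n d} {ω : Fin d → K}

lemma InOrbit.gr_left (h : InOrbit X f f' ω) (a : Fin n) :
    gr (dims f) a = ∑ j, (X.A a j : ℤ) := by
  rw [h.dims_left, X.gr_row]

lemma InOrbit.gr_right (h : InOrbit X f f' ω) (a : Fin n) :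
    gr (dims f') a = ∑ j, (X.A j a : ℤ) := by
  rw [h.dims_right, X.gr_col]

/-- The matrices of the pairs of flags that form an elementary step. -/
lemma InOrbit.eStep_iff (h : InOrbit X f f' ω) (i : Fin (n - 1)) :
    EStep i f f' ↔
      ∃ b : Fin n → ℕ, X.A = Matrix.diagonal b + Matrix.single (lo i) (hi i) 1 := by
  rw [DecMat.exists_diagonal_add_single_iff (DecMat.lo_ne_hi i)]
  obtain ⟨b, h1, h2, -⟩ := inOrbit_iff_adapted.1 h
  have hrow : (∀ k l, X.A k l ≠ 0 → k = l ∨ (k = lo i ∧ l = hi i)) →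
      gr (dims f) (lo i) = gr (dims f') (lo i) + X.A (lo i) (hi i) := by
    intro hs
    have e1 : ∑ k, (X.A k (lo i) : ℤ) = X.A (lo i) (lo i) := by
      refine Finset.sum_eq_single (lo i) (fun k _ hk => ?_) fun hn => absurd (Finset.mem_univ _) hn
      by_contra hc
      rcases hs k (lo i) (by exact_mod_cast hc) with h3 | h3
      · exact hk h3
      · exact hk h3.1
    have e2 : ∑ l ∈ Finset.univ.erase (lo i), (X.A (lo i) l : ℤ) = X.A (lo i) (hi i) := by
      refine Finset.sum_eq_single (hi i) (fun l hl hl2 => ?_)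
        fun hn => absurd (Finset.mem_erase.2 ⟨(DecMat.lo_ne_hi i).symm, Finset.mem_univ _⟩) hn
      by_contra hc
      rcases hs (lo i) l (by exact_mod_cast hc) with h3 | h3
      · exact Finset.ne_of_mem_erase hl h3.symm
      · exact hl2 h3.2
    rw [h.gr_left, h.gr_right, e1, ← Finset.add_sum_erase _ _ (Finset.mem_univ (lo i)), e2]
  constructor
  · intro hst
    have hs : ∀ k l, X.A k l ≠ 0 → k = l ∨ (k = lo i ∧ l = hi i) := by
      intro k l hkl
      let x : X.Idx := ⟨(k, l), ⟨0, Nat.pos_of_ne_zero hkl⟩⟩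
      have key : ∀ s : Fin (n + 1), s ≠ mid i → ((k : ℕ) < s ↔ (l : ℕ) < s) := fun s hs => by
        have e1 := h1.basis_mem_iff s x
        have e2 := h2.basis_mem_iff s x
        rw [hst.1 s hs] at e1
        exact e1.symm.trans e2
      have key2 : (l : ℕ) < mid i → (k : ℕ) < mid i := fun hl =>
        (h1.basis_mem_iff _ x).1 (hst.2.1 ((h2.basis_mem_iff _ x).2 hl))
      rw [val_mid] at key2
      by_contra hc
      simp only [not_or, not_and, Fin.ext_iff, val_lo, val_hi] at hc
      have k1 := key k.succ
      have k2 := key l.succ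
      have k3 := key l.castSucc
      simp only [ne_eq, Fin.ext_iff, Fin.val_succ, Fin.val_castSucc, val_mid] at k1 k2 k3
      omega
    refine ⟨hs, ?_⟩
    have e1 := hrow hs
    unfold gr at e1
    have e2 := hst.2.2
    rw [show (lo i).succ = mid i from rfl] at e1
    unfold dims at e1
    rw [hst.castSucc_lo] at e1
    omega
  · rintro ⟨hs, hone⟩
    have hx : ∀ x : X.Idx, x.1.1 = x.1.2 ∨ (x.1.1 = lo i ∧ x.1.2 = hi i) := fun x =>
      hs _ _ fun h0 => (Fin.cast h0 x.2).elim0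
    have heq : ∀ s, s ≠ mid i → f.1 s = f'.1 s := by
      intro s hsm
      rw [h1 s, h2 s]
      congr 2
      ext x
      change (x.1.1 : ℕ) < s ↔ (x.1.2 : ℕ) < s
      rcases hx x with h3 | h3
      · rw [h3]
      · rw [h3.1, h3.2, val_lo, val_hi]
        have : (s : ℕ) ≠ i + 1 := fun h => hsm (Fin.ext h)
        omega
    refine ⟨heq, ?_, ?_⟩
    · rw [h1 (mid i), h2 (mid i)]
      refine Submodule.span_mono (Set.image_mono fun x hlt => ?_)
      change (x.1.2 : ℕ) < mid i at hlt
      change (x.1.1 : ℕ) < mid i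
      rcases hx x with h3 | h3
      · rwa [h3]
      · rw [h3.1, val_lo, val_mid]
        omega
    · have e1 := hrow hs
      rw [hone] at e1
      unfold gr dims at e1
      rw [show (lo i).succ = mid i from rfl, heq _ (castSucc_lo_ne_mid i)] at e1
      push_cast at e1
      omega

lemma InOrbit.Δ_eq_zero_iff [NeZero n] (h : InOrbit X f f ω) :
    X.Δ = {((0 : Fin n), (0 : Fin n))} ↔ ω ≠ 0 ∧ ω ∈ f.1 (0 : Fin n).succ := by
  constructor
  · intro hΔ
    refine ⟨fun h0 => ?_, ?_⟩
    · rw [h.vec_eq_zero_iff.1 h0] at hΔ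
      exact Finset.singleton_ne_empty _ hΔ.symm
    · obtain ⟨b, h1, -, rfl⟩ := inOrbit_iff_adapted.1 h
      refine sum_mem fun x hx => (h1.basis_mem_iff _ x).2 ?_
      have hx1 := (DecMat.mem_marked.1 hx).1
      rw [hΔ, Finset.mem_singleton] at hx1
      rw [hx1, Fin.val_succ]
      exact Nat.lt_succ_self _
  · rintro ⟨h0, hω⟩
    have hsub : ∀ p ∈ X.Δ, p = ((0 : Fin n), (0 : Fin n)) := by
      intro p hp
      have hd := (h.dom_iff p.1 p.2).1 ⟨p, hp, le_rfl, le_rfl⟩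
      have key : ∀ a : Fin n, ω ∉ f.1 a.castSucc → a = 0 := by
        intro a ha
        by_contra hne
        refine ha (f.mono ?_ hω)
        have := Nat.pos_of_ne_zero (fun h0 => hne (Fin.ext h0) : (a : ℕ) ≠ 0)
        rw [Fin.le_def, Fin.val_succ, Fin.val_castSucc]
        exact this
      exact Prod.ext (key _ fun hm => hd (mem_sup_left hm)) (key _ fun hm => hd (mem_sup_right hm))
    obtain ⟨p, hp⟩ := Finset.nonempty_iff_ne_empty.2 fun he => h0 (h.vec_eq_zero_iff.2 he)
    exact Finset.eq_singleton_iff_unique_mem.2 ⟨hsub p hp ▸ hp, hsub⟩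

end Steps

end Generators

section GeneratorFamilies

open Submodule Module

variable {n d : ℕ}

lemma cf_mul_diagonal {K : Type} [Field K] [Fintype K] {R : Type} [CommRing R]
    (φ : Flag K n d → R) (x : CV K R n d) (f f' : Flag K n d) (ω : Fin d → K) :
    cf (x * sc (Matrix.diagonal φ)) f f' ω = cf x f f' ω * φ f' := by
  have h : (x * sc (Matrix.diagonal φ)) =
      (sc (Matrix.diagonal φ) * x.transpose).transpose := by
    rw [Matrix.transpose_mul, Matrix.transpose_transpose, sc_transpose, Matrix.diagonal_transpose]
  rw [h, cf_transpose, cf_diagonal_mul, cf_transpose, mul_comm]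

lemma cf_fdiag_mul (φ : (Fin (n + 1) → ℕ) → Lau) (x : ∀ Q, Conv n d Q) (Q : PrimePow)
    (f f' : Flag Q.F n d) (ω : Fin d → Q.F) :
    cf (R := Q.Val) ((fdiag φ * x : ∀ Q, Conv n d Q) Q) f f' ω =
      Q.ev (φ (dims f)) * cf (R := Q.Val) (x Q) f f' ω :=
  cf_diagonal_mul _ _ _ _ _

lemma cf_mul_fdiag (φ : (Fin (n + 1) → ℕ) → Lau) (x : ∀ Q, Conv n d Q) (Q : PrimePow)
    (f f' : Flag Q.F n d) (ω : Fin d → Q.F) :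
    cf (R := Q.Val) ((x * fdiag φ : ∀ Q, Conv n d Q) Q) f f' ω =
      cf (R := Q.Val) (x Q) f f' ω * Q.ev (φ (dims f')) :=
  cf_mul_diagonal _ _ _ _ _

lemma fam_ext {x y : ∀ Q, Conv n d Q}
    (h : ∀ (Q : PrimePow) (f f' : Flag Q.F n d) (ω : Fin d → Q.F),
      cf (R := Q.Val) (x Q) f f' ω = cf (R := Q.Val) (y Q) f f' ω) : x = y :=
  funext fun Q => cf_ext (R := Q.Val) fun f f' ω => h Q f f' ω

open Classical in
lemma cf_fdiag (φ : (Fin (n + 1) → ℕ) → Lau) (Q : PrimePow) (f f' : Flag Q.F n d)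
    (ω : Fin d → Q.F) :
    cf (R := Q.Val) (fdiag φ Q) f f' ω = if f = f' ∧ ω = 0 then Q.ev (φ (dims f)) else 0 := by
  unfold fdiag
  rw [cf_sc, Matrix.diagonal_apply]
  by_cases h1 : f = f' <;> by_cases h2 : ω = 0 <;> simp [h1, h2]

/-- The map `fdiag` as a homomorphism of algebras. -/
def fdiagHom (n d : ℕ) : ((Fin (n + 1) → ℕ) → Lau) →ₐ[Lau] ∀ Q, Conv n d Q where
  toFun := fdiag
  map_one' := by
    classical
    refine fam_ext fun Q f f' ω => ?_
    rw [cf_fdiag, Pi.one_apply, Pi.one_apply, ← map_one (sc (K := Q.F) (R := Q.Val)), cf_sc,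
      Matrix.one_apply, map_one]
    by_cases h1 : f = f' <;> by_cases h2 : ω = 0 <;> simp [h1, h2]
  map_zero' := by
    refine fam_ext fun Q f f' ω => ?_
    rw [cf_fdiag, Pi.zero_apply, Pi.zero_apply, cf_zero, map_zero, ite_self]
  map_mul' φ ψ := by
    refine fam_ext fun Q f f' ω => ?_
    rw [cf_fdiag_mul, cf_fdiag, cf_fdiag, Pi.mul_apply, map_mul, mul_ite, mul_zero]
  map_add' φ ψ := by
    refine fam_ext fun Q f f' ω => ?_
    rw [Pi.add_apply, cf_add, cf_fdiag, cf_fdiag, cf_fdiag, Pi.add_apply, map_add]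
    split_ifs
    · rfl
    · rw [add_zero]
  commutes' p := by
    classical
    refine fam_ext fun Q f f' ω => ?_
    rw [Algebra.algebraMap_eq_smul_one, Algebra.algebraMap_eq_smul_one, Pi.smul_apply, cf_smul,
      Pi.one_apply, cf_fdiag, ← map_one (sc (K := Q.F) (R := Q.Val)), cf_sc, Matrix.one_apply,
      Pi.smul_apply, Pi.one_apply, smul_eq_mul, mul_one]
    by_cases h1 : f = f' <;> by_cases h2 : ω = 0 <;> simp [h1, h2]

lemma fdiag_mul (φ ψ : (Fin (n + 1) → ℕ) → Lau) :
    (fdiag (φ * ψ) : ∀ Q, Conv n d Q) = fdiag φ * fdiag ψ := map_mul (fdiagHom n d) φ ψ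

lemma fdiag_one : (fdiag 1 : ∀ Q, Conv n d Q) = 1 := map_one (fdiagHom n d)

lemma fdiag_smul (p : Lau) (φ : (Fin (n + 1) → ℕ) → Lau) :
    (fdiag (p • φ) : ∀ Q, Conv n d Q) = p • fdiag φ := map_smul (fdiagHom n d) p φ

lemma fdiag_congr {φ ψ : (Fin (n + 1) → ℕ) → Lau}
    (h : ∀ (Q : PrimePow) (f : Flag Q.F n d), φ (dims f) = ψ (dims f)) :
    (fdiag φ : ∀ Q, Conv n d Q) = fdiag ψ :=
  fam_ext fun Q f f' ω => by rw [cf_fdiag, cf_fdiag, h]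

lemma fdiag_comm (φ ψ : (Fin (n + 1) → ℕ) → Lau) :
    (fdiag φ * fdiag ψ : ∀ Q, Conv n d Q) = fdiag ψ * fdiag φ := by
  rw [← fdiag_mul, mul_comm, fdiag_mul]

/-- The dimensions before an elementary step in terms of the dimensions after the step. -/
def shift (i : Fin (n - 1)) (δ : Fin (n + 1) → ℕ) : Fin (n + 1) → ℕ :=
  Function.update δ (mid i) (δ (mid i) + 1)

lemma EStep.dims_eq {K : Type} [Field K] {i : Fin (n - 1)} {f f' : Flag K n d}
    (h : EStep i f f') : dims f = shift i (dims f') := by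
  funext s
  by_cases hs : s = mid i
  · subst hs
    rw [shift, Function.update_self]
    exact h.2.2
  · rw [shift, Function.update_of_ne hs]
    unfold dims
    rw [h.1 s hs]

lemma gr_shift (i : Fin (n - 1)) (δ : Fin (n + 1) → ℕ) (a : Fin n) :
    gr (shift i δ) a = gr δ a + wt a i := by
  have h1 : a.succ = mid i ↔ a = lo i := by
    rw [Fin.ext_iff, Fin.ext_iff, Fin.val_succ, val_mid, val_lo]
    omega
  have h2 : a.castSucc = mid i ↔ a = hi i := by
    rw [Fin.ext_iff, Fin.ext_iff, Fin.val_castSucc, val_mid, val_hi]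
  unfold gr shift wt
  rw [Function.update_apply, Function.update_apply, if_congr h1 rfl rfl, if_congr h2 rfl rfl]
  by_cases h3 : a = lo i
  · have h4 : a ≠ hi i := h3 ▸ DecMat.lo_ne_hi i
    rw [if_pos h3, if_neg h4, if_pos h3, if_neg h4, ← h1.2 h3]
    push_cast
    ring
  · by_cases h4 : a = hi i
    · rw [if_neg h3, if_pos h4, if_neg h3, if_pos h4, ← h2.2 h4]
      push_cast
      ring
    · rw [if_neg h3, if_neg h4, if_neg h3, if_neg h4]
      ring

open Classical in
lemma cf_Efam (i : Fin (n - 1)) (Q : PrimePow) (f f' : Flag Q.F n d) (ω : Fin d → Q.F) :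
    cf (R := Q.Val) (Efam i Q) f f' ω = if EStep i f f' ∧ ω = 0 then 1 else 0 := by
  unfold Efam
  rw [cf_sc, Eh, Matrix.of_apply]
  by_cases h1 : EStep i f f' <;> by_cases h2 : ω = 0 <;> simp [h1, h2]

open Classical in
lemma cf_Ffam (i : Fin (n - 1)) (Q : PrimePow) (f f' : Flag Q.F n d) (ω : Fin d → Q.F) :
    cf (R := Q.Val) (Ffam i Q) f f' ω = if EStep i f' f ∧ ω = 0 then 1 else 0 :=
  cf_Efam i Q f' f ω

open Classical in
lemma cf_Ifam (s : Fin (n + 1)) (Q : PrimePow) (f f' : Flag Q.F n d) (ω : Fin d → Q.F) :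
    cf (R := Q.Val) (Ifam s Q) f f' ω = if f = f' ∧ ω ∈ f.1 s then 1 else 0 := by
  change (Matrix.diagonal (fun f : Flag Q.F n d => ind Q.Val (f.1 s)) f f').coeff ω = _
  rw [Matrix.diagonal_apply]
  by_cases h1 : f = f'
  · rw [if_pos h1, coeff_ind]
    simp [h1]
  · rw [if_neg h1, if_neg fun h => h1 h.1]
    rfl

lemma fdiag_mul_Efam (φ : (Fin (n + 1) → ℕ) → Lau) (i : Fin (n - 1)) :
    (fdiag φ * Efam i : ∀ Q, Conv n d Q) = Efam i * fdiag fun δ => φ (shift i δ) := by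
  refine fam_ext fun Q f f' ω => ?_
  rw [cf_fdiag_mul, cf_mul_fdiag, cf_Efam]
  split_ifs with h
  · rw [h.1.dims_eq, mul_comm]
  · rw [mul_zero, zero_mul]

lemma Ffam_mul_fdiag (φ : (Fin (n + 1) → ℕ) → Lau) (i : Fin (n - 1)) :
    (Ffam i * fdiag φ : ∀ Q, Conv n d Q) = (fdiag fun δ => φ (shift i δ)) * Ffam i := by
  refine fam_ext fun Q f f' ω => ?_
  rw [cf_fdiag_mul, cf_mul_fdiag, cf_Ffam]
  split_ifs with h
  · rw [h.1.dims_eq, mul_comm]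
  · rw [mul_zero, zero_mul]

lemma fdiag_mul_Ifam (φ : (Fin (n + 1) → ℕ) → Lau) (s : Fin (n + 1)) :
    (fdiag φ * Ifam s : ∀ Q, Conv n d Q) = Ifam s * fdiag φ := by
  refine fam_ext fun Q f f' ω => ?_
  rw [cf_fdiag_mul, cf_mul_fdiag, cf_Ifam]
  split_ifs with h
  · rw [h.1, mul_comm]
  · rw [mul_zero, zero_mul]

/-- The diagonal family with entries `v ^ k(δ)`. -/
def fpow (k : (Fin (n + 1) → ℕ) → ℤ) : ∀ Q, Conv n d Q := fdiag fun δ => LaurentPolynomial.T (k δ)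

lemma fpow_mul (k l : (Fin (n + 1) → ℕ) → ℤ) :
    (fpow k * fpow l : ∀ Q, Conv n d Q) = fpow (k + l) := by
  unfold fpow
  rw [← fdiag_mul]
  congr 1
  funext δ
  exact (LaurentPolynomial.T_add _ _).symm

lemma fpow_zero : (fpow 0 : ∀ Q, Conv n d Q) = 1 := fdiag_one

lemma fpow_comm (k l : (Fin (n + 1) → ℕ) → ℤ) :
    (fpow k * fpow l : ∀ Q, Conv n d Q) = fpow l * fpow k := fdiag_comm _ _

lemma fpow_neg_mul (k : (Fin (n + 1) → ℕ) → ℤ) :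
    (fpow (-k) * fpow k : ∀ Q, Conv n d Q) = 1 := by
  rw [fpow_mul, neg_add_cancel, fpow_zero]

lemma fpow_mul_neg (k : (Fin (n + 1) → ℕ) → ℤ) :
    (fpow k * fpow (-k) : ∀ Q, Conv n d Q) = 1 := by
  rw [fpow_mul, add_neg_cancel, fpow_zero]

lemma fpow_add_const (k : (Fin (n + 1) → ℕ) → ℤ) (c : ℤ) :
    (fpow (fun δ => k δ + c) : ∀ Q, Conv n d Q) = (LaurentPolynomial.T c : Lau) • fpow k := by
  unfold fpow
  rw [← fdiag_smul]
  congr 1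
  funext δ
  rw [Pi.smul_apply, smul_eq_mul, mul_comm]
  exact LaurentPolynomial.T_add _ _

lemma fpow_mul_Efam (k : (Fin (n + 1) → ℕ) → ℤ) (i : Fin (n - 1)) (c : ℤ)
    (hk : ∀ δ, k (shift i δ) = k δ + c) :
    (fpow k * Efam i : ∀ Q, Conv n d Q) = (LaurentPolynomial.T c : Lau) • (Efam i * fpow k) := by
  rw [← mul_smul_comm, ← fpow_add_const]
  refine (fdiag_mul_Efam _ i).trans ?_
  simp only [hk]
  rfl

lemma fpow_mul_Ffam (k : (Fin (n + 1) → ℕ) → ℤ) (i : Fin (n - 1)) (c : ℤ)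
    (hk : ∀ δ, k (shift i δ) = k δ + c) :
    (Ffam i * fpow k : ∀ Q, Conv n d Q) = (LaurentPolynomial.T c : Lau) • (fpow k * Ffam i) := by
  rw [← smul_mul_assoc, ← fpow_add_const]
  refine (Ffam_mul_fdiag _ i).trans ?_
  simp only [hk]
  rfl

open Classical in
lemma cf_sum_e (P : DecMat n d → Prop) [DecidablePred P] (c : DecMat n d → Lau)
    {X : DecMat n d} {Q : PrimePow}
    {f f' : Flag Q.F n d} {ω : Fin d → Q.F} (h : InOrbit X f f' ω) :
    cf (R := Q.Val) ((∑ X with P X, c X • e X) Q) f f' ω = if P X then Q.ev (c X) else 0 := by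
  rw [Finset.sum_apply, cf_sum, Finset.sum_filter, Finset.sum_eq_single X]
  · rw [Pi.smul_apply, cf_smul, cf_e, if_pos h, mul_one]
  · intro Y _ hY
    rw [Pi.smul_apply, cf_smul, cf_e, if_neg fun h' : InOrbit Y f f' ω => hY (h'.unique h),
        mul_zero, ite_self]
  · exact fun h => absurd (Finset.mem_univ _) h

lemma coe_std (X : DecMat n d) : ((MS.std X : MS n d) : ∀ Q, Conv n d Q) =
    (LaurentPolynomial.T (-(X.dimOrbit : ℤ) + X.dimFlag) : Lau) • e X := rfl

lemma coe_smul_std (X : DecMat n d) (k : ℤ) :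
    (((LaurentPolynomial.T k : Lau) • MS.std X : MS n d) : ∀ Q, Conv n d Q) =
      (LaurentPolynomial.T (k + (-(X.dimOrbit : ℤ) + X.dimFlag)) : Lau) • e X := by
  rw [LaurentPolynomial.T_add, mul_smul]
  rfl

lemma InOrbit.gr_eq {K : Type} [Field K] {X : DecMat n d} {f : Flag K n d} {ω : Fin d → K}
    (h : InOrbit X f f ω) (a : Fin n) : gr (dims f) a = X.A a a := by
  rw [h.gr_left]
  refine Finset.sum_eq_single a (fun b _ hb => ?_) fun hn => absurd (Finset.mem_univ _) hn
  exact_mod_cast h.flag_eq_iff.1 rfl hb.symm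

lemma dims_zero {K : Type} [Field K] (f : Flag K n d) : dims f 0 = 0 := by
  unfold dims
  rw [f.2.2.1, finrank_bot]

variable [NeZero n]

/-- The normalization of `E_i` depends only on the dimensions of the lower flag. -/
lemma coe_E (i : Fin (n - 1)) : ((MS.E i : MS n d) : ∀ Q, Conv n d Q) =
    Efam i * fpow fun δ => -gr δ (lo i) := by
  classical
  unfold MS.E
  rw [AddSubmonoidClass.coe_finsetSum]
  simp only [coe_std]
  refine fam_ext fun Q f f' ω => ?_
  obtain ⟨X, hX⟩ := exists_orbit f f' ω
  refine (cf_sum_e (fun X => X.Δ = ∅ ∧ ∃ b : Fin n → ℕ,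
    X.A = Matrix.diagonal b + Matrix.single (lo i) (hi i) 1) _ hX).trans ?_
  rw [fpow, cf_mul_fdiag, cf_Efam]
  rw [if_congr (and_comm.trans (and_congr (hX.eStep_iff i).symm hX.vec_eq_zero_iff.symm)) rfl rfl]
  split_ifs with h
  · rw [one_mul]
    congr 2
    obtain ⟨h1, h2⟩ := DecMat.exists_diagonal_add_single_iff (DecMat.lo_ne_hi i) |>.1
      ((hX.eStep_iff i).1 h.1)
    rw [X.dimFlag_sub_dimOrbit_of_single (hX.vec_eq_zero_iff.1 h.2) (lo i, lo i) (lo i, hi i)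
      ⟨le_rfl, Nat.lt_succ_self _⟩, h2, hX.gr_right]
    · rw [Finset.sum_eq_single (lo i)]
      · norm_num
      · intro k _ hk
        by_contra hc
        rcases h1 k (lo i) (by exact_mod_cast hc) with h3 | h3
        · exact hk h3
        · exact hk h3.1
      · exact fun hn => absurd (Finset.mem_univ _) hn
    · intro k l k' l' hk hl h3 h4
      have h3' := h1 _ _ h3
      have h4' := h1 _ _ h4
      simp only [Fin.ext_iff, Fin.le_def, Fin.lt_def, val_lo, val_hi, Prod.mk.injEq] at *
      omega
  · rw [zero_mul]

lemma coe_F (i : Fin (n - 1)) : ((MS.F i : MS n d) : ∀ Q, Conv n d Q) =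
    Ffam i * fpow fun δ => -gr δ (hi i) := by
  classical
  unfold MS.F
  rw [AddSubmonoidClass.coe_finsetSum]
  simp only [coe_std]
  refine fam_ext fun Q f f' ω => ?_
  obtain ⟨X, hX⟩ := exists_orbit f f' ω
  have key : EStep i f' f ↔
      ∃ b : Fin n → ℕ, X.A = Matrix.diagonal b + Matrix.single (hi i) (lo i) 1 := by
    rw [hX.swap.eStep_iff]
    refine exists_congr fun b => ?_
    change X.A.transpose = _ ↔ _
    rw [← Matrix.transpose_inj, Matrix.transpose_transpose, Matrix.transpose_add,
      Matrix.diagonal_transpose, Matrix.transpose_single]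
  refine (cf_sum_e (fun X => X.Δ = ∅ ∧ ∃ b : Fin n → ℕ,
    X.A = Matrix.diagonal b + Matrix.single (hi i) (lo i) 1) _ hX).trans ?_
  rw [fpow, cf_mul_fdiag, cf_Ffam]
  rw [if_congr (and_comm.trans (and_congr key.symm hX.vec_eq_zero_iff.symm)) rfl rfl]
  split_ifs with h
  · rw [one_mul]
    congr 2
    obtain ⟨h1, h2⟩ := DecMat.exists_diagonal_add_single_iff (DecMat.lo_ne_hi i).symm |>.1
      (key.1 h.1)
    rw [X.dimFlag_sub_dimOrbit_of_single (hX.vec_eq_zero_iff.1 h.2) (hi i, lo i) (hi i, hi i)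
      ⟨le_rfl, Nat.lt_succ_self _⟩, h2, hX.gr_right]
    · rw [Finset.sum_eq_single (hi i)]
      · norm_num
      · intro k _ hk
        by_contra hc
        rcases h1 k (hi i) (by exact_mod_cast hc) with h3 | h3
        · exact hk h3
        · exact hk h3.1
      · exact fun hn => absurd (Finset.mem_univ _) hn
    · intro k l k' l' hk hl h3 h4
      have h3' := h1 _ _ h3
      have h4' := h1 _ _ h4
      simp only [Fin.ext_iff, Fin.le_def, Fin.lt_def, val_lo, val_hi, Prod.mk.injEq] at *
      omega
  · rw [zero_mul]

open Classical in
lemma sum_diag_eq_fpow (k : DecMat n d → ℤ) (l : (Fin (n + 1) → ℕ) → ℤ)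
    (h : ∀ (X : DecMat n d) (Q : PrimePow) (f : Flag Q.F n d), InOrbit X f f 0 →
      k X = l (dims f)) :
    (((∑ X : DecMat n d with X.Δ = ∅ ∧ X.A.IsDiag,
      (LaurentPolynomial.T (k X) : Lau) • MS.std X : MS n d)) : ∀ Q, Conv n d Q) = fpow l := by
  rw [AddSubmonoidClass.coe_finsetSum]
  simp only [coe_smul_std]
  refine fam_ext fun Q f f' ω => ?_
  obtain ⟨X, hX⟩ := exists_orbit f f' ω
  refine (cf_sum_e (fun X => X.Δ = ∅ ∧ X.A.IsDiag) _ hX).trans ?_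
  rw [fpow, cf_fdiag]
  rw [if_congr (and_comm.trans (and_congr hX.flag_eq_iff.symm hX.vec_eq_zero_iff.symm)) rfl rfl]
  split_ifs with h1
  · obtain ⟨rfl, rfl⟩ := h1
    rw [X.dimFlag_sub_dimOrbit_of_isDiag (hX.vec_eq_zero_iff.1 rfl) (hX.flag_eq_iff.1 rfl),
      add_zero, h X Q f hX]
  · rfl

lemma coe_H (a : Fin n) : ((MS.H a : MS n d) : ∀ Q, Conv n d Q) = fpow fun δ => gr δ a :=
  sum_diag_eq_fpow _ _ fun _ _ _ h => (h.gr_eq a).symm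

lemma coe_Hinv (a : Fin n) : ((MS.Hinv a : MS n d) : ∀ Q, Conv n d Q) =
    fpow fun δ => -gr δ a :=
  sum_diag_eq_fpow _ _ fun _ _ _ h => congrArg _ (h.gr_eq a).symm

lemma DecMat.dimFlag_sub_dimOrbit_of_corner (X : DecMat n d)
    (hΔ : X.Δ = {((0 : Fin n), (0 : Fin n))}) (hA : X.A.IsDiag) :
    -(X.dimOrbit : ℤ) + X.dimFlag = -(X.A 0 0 : ℤ) := by
  classical
  obtain ⟨Y, hYA, hYΔ⟩ : ∃ Y : DecMat n d, Y.A = X.A ∧ Y.Δ = ∅ :=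
    ⟨⟨X.A, ∅, X.sum_eq, by simp, by simp⟩, rfl, rfl⟩
  have e1 := Y.dimFlag_sub_dimOrbit_of_isDiag hYΔ (hYA ▸ hA)
  have e2 : X.dimOrbit = Y.dimOrbit + X.A 0 0 := by
    unfold DecMat.dimOrbit
    rw [hΔ, hYΔ, hYA]
    simp only [Finset.mem_singleton, exists_eq_left, Finset.notMem_empty, false_and,
      exists_false, if_false, Finset.sum_const_zero, add_zero]
    congr 1
    rw [Finset.sum_eq_single 0, Finset.sum_eq_single 0]
    · exact if_pos ⟨le_rfl, le_rfl⟩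
    · intro j _ hj
      exact if_neg fun h => hj (Fin.ext (Nat.le_zero.1 h.2))
    · exact fun hn => absurd (Finset.mem_univ _) hn
    · intro k _ hk
      exact Finset.sum_eq_zero fun j _ => if_neg fun h => hk (Fin.ext (Nat.le_zero.1 h.1))
    · exact fun hn => absurd (Finset.mem_univ _) hn
  have e3 : X.dimFlag = Y.dimFlag := by
    unfold DecMat.dimFlag
    rw [hYA]
  omega

/-- The two sums in the definition of `L` are supported on `ω = 0` and on the nonzero `ω ∈ f_1`. -/
lemma coe_L : ((MS.L : MS n d) : ∀ Q, Conv n d Q) =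
    (fpow fun δ => -2 * (δ (0 : Fin n).succ : ℤ)) * Ifam (0 : Fin n).succ := by
  classical
  unfold MS.L
  have hgr : ∀ (K : Type) [Field K] (f : Flag K n d),
      gr (dims f) 0 = dims f (0 : Fin n).succ := by
    intro K _ f
    unfold gr
    rw [Fin.castSucc_zero', dims_zero]
    simp
  have h1 := sum_diag_eq_fpow (n := n) (d := d) (fun X => -2 * (X.A 0 0 : ℤ))
    (fun δ => -2 * (δ (0 : Fin n).succ : ℤ)) fun X Q f h => by rw [← h.gr_eq, hgr]
  rw [Subalgebra.coe_add, h1, AddSubmonoidClass.coe_finsetSum]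
  simp only [coe_smul_std]
  refine fam_ext fun Q f f' ω => ?_
  obtain ⟨X, hX⟩ := exists_orbit f f' ω
  have h2 := cf_sum_e (fun X : DecMat n d => X.Δ = {((0 : Fin n), (0 : Fin n))} ∧ X.A.IsDiag)
    (fun X => LaurentPolynomial.T (-(X.A 0 0 : ℤ) + (-(X.dimOrbit : ℤ) + X.dimFlag))) hX
  rw [if_congr (and_congr_right' hX.flag_eq_iff.symm) rfl rfl] at h2
  rw [Pi.add_apply, cf_add, h2, fpow, cf_fdiag, cf_fdiag_mul, cf_Ifam]
  by_cases hf : f = f'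
  · subst hf
    have h0 : ω = 0 → ω ∈ f.1 (0 : Fin n).succ := fun h => h ▸ zero_mem _
    have h1 := hX.Δ_eq_zero_iff
    by_cases hω : ω = 0
    · rw [if_pos ⟨rfl, hω⟩, if_neg fun h => (h1.1 h.1).1 hω, if_pos ⟨rfl, h0 hω⟩, add_zero, mul_one]
    · by_cases hω2 : ω ∈ f.1 (0 : Fin n).succ
      · have hΔ := h1.2 ⟨hω, hω2⟩
        rw [if_neg fun h => hω h.2, if_pos ⟨hΔ, rfl⟩, if_pos ⟨rfl, hω2⟩, zero_add, mul_one]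
        congr 2
        rw [← hgr, hX.gr_eq]
        have hd := hX.flag_eq_iff.1 rfl
        rw [X.dimFlag_sub_dimOrbit_of_corner hΔ (hX.flag_eq_iff.1 rfl)]
        ring
      · rw [if_neg fun h => hω h.2, if_neg fun h => hω2 (h1.1 h.1).2, if_neg fun h => hω2 h.2,
          add_zero, mul_zero]
  · rw [if_neg fun h => hf h.1, if_neg fun h => hf h.2, if_neg fun h => hf h.1, add_zero, mul_zero]

end GeneratorFamilies

/-! ### Sums over elementary steps -/

section StepSums

open Submodule Module

variable {K : Type} [Field K] [Fintype K] {n d : ℕ}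

open Classical in
/-- The elementary steps with a given lower end correspond to subspaces. -/
lemma sum_eStep_to {M : Type*} [AddCommMonoid M] (i : Fin (n - 1)) (f : Flag K n d)
    {U : Submodule K (Fin d → K)} (hU : U ≤ f.1 (hi i).succ) (Φ : Submodule K (Fin d → K) → M) :
    ∑ g with EStep i g f ∧ g.1 (mid i) ≤ U, Φ (g.1 (mid i)) =
      ∑ Z ∈ between (f.1 (mid i)) U, Φ Z := by
  refine Finset.sum_bij (fun g _ => g.1 (mid i)) (fun g hg => ?_) (fun g hg g' hg' h => ?_)
    (fun Z hZ => ?_) fun _ _ => rfl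
  · obtain ⟨-, h1, h2⟩ := Finset.mem_filter.1 hg
    exact mem_between.2 ⟨h1.2.1, h2, h1.2.2⟩
  · obtain ⟨-, h1, -⟩ := Finset.mem_filter.1 hg
    obtain ⟨-, h2, -⟩ := Finset.mem_filter.1 hg'
    exact Flag.ext_mid (fun s hs => (h1.1 s hs).trans (h2.1 s hs).symm) h
  · obtain ⟨h1, h2, h3⟩ := mem_between.1 hZ
    refine ⟨f.replace i Z ((f.mono (castSucc_lo_lt_mid i).le).trans h1) (h2.trans hU), ?_,
      f.replace_mid i Z _ _⟩
    refine Finset.mem_filter.2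
      ⟨Finset.mem_univ _, ⟨fun s hs => f.replace_of_ne i Z _ _ hs, ?_, ?_⟩, ?_⟩
    · rwa [f.replace_mid]
    · rwa [f.replace_mid]
    · rwa [f.replace_mid]

open Classical in
/-- The elementary steps from a flag to the flags above a subspace of codimension two. -/
lemma sum_eStep_from {M : Type*} [AddCommMonoid M] (i : Fin (n - 1)) (f : Flag K n d)
    {N : Submodule K (Fin d → K)} (hN : f.1 (lo i).castSucc ≤ N)
    (hd : finrank K (f.1 (mid i)) = finrank K N + 2) (Φ : Submodule K (Fin d → K) → M) :
    ∑ g with EStep i f g ∧ N ≤ g.1 (mid i), Φ (g.1 (mid i)) =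
      ∑ Z ∈ between N (f.1 (mid i)), Φ Z := by
  refine Finset.sum_bij (fun g _ => g.1 (mid i)) (fun g hg => ?_) (fun g hg g' hg' h => ?_)
    (fun Z hZ => ?_) fun _ _ => rfl
  · obtain ⟨-, h1, h2⟩ := Finset.mem_filter.1 hg
    have := h1.2.2
    exact mem_between.2 ⟨h2, h1.2.1, by omega⟩
  · obtain ⟨-, h1, -⟩ := Finset.mem_filter.1 hg
    obtain ⟨-, h2, -⟩ := Finset.mem_filter.1 hg'
    exact Flag.ext_mid (fun s hs => (h1.1 s hs).symm.trans (h2.1 s hs)) h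
  · obtain ⟨h1, h2, h3⟩ := mem_between.1 hZ
    refine ⟨_, Finset.mem_filter.2 ⟨Finset.mem_univ _,
      eStep_replace f i Z (hN.trans h1) h2 (by omega), ?_⟩, f.replace_mid i Z _ _⟩
    rwa [f.replace_mid]

open Classical in
/-- The number of elementary steps from a flag. -/
lemma card_eStep_from {R : Type*} [Field R] [CharZero R] (i : Fin (n - 1)) (f : Flag K n d) :
    ((Nat.card K : R) - 1) * ((Finset.univ.filter fun g => EStep i f g).card : R) =
      (Nat.card K : R) ^ (dims f (mid i) - dims f (lo i).castSucc) - 1 := by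
  have hfin : Finite (Dual K (Fin d → K)) := Module.finite_of_finite K
  have := Fintype.ofFinite (Dual K (Fin d → K))
  have hle : f.1 (lo i).castSucc ≤ f.1 (mid i) := f.mono (castSucc_lo_lt_mid i).le
  have hmono : dims f (lo i).castSucc ≤ dims f (mid i) := Submodule.finrank_mono hle
  have hd : dims f (mid i) ≤ d := (Submodule.finrank_le _).trans_eq (Module.finrank_fin_fun K)
  have hq : (Nat.card K : R) ^ (d - dims f (mid i)) ≠ 0 :=
    pow_ne_zero _ (Nat.cast_ne_zero.2 Nat.card_pos.ne')
  -- the linear forms vanishing on the smaller space are counted according to the step they cut out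
  have h1 : (Nat.card {ξ : Dual K (Fin d → K) // f.1 (lo i).castSucc ≤ LinearMap.ker ξ ∧
      ¬ f.1 (mid i) ≤ LinearMap.ker ξ} : R) =
      ∑ g with EStep i f g, (Nat.card {ξ : Dual K (Fin d → K) // g.1 (mid i) ≤ LinearMap.ker ξ ∧
        ¬ f.1 (mid i) ≤ LinearMap.ker ξ} : R) := by
    simp only [Nat.card_eq_fintype_card, Fintype.card_subtype, Finset.card_filter, Nat.cast_sum]
    rw [Finset.sum_comm]
    refine Finset.sum_congr rfl fun ξ _ => ?_
    by_cases hg : f.1 (lo i).castSucc ≤ LinearMap.ker ξ ∧ ¬ f.1 (mid i) ≤ LinearMap.ker ξ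
    · obtain ⟨g, ⟨h3, h4⟩, h5⟩ := existsUnique_eStep_of_dual i f hg.1 hg.2
      rw [if_pos hg, Finset.sum_eq_single g]
      · rw [if_pos ⟨h4, hg.2⟩]
      · intro g' hg' hne
        rw [if_neg fun h6 => hne (h5 _ ⟨(Finset.mem_filter.1 hg').2, h6.1⟩), Nat.cast_zero]
      · exact fun hn => absurd (Finset.mem_filter.2 ⟨Finset.mem_univ _, h3⟩) hn
    · rw [if_neg hg, Nat.cast_zero]
      refine (Finset.sum_eq_zero fun g hg' => ?_).symm
      rw [if_neg, Nat.cast_zero]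
      intro h
      have h3 := (Finset.mem_filter.1 hg').2
      exact hg ⟨by
        rw [h3.castSucc_lo]
        exact (g.mono (castSucc_lo_lt_mid i).le).trans h.1, h.2⟩
  rw [card_duals_of_le hle, Finset.sum_congr rfl fun g hg =>
    card_duals (Finset.mem_filter.1 hg).2.2.1 (Finset.mem_filter.1 hg).2.2.2, Finset.sum_const,
    nsmul_eq_mul] at h1
  have h2 : (Nat.card K : R) ^ (d - finrank K (f.1 (lo i).castSucc)) =
      (Nat.card K : R) ^ (d - dims f (mid i)) *
        (Nat.card K : R) ^ (dims f (mid i) - dims f (lo i).castSucc) := by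
    rw [← pow_add]
    congr 1
    unfold dims at *
    omega
  rw [h2] at h1
  refine mul_left_cancel₀ hq ?_
  change _ - (Nat.card K : R) ^ (d - dims f (mid i)) =
    _ * ((Nat.card K : R) ^ (d - dims f (mid i)) * _) at h1
  linear_combination -h1

open Classical in
/-- The number of elementary steps to a flag. -/
lemma card_eStep_to {R : Type} [CommRing R] (i : Fin (n - 1)) (f : Flag K n d) :
    ((Nat.card K : R) - 1) * ((Finset.univ.filter fun g => EStep i g f).card : R) =
      (Nat.card K : R) ^ (dims f (hi i).succ - dims f (mid i)) - 1 := by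
  have h1 := sum_eStep_to i f le_rfl (fun _ => (1 : ℕ))
  rw [Finset.sum_const, Finset.sum_const, smul_eq_mul, smul_eq_mul, mul_one, mul_one] at h1
  have h2 : (Finset.univ.filter fun g => EStep i g f ∧ g.1 (mid i) ≤ f.1 (hi i).succ) =
      Finset.univ.filter fun g => EStep i g f := by
    refine Finset.filter_congr fun g _ => and_iff_left_of_imp fun h => ?_
    rw [← h.succ_hi]
    exact g.mono (mid_lt_succ_hi i).le
  rw [h2] at h1
  rw [h1]
  exact card_between (f.mono (mid_lt_succ_hi i).le)

end StepSums

/-! ### The subalgebra generated by the generators -/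

section Interpolation

variable {n d : ℕ} {A : Subalgebra Lau (∀ Q, Conv n d Q)}

lemma T_sub_T_ne_zero {k l : ℤ} (h : k ≠ l) :
    (LaurentPolynomial.T k - LaurentPolynomial.T l : Lau) ≠ 0 := by
  intro h0
  have h1 := sub_eq_zero.1 h0
  have h2 : (Finsupp.single k 1 : ℤ →₀ ℤ) k = (Finsupp.single l 1 : ℤ →₀ ℤ) k :=
    congrArg (fun p : Lau => p.coeff k) h1
  rw [Finsupp.single_eq_same, Finsupp.single_eq_of_ne h] at h2
  exact one_ne_zero h2

/-- Lagrange interpolation: the functions `v ^ {δ_s}` generate, up to denominators, all functions on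
the points with coordinates at most `d`. -/
lemma interpolation {m d : ℕ} {B : Subalgebra Lau ((Fin m → ℕ) → Lau)}
    (hsat : ∀ (p : Lau) (φ : (Fin m → ℕ) → Lau), p ≠ 0 → p • φ ∈ B → φ ∈ B)
    (hcongr : ∀ φ ψ : (Fin m → ℕ) → Lau, ψ ∈ B →
      (∀ δ : Fin m → ℕ, (∀ s, δ s < d + 1) → φ δ = ψ δ) → φ ∈ B)
    (hK : ∀ s, (fun δ => LaurentPolynomial.T (δ s : ℤ)) ∈ B) (φ : (Fin m → ℕ) → Lau) : φ ∈ B := by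
  classical
  -- the characteristic function of `δ s = k`, up to the factor `∏ (v ^ k - v ^ l)`
  have h1 : ∀ (s : Fin m) (k : ℕ), (fun δ => if δ s = k then 1 else 0) ∈ B := by
    intro s k
    refine hsat (∏ l ∈ (Finset.range (d + 1)).erase k,
      (LaurentPolynomial.T (k : ℤ) - LaurentPolynomial.T (l : ℤ))) _
      (Finset.prod_ne_zero_iff.2 fun l hl => T_sub_T_ne_zero ?_) ?_
    · exact_mod_cast (Finset.ne_of_mem_erase hl).symm
    · refine hcongr _ (∏ l ∈ (Finset.range (d + 1)).erase k,
        ((fun δ => LaurentPolynomial.T (δ s : ℤ)) - algebraMap Lau _ (LaurentPolynomial.T (l : ℤ))))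
        (prod_mem fun l _ => sub_mem (hK s) (Subalgebra.algebraMap_mem B _)) fun δ hδ => ?_
      rw [Finset.prod_apply, Pi.smul_apply, smul_eq_mul]
      split_ifs with h
      · rw [mul_one]
        refine Finset.prod_congr rfl fun l _ => ?_
        rw [← h]
        rfl
      · rw [mul_zero]
        refine (Finset.prod_eq_zero (i := δ s) (Finset.mem_erase.2 ⟨h, Finset.mem_range.2 (hδ s)⟩)
          ?_).symm
        exact sub_self _
  -- every function is a linear combination of the characteristic functions of points
  refine hcongr _ (∑ r : Fin m → Fin (d + 1), φ (fun s => r s) •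
    ∏ s, fun δ => if δ s = (r s : ℕ) then 1 else 0)
    (sum_mem fun r _ => Subalgebra.smul_mem B (prod_mem fun s _ => h1 s _) _) fun δ hδ => ?_
  rw [Finset.sum_apply, Finset.sum_eq_single fun s => ⟨δ s, hδ s⟩]
  · rw [Pi.smul_apply, Finset.prod_apply, Finset.prod_eq_one fun s _ => if_pos rfl, smul_eq_mul,
      mul_one]
  · intro r _ hr
    obtain ⟨s, hs⟩ := Function.ne_iff.1 hr
    rw [Pi.smul_apply, Finset.prod_apply, Finset.prod_eq_zero (Finset.mem_univ s), smul_zero]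
    exact if_neg fun h => hs (Fin.ext h.symm)
  · exact fun h => absurd (Finset.mem_univ _) h

/-- A saturated subalgebra which contains the diagonal families `v ^ {dim f_s}` contains all
diagonal families. -/
lemma fdiag_mem_of_saturated
    (hsat : ∀ (p : Lau) (x : ∀ Q, Conv n d Q), p ≠ 0 → p • x ∈ A → x ∈ A)
    (hK : ∀ s, fpow (fun δ => (δ s : ℤ)) ∈ A) (φ : (Fin (n + 1) → ℕ) → Lau) : fdiag φ ∈ A := by
  refine interpolation (d := d) (B := A.comap (fdiagHom n d)) (fun p φ hp h => ?_)
    (fun φ ψ hψ h => ?_) hK φ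
  · refine hsat p (fdiag φ) hp ?_
    rw [← fdiag_smul]
    exact h
  · have : (fdiag φ : ∀ Q, Conv n d Q) = fdiag ψ := fdiag_congr fun Q f => h _ fun s =>
      Nat.lt_succ_of_le ((Submodule.finrank_le _).trans_eq (Module.finrank_fin_fun _))
    change fdiag φ ∈ A
    rw [this]
    exact hψ

end Interpolation

section Recursion

open Submodule Module

variable {n d : ℕ}

open Classical in
lemma sc_Eh_apply {K : Type} [Field K] [Fintype K] {R : Type} [CommRing R] (i : Fin (n - 1))
    (f f' : Flag K n d) : (sc (Eh K R i) : CV K R n d) f f' = if EStep i f f' then 1 else 0 := by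
  change algebraMap R _ (if EStep i f f' then 1 else 0) = _
  split_ifs
  · exact map_one _
  · exact map_zero _

lemma fdiag_mul_apply (φ : (Fin (n + 1) → ℕ) → Lau) (x : ∀ Q, Conv n d Q) (Q : PrimePow)
    (f f' : Flag Q.F n d) : (fdiag φ * x : ∀ Q, Conv n d Q) Q f f' =
      Q.ev (φ (dims f)) • x Q f f' := by
  refine AddMonoidAlgebra.ext (Finsupp.ext fun ω => ?_)
  exact cf_fdiag_mul φ x Q f f' ω

lemma mul_fdiag_apply (φ : (Fin (n + 1) → ℕ) → Lau) (x : ∀ Q, Conv n d Q) (Q : PrimePow)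
    (f f' : Flag Q.F n d) : (x * fdiag φ : ∀ Q, Conv n d Q) Q f f' =
      Q.ev (φ (dims f')) • x Q f f' := by
  refine AddMonoidAlgebra.ext (Finsupp.ext fun ω => ?_)
  exact (cf_mul_fdiag φ x Q f f' ω).trans (mul_comm _ _)

lemma Ifam_mul_apply (s : Fin (n + 1)) (x : ∀ Q, Conv n d Q) (Q : PrimePow)
    (f f' : Flag Q.F n d) :
    (Ifam s * x : ∀ Q, Conv n d Q) Q f f' = ind Q.Val (f.1 s) * x Q f f' :=
  Matrix.diagonal_mul _ _ _ _

lemma mul_Ifam_apply (s : Fin (n + 1)) (x : ∀ Q, Conv n d Q) (Q : PrimePow)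
    (f f' : Flag Q.F n d) :
    (x * Ifam s : ∀ Q, Conv n d Q) Q f f' = x Q f f' * ind Q.Val (f'.1 s) :=
  Matrix.mul_diagonal _ _ _ _

open Classical in
lemma Efam_mul_apply (i : Fin (n - 1)) (x : ∀ Q, Conv n d Q) (Q : PrimePow)
    (f f' : Flag Q.F n d) :
    (Efam i * x : ∀ Q, Conv n d Q) Q f f' = ∑ g with EStep i f g, x Q g f' := by
  refine (Matrix.mul_apply).trans ?_
  rw [Finset.sum_filter]
  refine Finset.sum_congr rfl fun g _ => ?_
  unfold Efam
  rw [sc_Eh_apply, ite_mul, one_mul, zero_mul]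

open Classical in
lemma mul_Efam_apply (i : Fin (n - 1)) (x : ∀ Q, Conv n d Q) (Q : PrimePow)
    (f f' : Flag Q.F n d) :
    (x * Efam i : ∀ Q, Conv n d Q) Q f f' = ∑ g with EStep i g f', x Q f g := by
  refine (Matrix.mul_apply).trans ?_
  rw [Finset.sum_filter]
  refine Finset.sum_congr rfl fun g _ => ?_
  unfold Efam
  rw [sc_Eh_apply, mul_ite, mul_one, mul_zero]

open Classical in
lemma Efam_apply (i : Fin (n - 1)) (Q : PrimePow) (f f' : Flag Q.F n d) :
    (Efam i : ∀ Q, Conv n d Q) Q f f' = if EStep i f f' then 1 else 0 := sc_Eh_apply i f f'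

open Classical in
lemma Ffam_apply (i : Fin (n - 1)) (Q : PrimePow) (f f' : Flag Q.F n d) :
    (Ffam i : ∀ Q, Conv n d Q) Q f f' = if EStep i f' f then 1 else 0 := sc_Eh_apply i f' f

lemma fam_ext' {x y : ∀ Q, Conv n d Q}
    (h : ∀ (Q : PrimePow) (f f' : Flag Q.F n d), x Q f f' = y Q f f') : x = y :=
  funext fun Q => Matrix.ext fun f f' => h Q f f'

/-- The recursion which expresses the characteristic function of a term of the flag by the one of
the preceding term. On the diagonal, the subspaces `Z` between `N = f_{mid i}` and the next term `U`
with `dim Z = dim N + 1` satisfy `∑ ind Z = ind U + (# - 1) ind N`; off the diagonal, the second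
summand cancels the first one, because `ind N * ind N'` is a multiple of `ind (N + N')`. -/
lemma Ifam_succ (i : Fin (n - 1)) : (Ifam (hi i).succ : ∀ Q, Conv n d Q) =
    Ffam i * Ifam (mid i) * Efam i
      - fpow (fun δ => 2 - 2 * (δ (mid i) : ℤ)) * (Ifam (mid i) * (Ffam i * Efam i) * Ifam (mid i))
      + fpow (fun δ => 2 * gr δ (hi i)) * Ifam (mid i) := by
  classical
  refine fam_ext' fun Q f f' => ?_
  change _ = (Ffam i * Ifam (mid i) * Efam i : ∀ Q, Conv n d Q) Q f f'
    - (fpow (fun δ => 2 - 2 * (δ (mid i) : ℤ)) *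
      (Ifam (mid i) * (Ffam i * Efam i) * Ifam (mid i)) : ∀ Q, Conv n d Q) Q f f'
    + (fpow (fun δ => 2 * gr δ (hi i)) * Ifam (mid i) : ∀ Q, Conv n d Q) Q f f'
  have e1 : (Ffam i * Ifam (mid i) * Efam i : ∀ Q, Conv n d Q) Q f f' =
      ∑ g with EStep i g f', if EStep i g f then ind Q.Val (g.1 (mid i)) else 0 := by
    rw [mul_Efam_apply]
    refine Finset.sum_congr rfl fun g _ => ?_
    rw [mul_Ifam_apply, Ffam_apply, ite_mul, one_mul, zero_mul]
  have e2 : (Ffam i * Efam i : ∀ Q, Conv n d Q) Q f f' =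
      ∑ g with EStep i g f', if EStep i g f then 1 else 0 := by
    rw [mul_Efam_apply]
    exact Finset.sum_congr rfl fun g _ => Ffam_apply _ _ _ _
  have e3 : (Ifam (hi i).succ : ∀ Q, Conv n d Q) Q f f' =
      if f = f' then ind Q.Val (f.1 (hi i).succ) else 0 := Matrix.diagonal_apply _ _ _
  have e4 : (Ifam (mid i) : ∀ Q, Conv n d Q) Q f f' =
      if f = f' then ind Q.Val (f.1 (mid i)) else 0 := Matrix.diagonal_apply _ _ _
  have hq : (Nat.card Q.F : Q.Val) ≠ 0 := Nat.cast_ne_zero.2 Nat.card_pos.ne'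
  unfold fpow
  rw [fdiag_mul_apply, fdiag_mul_apply, mul_Ifam_apply, Ifam_mul_apply, e1, e2, e3, e4]
  by_cases hf : f = f'
  · subst hf
    rw [if_pos rfl, if_pos rfl]
    have hNU : f.1 (mid i) ≤ f.1 (hi i).succ := f.mono (mid_lt_succ_hi i).le
    have h1 : (∑ g with EStep i g f, if EStep i g f then ind Q.Val (g.1 (mid i)) else 0) =
        ∑ Z ∈ between (f.1 (mid i)) (f.1 (hi i).succ), ind Q.Val Z := by
      rw [← sum_eStep_to i f le_rfl]
      refine Finset.sum_congr ?_ fun g hg => if_pos (Finset.mem_filter.1 hg).2.1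
      refine Finset.filter_congr fun g _ => ⟨fun h => ⟨h, ?_⟩, fun h => h.1⟩
      rw [← h.succ_hi]
      exact g.mono (mid_lt_succ_hi i).le
    have h2 : (∑ g with EStep i g f, if EStep i g f then
        (1 : AddMonoidAlgebra Q.Val (Fin d → Q.F)) else 0) =
        ((between (f.1 (mid i)) (f.1 (hi i).succ)).card : Q.Val) • 1 := by
      have := sum_eStep_to i f le_rfl fun _ => (1 : AddMonoidAlgebra Q.Val (Fin d → Q.F))
      rw [Nat.cast_smul_eq_nsmul, ← Finset.sum_const, ← this]
      refine Finset.sum_congr ?_ fun g hg => if_pos (Finset.mem_filter.1 hg).2.1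
      refine Finset.filter_congr fun g _ => ⟨fun h => ⟨h, ?_⟩, fun h => h.1⟩
      rw [← h.succ_hi]
      exact g.mono (mid_lt_succ_hi i).le
    have h3 := card_between (R := Q.Val) hNU
    have hmono : finrank Q.F (f.1 (mid i)) ≤ finrank Q.F (f.1 (hi i).succ) :=
      Submodule.finrank_mono hNU
    have h4 : Q.ev (LaurentPolynomial.T (2 - 2 * (dims f (mid i) : ℤ))) *
        (Nat.card (f.1 (mid i)) : Q.Val) = Nat.card Q.F := by
      rw [Module.natCard_eq_pow_finrank (K := Q.F) (V := f.1 (mid i)), Q.ev_T]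
      push_cast
      rw [← Q.rt_sq, ← pow_mul, ← zpow_natCast, ← zpow_natCast, ← zpow_add₀ Q.rt_ne_zero]
      congr 1
      unfold dims
      push_cast
      ring
    have h5 : Q.ev (LaurentPolynomial.T (2 * gr (dims f) (hi i))) =
        (Nat.card Q.F : Q.Val) ^ (finrank Q.F (f.1 (hi i).succ) - finrank Q.F (f.1 (mid i))) := by
      rw [Q.ev_T, ← Q.rt_sq, ← pow_mul, ← zpow_natCast]
      congr 1
      unfold gr
      rw [castSucc_hi]
      unfold dims
      push_cast [hmono]
      ring
    rw [h1, h2, sum_ind_between hNU, mul_smul_comm, mul_one, smul_mul_assoc,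
      ind_mul_ind_of_le le_rfl, h5, smul_smul, smul_smul]
    beta_reduce
    rw [mul_right_comm, h4]
    rw [← sub_eq_zero, show ∀ (x y : AddMonoidAlgebra Q.Val (Fin d → Q.F)) (a b c : Q.Val),
      x - (x + a • y - b • y + c • y) = (b - a - c) • y from fun x y a b c => by module]
    convert zero_smul Q.Val (ind Q.Val (f.1 (mid i))) using 2
    linear_combination h3
  · rw [if_neg hf, if_neg hf, smul_zero, add_zero, eq_comm, sub_eq_zero]
    rw [Finset.mul_sum, Finset.sum_mul, Finset.smul_sum]
    refine Finset.sum_congr rfl fun g hg => ?_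
    have hg' := (Finset.mem_filter.1 hg).2
    split_ifs with h
    · have hne : f.1 (mid i) ≠ f'.1 (mid i) := fun he =>
        hf (Flag.ext_mid (fun s hs => (h.1 s hs).symm.trans (hg'.1 s hs)) he)
      have hsup : f.1 (mid i) ⊔ f'.1 (mid i) = g.1 (mid i) := by
        refine eq_of_le_of_finrank_le (sup_le h.2.1 hg'.2.1) ?_
        rw [h.2.2]
        refine Submodule.finrank_lt_finrank_of_lt (lt_of_le_of_ne le_sup_left fun he => hne ?_)
        refine (eq_of_le_of_finrank_eq (he ▸ le_sup_right) ?_).symm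
        have a1 := h.2.2
        have a2 := hg'.2.2
        omega
      have hinf := Submodule.finrank_sup_add_finrank_inf_eq (f.1 (mid i)) (f'.1 (mid i))
      rw [hsup] at hinf
      have a1 := h.2.2
      have a2 := hg'.2.2
      rw [mul_one, ind_mul_ind, hsup, smul_smul]
      have h4 : Q.ev (LaurentPolynomial.T (2 - 2 * (dims f (mid i) : ℤ))) *
          (Nat.card (f.1 (mid i) ⊓ f'.1 (mid i) : Submodule Q.F (Fin d → Q.F)) : Q.Val) = 1 := by
        rw [Module.natCard_eq_pow_finrank (K := Q.F), Q.ev_T]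
        push_cast
        rw [← Q.rt_sq, ← pow_mul, ← zpow_natCast, ← zpow_add₀ Q.rt_ne_zero]
        convert zpow_zero Q.rt using 2
        unfold dims
        push_cast
        omega
      rw [h4, one_smul]
    · rw [mul_zero, zero_mul, smul_zero]

end Recursion

section Generation

open Submodule Module

variable {n d : ℕ} [NeZero n] {A : Subalgebra Lau (∀ Q, Conv n d Q)}

/-- A saturated subalgebra which contains the generators contains the characteristic functions of
all orbits. The diagonal families come from the `H_a` by interpolation, and the families `Ifam s`
from `L` by the recursion `Ifam_succ`. -/
theorem e_mem_of_generators
    (hsat : ∀ (p : Lau) (x : ∀ Q, Conv n d Q), p ≠ 0 → p • x ∈ A → x ∈ A)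
    (hE : ∀ i, ((MS.E i : MS n d) : ∀ Q, Conv n d Q) ∈ A)
    (hF : ∀ i, ((MS.F i : MS n d) : ∀ Q, Conv n d Q) ∈ A)
    (hH : ∀ a, ((MS.H a : MS n d) : ∀ Q, Conv n d Q) ∈ A)
    (hL : ((MS.L : MS n d) : ∀ Q, Conv n d Q) ∈ A) (X : DecMat n d) : e X ∈ A := by
  have hK : ∀ s, (fpow fun δ => (δ s : ℤ) : ∀ Q, Conv n d Q) ∈ A := by
    intro s
    induction s using Fin.induction with
    | zero =>
      have : (fpow fun δ => (δ 0 : ℤ) : ∀ Q, Conv n d Q) = fpow 0 :=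
        fdiag_congr fun Q f => by
          change LaurentPolynomial.T ((dims f 0 : ℕ) : ℤ) = LaurentPolynomial.T 0
          rw [dims_zero, Nat.cast_zero]
      rw [this, fpow_zero]
      exact one_mem A
    | succ a ih =>
      have : (fpow fun δ => (δ a.succ : ℤ) : ∀ Q, Conv n d Q) =
          (MS.H a : MS n d).1 * fpow fun δ => (δ a.castSucc : ℤ) := by
        rw [coe_H, fpow_mul]
        congr 1
        funext δ
        exact (sub_add_cancel _ _).symm
      rw [this]
      exact mul_mem (hH a) ih
  have hD := fdiag_mem_of_saturated hsat hK
  have hE' : ∀ i, Efam i ∈ A := fun i => by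
    have : (Efam i : ∀ Q, Conv n d Q) = (MS.E i : MS n d).1 * fpow fun δ => gr δ (lo i) := by
      rw [coe_E, mul_assoc]
      exact ((congrArg _ (fpow_neg_mul _)).trans (mul_one _)).symm
    rw [this]
    exact mul_mem (hE i) (hD _)
  have hF' : ∀ i, Ffam i ∈ A := fun i => by
    have : (Ffam i : ∀ Q, Conv n d Q) = (MS.F i : MS n d).1 * fpow fun δ => gr δ (hi i) := by
      rw [coe_F, mul_assoc]
      exact ((congrArg _ (fpow_neg_mul _)).trans (mul_one _)).symm
    rw [this]
    exact mul_mem (hF i) (hD _)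
  have hI : ∀ s, Ifam s ∈ A := by
    intro s
    induction s using Fin.induction with
    | zero =>
      have : (Ifam 0 : ∀ Q, Conv n d Q) = 1 := by
        refine fam_ext fun Q f f' ω => ?_
        rw [← fdiag_one, cf_Ifam, cf_fdiag, Pi.one_apply, map_one, f.2.2.1, Submodule.mem_bot]
        congr
      rw [this]
      exact one_mem A
    | succ a ih =>
      by_cases ha : (a : ℕ) = 0
      · have h0 : a = 0 := Fin.ext ha
        subst h0
        have : (Ifam (0 : Fin n).succ : ∀ Q, Conv n d Q) =
            (fpow fun δ => -(-2 * (δ (0 : Fin n).succ : ℤ))) * (MS.L : MS n d).1 := by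
          rw [coe_L, ← mul_assoc]
          exact ((congrArg (· * _) (fpow_neg_mul _)).trans (one_mul _)).symm
        rw [this]
        exact mul_mem (hD _) hL
      · let i : Fin (n - 1) := ⟨a - 1, by omega⟩
        have h1 : hi i = a := Fin.ext (by rw [val_hi]; change (a : ℕ) - 1 + 1 = a; omega)
        have h2 : mid i = a.castSucc := by rw [← castSucc_hi, h1]
        rw [← h1, Ifam_succ, h2]
        exact add_mem (sub_mem (mul_mem (mul_mem (hF' i) ih) (hE' i))
          (mul_mem (hD _) (mul_mem (mul_mem ih (mul_mem (hF' i) (hE' i))) ih))) (mul_mem (hD _) ih)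
  exact e_mem_of_saturated hsat hE' hF' hI hD X

end Generation

/-! ### Relations between elementary steps -/

section StepRelations

open Submodule Module

variable {n d : ℕ}

section Pairs

variable {K : Type} [Field K] {i j : Fin (n - 1)} {f g f' : Flag K n d}

/-- The term of `f'` at `mid i` is a subspace of codimension `k` of the term of `f`. -/
def Drop (k : ℕ) (i : Fin (n - 1)) (f f' : Flag K n d) : Prop :=
  f'.1 (mid i) ≤ f.1 (mid i) ∧ finrank K (f.1 (mid i)) = finrank K (f'.1 (mid i)) + k

/-- The flags `f` and `f'` agree outside of `mid i` and `mid j`. -/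
def Agree (i j : Fin (n - 1)) (f f' : Flag K n d) : Prop :=
  ∀ s, s ≠ mid i → s ≠ mid j → f.1 s = f'.1 s

lemma mid_injective : Function.Injective (mid : Fin (n - 1) → Fin (n + 1)) := fun i j h => by
  have := congrArg Fin.val h
  rw [val_mid, val_mid] at this
  exact Fin.ext (by omega)

lemma castSucc_lo_eq_mid_iff : (lo i).castSucc = mid j ↔ (j : ℕ) + 1 = i := by
  rw [Fin.ext_iff, Fin.val_castSucc, val_lo, val_mid, eq_comm]

lemma succ_hi_eq_mid_iff : (hi i).succ = mid j ↔ (i : ℕ) + 1 = j := by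
  rw [Fin.ext_iff, Fin.val_succ, val_hi, val_mid]
  omega

lemma Agree.castSucc_lo_le (h : Agree i j f f') (hij : (j : ℕ) + 1 ≠ i) :
    f.1 (lo i).castSucc ≤ f'.1 (mid i) := by
  rw [h _ (castSucc_lo_ne_mid i) fun e => hij (castSucc_lo_eq_mid_iff.1 e)]
  exact f'.mono (castSucc_lo_lt_mid i).le

lemma Agree.comm (h : Agree i j f f') : Agree j i f f' := fun s h1 h2 => h s h2 h1

lemma eStep_and_eStep_iff (hij : i ≠ j) :
    EStep i f g ∧ EStep j g f' ↔ (Agree i j f f' ∧ Drop 1 i f f' ∧ Drop 1 j f f') ∧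
      ((∀ s, s ≠ mid i → f.1 s = g.1 s) ∧ g.1 (mid i) = f'.1 (mid i)) := by
  have hm : mid i ≠ mid j := fun h => hij (mid_injective h)
  constructor
  · rintro ⟨h1, h2⟩
    have e1 := h2.1 _ hm
    have e2 := h1.1 _ hm.symm
    refine ⟨⟨fun s hs hs' => (h1.1 s hs).trans (h2.1 s hs'), ?_, ?_⟩, h1.1, e1⟩
    · rw [Drop, ← e1]
      exact h1.2
    · rw [Drop, e2]
      exact h2.2
  · rintro ⟨⟨h1, h2, h3⟩, h4, h5⟩
    refine ⟨⟨h4, ?_⟩, fun s hs => ?_, ?_⟩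
    · rw [h5]
      exact h2
    · by_cases hsi : s = mid i
      · rw [hsi, h5]
      · rw [← h4 s hsi]
        exact h1 s hsi hs
    · rw [← h4 _ hm.symm]
      exact h3

end Pairs

open Classical in
/-- In a product of two elementary steps at different places the intermediate flag is determined by
the two ends; the last condition says that it exists. -/
lemma Efam_mul_Efam_apply {i j : Fin (n - 1)} (hij : i ≠ j) (Q : PrimePow)
    (f f' : Flag Q.F n d) :
    (Efam i * Efam j : ∀ Q, Conv n d Q) Q f f' =
      if (Agree i j f f' ∧ Drop 1 i f f' ∧ Drop 1 j f f') ∧ f.1 (lo i).castSucc ≤ f'.1 (mid i)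
        then 1 else 0 := by
  rw [Efam_mul_apply, Finset.sum_congr rfl fun g _ => Efam_apply j Q g f', ← Finset.sum_filter,
    Finset.filter_filter]
  split_ifs with h
  · rw [Finset.sum_eq_single (f.replace i (f'.1 (mid i)) h.2
      (h.1.2.1.1.trans (f.mono (mid_lt_succ_hi i).le)))]
    · intro g hg hne
      obtain ⟨-, h1, h2⟩ := (eStep_and_eStep_iff hij).1 (Finset.mem_filter.1 hg).2
      refine absurd (Flag.ext_mid (i := i) (fun s hs => ?_) ?_) hne
      · rw [f.replace_of_ne i _ _ _ hs, h1 s hs]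
      · rw [h2, f.replace_mid]
    · intro hn
      refine (hn (Finset.mem_filter.2 ⟨Finset.mem_univ _, (eStep_and_eStep_iff hij).2
        ⟨h.1, fun s hs => ?_, ?_⟩⟩)).elim
      · rw [f.replace_of_ne i _ _ _ hs]
      · rw [f.replace_mid]
  · refine Finset.sum_eq_zero fun g hg => absurd ?_ h
    obtain ⟨h1, h2⟩ := Finset.mem_filter.1 hg
    obtain ⟨h3, h4, h5⟩ := (eStep_and_eStep_iff hij).1 h2
    refine ⟨h3, ?_⟩
    rw [← h5, h4 _ (castSucc_lo_ne_mid i)]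
    exact g.mono (castSucc_lo_lt_mid i).le

lemma Efam_comm {i j : Fin (n - 1)} (h : (i : ℕ) + 1 < j ∨ (j : ℕ) + 1 < i) :
    (Efam i * Efam j : ∀ Q, Conv n d Q) = Efam j * Efam i := by
  classical
  have hij : i ≠ j := by
    rintro rfl
    omega
  refine fam_ext' fun Q f f' => ?_
  rw [Efam_mul_Efam_apply hij, Efam_mul_Efam_apply hij.symm]
  refine if_congr ⟨?_, ?_⟩ rfl rfl
  · rintro ⟨⟨h1, h2, h3⟩, -⟩
    exact ⟨⟨h1.comm, h3, h2⟩, h1.comm.castSucc_lo_le (by omega)⟩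
  · rintro ⟨⟨h1, h2, h3⟩, -⟩
    exact ⟨⟨h1.comm, h3, h2⟩, h1.comm.castSucc_lo_le (by omega)⟩

section Triples

variable {i j : Fin (n - 1)} {Q : PrimePow} {f f' : Flag Q.F n d}

open Classical in
/-- A product of three elementary steps, of which the first one and another one are at `i`, as a sum
over the intermediate subspaces at `mid i` that satisfy the condition `C`. -/
lemma sum_from_apply (hij : i ≠ j) (x : ∀ Q, Conv n d Q) (C : Submodule Q.F (Fin d → Q.F) → Prop)
    (hx : ∀ g, EStep i f g → x Q g f' =
      if (Agree i j g f' ∧ Drop 1 i g f' ∧ Drop 1 j g f') ∧ C (g.1 (mid i)) then 1 else 0)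
    (hC : Agree i j f f' → Drop 2 i f f' → Drop 1 j f f' →
      (∃ Z ∈ between (f'.1 (mid i)) (f.1 (mid i)), C Z) →
        f.1 (lo i).castSucc ≤ f'.1 (mid i)) :
    (Efam i * x : ∀ Q, Conv n d Q) Q f f' =
      if Agree i j f f' ∧ Drop 2 i f f' ∧ Drop 1 j f f' then
        (((between (f'.1 (mid i)) (f.1 (mid i))).filter C).card : Q.Val) • 1 else 0 := by
  have hm : mid i ≠ mid j := fun h => hij (mid_injective h)
  have key : ∀ g, EStep i f g → (((Agree i j g f' ∧ Drop 1 i g f' ∧ Drop 1 j g f') ∧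
      C (g.1 (mid i))) ↔ (Agree i j f f' ∧ Drop 2 i f f' ∧ Drop 1 j f f') ∧
        f'.1 (mid i) ≤ g.1 (mid i) ∧ C (g.1 (mid i))) := by
    intro g hg
    have e1 : Agree i j g f' ↔ Agree i j f f' :=
      forall_congr' fun s => forall_congr' fun hs => by rw [hg.1 s hs]
    have e2 : Drop 1 j g f' ↔ Drop 1 j f f' := by rw [Drop, Drop, hg.1 _ hm.symm]
    rw [e1, e2]
    have e3 := hg.2.2
    have e4 := hg.2.1
    constructor
    · rintro ⟨⟨h1, ⟨h2, h2'⟩, h3⟩, h4⟩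
      exact ⟨⟨h1, ⟨h2.trans e4, by omega⟩, h3⟩, h2, h4⟩
    · rintro ⟨⟨h1, ⟨h2, h2'⟩, h3⟩, h4, h5⟩
      exact ⟨⟨h1, ⟨h4, by omega⟩, h3⟩, h5⟩
  rw [Efam_mul_apply, Finset.sum_congr rfl fun g hg => (hx g (Finset.mem_filter.1 hg).2).trans
    (if_congr (key g (Finset.mem_filter.1 hg).2) rfl rfl)]
  by_cases hT : Agree i j f f' ∧ Drop 2 i f f' ∧ Drop 1 j f f'
  · rw [if_pos hT, Nat.cast_smul_eq_nsmul, ← Finset.sum_const, Finset.sum_filter C]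
    by_cases hex : ∃ Z ∈ between (f'.1 (mid i)) (f.1 (mid i)), C Z
    · rw [← sum_eStep_from i f (hC hT.1 hT.2.1 hT.2.2 hex) hT.2.1.2
        (fun Z => if C Z then (1 : AddMonoidAlgebra Q.Val (Fin d → Q.F)) else 0),
        ← Finset.filter_filter,
        Finset.sum_filter (fun g : Flag Q.F n d => f'.1 (mid i) ≤ g.1 (mid i))]
      refine Finset.sum_congr rfl fun g _ => ?_
      rw [← ite_and]
      exact if_congr (and_iff_right hT) rfl rfl
    · rw [Finset.sum_eq_zero, Finset.sum_eq_zero]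
      · exact fun Z hZ => if_neg fun h => hex ⟨Z, hZ, h⟩
      · intro g hg
        have h1 := (Finset.mem_filter.1 hg).2
        refine if_neg fun h => hex ⟨g.1 (mid i), mem_between.2 ⟨h.2.1, h1.2.1, ?_⟩, h.2.2⟩
        have h2 := h1.2.2
        have h3 := hT.2.1.2
        omega
  · rw [if_neg hT]
    exact Finset.sum_eq_zero fun g _ => if_neg fun h => hT h.1

open Classical in
/-- A product of three elementary steps, of which the last one and another one are at `i`, as a sum
over the intermediate subspaces at `mid i` that satisfy the condition `C`. -/
lemma sum_to_apply (hij : i ≠ j) (x : ∀ Q, Conv n d Q) (C : Submodule Q.F (Fin d → Q.F) → Prop)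
    (hx : ∀ g, EStep i g f' → x Q f g =
      if (Agree i j f g ∧ Drop 1 i f g ∧ Drop 1 j f g) ∧ C (g.1 (mid i)) then 1 else 0)
    (hC : Agree i j f f' → Drop 2 i f f' → Drop 1 j f f' →
      (∃ Z ∈ between (f'.1 (mid i)) (f.1 (mid i)), C Z) → f.1 (mid i) ≤ f'.1 (hi i).succ) :
    (x * Efam i : ∀ Q, Conv n d Q) Q f f' =
      if Agree i j f f' ∧ Drop 2 i f f' ∧ Drop 1 j f f' then
        (((between (f'.1 (mid i)) (f.1 (mid i))).filter C).card : Q.Val) • 1 else 0 := by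
  have hm : mid i ≠ mid j := fun h => hij (mid_injective h)
  have key : ∀ g, EStep i g f' → (((Agree i j f g ∧ Drop 1 i f g ∧ Drop 1 j f g) ∧
      C (g.1 (mid i))) ↔ (Agree i j f f' ∧ Drop 2 i f f' ∧ Drop 1 j f f') ∧
        g.1 (mid i) ≤ f.1 (mid i) ∧ C (g.1 (mid i))) := by
    intro g hg
    have e1 : Agree i j f g ↔ Agree i j f f' :=
      forall_congr' fun s => forall_congr' fun hs => by rw [hg.1 s hs]
    have e2 : Drop 1 j f g ↔ Drop 1 j f f' := by rw [Drop, Drop, hg.1 _ hm.symm]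
    rw [e1, e2]
    have e3 := hg.2.2
    have e4 := hg.2.1
    constructor
    · rintro ⟨⟨h1, ⟨h2, h2'⟩, h3⟩, h4⟩
      exact ⟨⟨h1, ⟨e4.trans h2, by omega⟩, h3⟩, h2, h4⟩
    · rintro ⟨⟨h1, ⟨h2, h2'⟩, h3⟩, h4, h5⟩
      exact ⟨⟨h1, ⟨h4, by omega⟩, h3⟩, h5⟩
  rw [mul_Efam_apply, Finset.sum_congr rfl fun g hg => (hx g (Finset.mem_filter.1 hg).2).trans
    (if_congr (key g (Finset.mem_filter.1 hg).2) rfl rfl)]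
  by_cases hT : Agree i j f f' ∧ Drop 2 i f f' ∧ Drop 1 j f f'
  · rw [if_pos hT, Nat.cast_smul_eq_nsmul, ← Finset.sum_const, Finset.sum_filter C]
    by_cases hex : ∃ Z ∈ between (f'.1 (mid i)) (f.1 (mid i)), C Z
    · rw [← sum_eStep_to i f' (hC hT.1 hT.2.1 hT.2.2 hex)
        (fun Z => if C Z then (1 : AddMonoidAlgebra Q.Val (Fin d → Q.F)) else 0),
        ← Finset.filter_filter,
        Finset.sum_filter (fun g : Flag Q.F n d => g.1 (mid i) ≤ f.1 (mid i))]
      refine Finset.sum_congr rfl fun g _ => ?_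
      rw [← ite_and]
      exact if_congr (and_iff_right hT) rfl rfl
    · rw [Finset.sum_eq_zero, Finset.sum_eq_zero]
      · exact fun Z hZ => if_neg fun h => hex ⟨Z, hZ, h⟩
      · intro g hg
        have h1 := (Finset.mem_filter.1 hg).2
        exact if_neg fun h => hex ⟨g.1 (mid i), mem_between.2 ⟨h1.2.1, h.2.1, h1.2.2⟩, h.2.2⟩
  · rw [if_neg hT]
    exact Finset.sum_eq_zero fun g _ => if_neg fun h => hT h.1

end Triples

section Counts

variable {K : Type} [Field K] [Fintype K] {N U W : Submodule K (Fin d → K)}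

lemma card_between_of_two {R : Type} [Field R] [CharZero R] (hNU : N ≤ U)
    (hd : finrank K U = finrank K N + 2) :
    ((between N U).card : R) = (Nat.card K : R) + 1 := by
  have h := card_between (R := R) hNU
  rw [show finrank K U - finrank K N = 2 by omega] at h
  have h1 : (Nat.card K : R) - 1 ≠ 0 := by
    rw [sub_ne_zero]
    exact_mod_cast (Finite.one_lt_card (α := K)).ne'
  refine mul_left_cancel₀ h1 (h.trans ?_)
  ring

lemma filter_between_le (hNU : N ≤ U) (hNW : N ≤ W) (hd : finrank K U = finrank K N + 2)
    (hUW : finrank K (U ⊓ W : Submodule K (Fin d → K)) + 1 = finrank K U) [DecidablePred (· ≤ W)] :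
    (between N U).filter (· ≤ W) = {U ⊓ W} := by
  ext Z
  rw [Finset.mem_filter, mem_between, Finset.mem_singleton]
  constructor
  · rintro ⟨⟨h1, h2, h3⟩, h4⟩
    exact eq_of_le_of_finrank_eq (le_inf h2 h4) (by omega)
  · rintro rfl
    exact ⟨⟨le_inf hNU hNW, inf_le_left, by omega⟩, inf_le_right⟩

lemma filter_between_ge (hNU : N ≤ U) (hWU : W ≤ U)
    (hNW : finrank K (N ⊔ W : Submodule K (Fin d → K)) = finrank K N + 1)
    [DecidablePred (W ≤ ·)] :
    (between N U).filter (W ≤ ·) = {N ⊔ W} := by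
  ext Z
  rw [Finset.mem_filter, mem_between, Finset.mem_singleton]
  constructor
  · rintro ⟨⟨h1, h2, h3⟩, h4⟩
    exact (eq_of_le_of_finrank_eq (sup_le h1 h4) (by omega)).symm
  · rintro rfl
    exact ⟨⟨le_sup_left, sup_le hNU hWU, hNW⟩, le_sup_right⟩

end Counts

end StepRelations

/-! ### Serre relations and commutators -/

section SerreRelations

open Submodule Module

variable {n d : ℕ}

lemma smul_apply' (p : Lau) (x : ∀ Q, Conv n d Q) (Q : PrimePow) (f f' : Flag Q.F n d) :
    (p • x) Q f f' = Q.ev p • x Q f f' := by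
  refine AddMonoidAlgebra.ext (Finsupp.ext fun ω => ?_)
  exact cf_smul p Q (x Q) f f' ω

/-- The Serre relation, `j = i + 1`. Of the `q + 1` subspaces between the terms of `f'` and `f` at
`mid i`, either all or exactly one are contained in the term of `f'` at `mid j`. -/
lemma Efam_serre_of_succ {i j : Fin (n - 1)} (h : (i : ℕ) + 1 = j) :
    (Efam i * (Efam i * Efam j) + (LaurentPolynomial.T 2 : Lau) • ((Efam j * Efam i) * Efam i) :
        ∀ Q, Conv n d Q) =
      (LaurentPolynomial.T 2 + 1 : Lau) • (Efam i * (Efam j * Efam i)) := by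
  classical
  have hij : i ≠ j := by
    rintro rfl
    omega
  have hlo : (lo j).castSucc = mid i := castSucc_lo_eq_mid_iff.2 h
  have hhi : (hi i).succ = mid j := succ_hi_eq_mid_iff.2 h
  refine fam_ext' fun Q f f' => ?_
  have e1 : (Efam i * (Efam i * Efam j) : ∀ Q, Conv n d Q) Q f f' = _ :=
    sum_from_apply hij _ (fun Z => f'.1 (mid i) ≤ Z) (fun g _ => by
      rw [Efam_mul_Efam_apply hij]
      exact if_congr ⟨fun h => ⟨h.1, h.1.2.1.1⟩,
        fun h' => ⟨h'.1, h'.1.1.castSucc_lo_le (by omega)⟩⟩ rfl rfl)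
      fun h1 _ _ _ => h1.castSucc_lo_le (by omega)
  have e2 : ((Efam j * Efam i) * Efam i : ∀ Q, Conv n d Q) Q f f' = _ :=
    sum_to_apply hij _ (fun _ => f.1 (mid i) ≤ f'.1 (mid j)) (fun g hg => by
      rw [Efam_mul_Efam_apply hij.symm, hlo, ← hg.1 _ fun e => hij (mid_injective e).symm]
      exact if_congr ⟨fun h => ⟨⟨h.1.1.comm, h.1.2.2, h.1.2.1⟩, h.2⟩,
        fun h => ⟨⟨h.1.1.comm, h.1.2.2, h.1.2.1⟩, h.2⟩⟩ rfl rfl)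
      fun _ _ _ ⟨_, _, h2⟩ => hhi ▸ h2
  have e3 : (Efam i * (Efam j * Efam i) : ∀ Q, Conv n d Q) Q f f' = _ :=
    sum_from_apply hij _ (fun Z => Z ≤ f'.1 (mid j)) (fun g _ => by
      rw [Efam_mul_Efam_apply hij.symm, hlo]
      exact if_congr ⟨fun h => ⟨⟨h.1.1.comm, h.1.2.2, h.1.2.1⟩, h.2⟩,
        fun h => ⟨⟨h.1.1.comm, h.1.2.2, h.1.2.1⟩, h.2⟩⟩ rfl rfl)
      fun h1 _ _ _ => h1.castSucc_lo_le (by omega)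
  rw [Pi.add_apply, Matrix.add_apply, smul_apply', smul_apply', e1, e2, e3, map_add, map_one,
    Q.ev_T_two]
  by_cases hT : Agree i j f f' ∧ Drop 2 i f f' ∧ Drop 1 j f f'
  · rw [if_pos hT, if_pos hT, if_pos hT, Finset.filter_true_of_mem fun Z hZ => (mem_between.1 hZ).1]
    obtain ⟨-, ⟨h1, h2⟩, h3, h4⟩ := hT
    rw [card_between_of_two h1 h2]
    by_cases hle : f.1 (mid i) ≤ f'.1 (mid j)
    · rw [Finset.filter_true_of_mem fun _ _ => hle, Finset.filter_true_of_mem fun Z hZ =>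
        (mem_between.1 hZ).2.1.trans hle, card_between_of_two h1 h2]
      module
    · have hij' : mid i ≤ mid j := by rw [Fin.le_def, val_mid, val_mid]; omega
      have hsup : f.1 (mid i) ⊔ f'.1 (mid j) = f.1 (mid j) := by
        refine eq_of_le_of_finrank_le (sup_le (f.mono hij') h3) ?_
        rw [h4]
        exact Submodule.finrank_lt_finrank_of_lt (lt_of_le_of_ne le_sup_right fun e =>
          hle (e ▸ le_sup_left))
      have hd := Submodule.finrank_sup_add_finrank_inf_eq (f.1 (mid i)) (f'.1 (mid j))
      rw [hsup] at hd
      rw [Finset.filter_false_of_mem fun _ _ => hle,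
        filter_between_le h1 (f'.mono hij') h2 (by omega), Finset.card_singleton,
        Finset.card_empty, Nat.cast_one, Nat.cast_zero]
      module
  · rw [if_neg hT, if_neg hT, if_neg hT, smul_zero, smul_zero, add_zero]

/-- The Serre relation, `j = i - 1`. Of the `q + 1` subspaces between the terms of `f'` and `f` at
`mid i`, either all or exactly one contain the term of `f` at `mid j`. -/
lemma Efam_serre_of_pred {i j : Fin (n - 1)} (h : (j : ℕ) + 1 = i) :
    ((LaurentPolynomial.T 2 : Lau) • (Efam i * (Efam i * Efam j)) + (Efam j * Efam i) * Efam i :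
        ∀ Q, Conv n d Q) =
      (LaurentPolynomial.T 2 + 1 : Lau) • ((Efam i * Efam j) * Efam i) := by
  classical
  have hij : i ≠ j := by
    rintro rfl
    omega
  have hlo : (lo i).castSucc = mid j := castSucc_lo_eq_mid_iff.2 h
  have hup : ∀ {Q : PrimePow} {f f' : Flag Q.F n d}, Agree i j f f' →
      f.1 (mid i) ≤ f'.1 (hi i).succ := by
    intro Q f f' h1
    rw [← h1 _ (succ_hi_ne_mid i) fun e => by have := succ_hi_eq_mid_iff.1 e; omega]
    exact f.mono (mid_lt_succ_hi i).le
  refine fam_ext' fun Q f f' => ?_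
  have e1 : (Efam i * (Efam i * Efam j) : ∀ Q, Conv n d Q) Q f f' = _ :=
    sum_from_apply hij _ (fun _ => f.1 (mid j) ≤ f'.1 (mid i)) (fun g hg => by
      rw [Efam_mul_Efam_apply hij, hlo, ← hg.1 _ fun e => hij (mid_injective e).symm])
      fun _ _ _ ⟨_, _, h2⟩ => hlo ▸ h2
  have e2 : ((Efam j * Efam i) * Efam i : ∀ Q, Conv n d Q) Q f f' = _ :=
    sum_to_apply hij _ (fun Z => Z ≤ f.1 (mid i)) (fun g _ => by
      rw [Efam_mul_Efam_apply hij.symm]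
      exact if_congr ⟨fun h => ⟨⟨h.1.1.comm, h.1.2.2, h.1.2.1⟩, h.1.2.2.1⟩,
        fun h' => ⟨⟨h'.1.1.comm, h'.1.2.2, h'.1.2.1⟩, h'.1.1.comm.castSucc_lo_le (by omega)⟩⟩
          rfl rfl)
      fun h1 _ _ _ => hup h1
  have e3 : ((Efam i * Efam j) * Efam i : ∀ Q, Conv n d Q) Q f f' = _ :=
    sum_to_apply hij _ (fun Z => f.1 (mid j) ≤ Z) (fun g _ => by
      rw [Efam_mul_Efam_apply hij, hlo])
      fun h1 _ _ _ => hup h1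
  rw [Pi.add_apply, Matrix.add_apply, smul_apply', smul_apply', e1, e2, e3, map_add, map_one,
    Q.ev_T_two]
  by_cases hT : Agree i j f f' ∧ Drop 2 i f f' ∧ Drop 1 j f f'
  · rw [if_pos hT, if_pos hT, if_pos hT,
      Finset.filter_true_of_mem (p := (· ≤ f.1 (mid i))) fun Z hZ => (mem_between.1 hZ).2.1]
    obtain ⟨-, ⟨h1, h2⟩, h3, h4⟩ := hT
    rw [card_between_of_two h1 h2]
    by_cases hle : f.1 (mid j) ≤ f'.1 (mid i)
    · rw [Finset.filter_true_of_mem fun _ _ => hle, Finset.filter_true_of_mem fun Z hZ =>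
        hle.trans (mem_between.1 hZ).1, card_between_of_two h1 h2]
      module
    · have hij' : mid j ≤ mid i := by rw [Fin.le_def, val_mid, val_mid]; omega
      have hinf : f'.1 (mid i) ⊓ f.1 (mid j) = f'.1 (mid j) := by
        refine (eq_of_le_of_finrank_le (le_inf (f'.mono hij') h3) ?_).symm
        have := Submodule.finrank_lt_finrank_of_lt (lt_of_le_of_ne
          (inf_le_right : f'.1 (mid i) ⊓ f.1 (mid j) ≤ f.1 (mid j)) fun e => hle (e ▸ inf_le_left))
        omega
      have hd := Submodule.finrank_sup_add_finrank_inf_eq (f'.1 (mid i)) (f.1 (mid j))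
      rw [hinf] at hd
      rw [Finset.filter_false_of_mem fun _ _ => hle,
        filter_between_ge h1 (f.mono hij') (by omega), Finset.card_singleton,
        Finset.card_empty, Nat.cast_one, Nat.cast_zero]
      module
  · rw [if_neg hT, if_neg hT, if_neg hT, smul_zero, smul_zero, add_zero]

open Classical in
/-- There is at most one flag which differs from `f` only at `mid i` and has a prescribed term
there. -/
lemma card_flags_of_mid {K : Type} [Field K] [Fintype K] (i : Fin (n - 1)) (f : Flag K n d)
    (W : Submodule K (Fin d → K)) (P : Prop) (S : Flag K n d → Prop) [DecidablePred S]
    (hS : ∀ g, S g ↔ P ∧ (∀ s, s ≠ mid i → f.1 s = g.1 s) ∧ g.1 (mid i) = W)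
    (hP : P → f.1 (lo i).castSucc ≤ W ∧ W ≤ f.1 (hi i).succ) :
    (Finset.univ.filter S).card = if P then 1 else 0 := by
  rw [Finset.filter_congr fun g _ => hS g]
  split_ifs with h
  · rw [Finset.card_eq_one]
    refine ⟨f.replace i W (hP h).1 (hP h).2, ?_⟩
    ext g
    simp only [Finset.mem_filter, Finset.mem_univ, true_and, h, Finset.mem_singleton]
    constructor
    · rintro ⟨h1, h2⟩
      refine Flag.ext_mid (i := i) (fun s hs => ?_) ?_
      · rw [f.replace_of_ne i _ _ _ hs, h1 s hs]
      · rw [h2, f.replace_mid]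
    · rintro rfl
      exact ⟨fun s hs => (f.replace_of_ne i _ _ _ hs).symm, f.replace_mid i _ _ _⟩
  · rw [Finset.card_eq_zero, Finset.filter_eq_empty_iff]
    exact fun g _ hg => h hg.1

lemma Efam_mul_Ffam_comm {i j : Fin (n - 1)} (hij : i ≠ j) :
    (Efam i * Ffam j : ∀ Q, Conv n d Q) = Ffam j * Efam i := by
  classical
  have hm : mid i ≠ mid j := fun h => hij (mid_injective h)
  refine fam_ext' fun Q f f' => ?_
  -- on both sides the intermediate flag consists of terms of `f` and `f'`
  have e1 : ∀ g : Flag Q.F n d, EStep i f g ∧ EStep j f' g ↔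
      (Agree i j f f' ∧ Drop 1 i f f' ∧ Drop 1 j f' f) ∧ (∀ s, s ≠ mid i → f.1 s = g.1 s) ∧
        g.1 (mid i) = f'.1 (mid i) := by
    intro g
    constructor
    · rintro ⟨h1, h2⟩
      have a1 := h2.1 _ hm
      have a2 := h1.1 _ hm.symm
      refine ⟨⟨fun s hs hs' => (h1.1 s hs).trans (h2.1 s hs').symm, ?_, ?_⟩, h1.1, a1.symm⟩
      · rw [Drop, a1]
        exact h1.2
      · rw [Drop, a2]
        exact h2.2
    · rintro ⟨⟨h1, h2, h3⟩, h4, h5⟩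
      refine ⟨⟨h4, ?_⟩, fun s hs => ?_, ?_⟩
      · rw [h5]
        exact h2
      · by_cases hsi : s = mid i
        · rw [hsi, h5]
        · rw [← h4 s hsi]
          exact (h1 s hsi hs).symm
      · rw [← h4 _ hm.symm]
        exact h3
  have e2 : ∀ g : Flag Q.F n d, EStep i g f' ∧ EStep j g f ↔
      (Agree i j f f' ∧ Drop 1 i f f' ∧ Drop 1 j f' f) ∧ (∀ s, s ≠ mid j → f.1 s = g.1 s) ∧
        g.1 (mid j) = f'.1 (mid j) := by
    intro g
    constructor
    · rintro ⟨h2, h1⟩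
      have a1 := h1.1 _ hm
      have a2 := h2.1 _ hm.symm
      refine ⟨⟨fun s hs hs' => (h1.1 s hs').symm.trans (h2.1 s hs), ?_, ?_⟩,
        fun s hs => (h1.1 s hs).symm, a2⟩
      · rw [Drop, ← a1]
        exact h2.2
      · rw [Drop, ← a2]
        exact h1.2
    · rintro ⟨⟨h1, h2, h3⟩, h4, h5⟩
      refine ⟨⟨fun s hs => ?_, ?_⟩, fun s hs => (h4 s hs).symm, ?_⟩
      · by_cases hsj : s = mid j
        · rw [hsj, h5]
        · rw [← h4 s hsj]
          exact h1 s hs hsj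
      · rw [← h4 _ hm]
        exact h2
      · rw [h5]
        exact h3
  rw [Efam_mul_apply, mul_Efam_apply, Finset.sum_congr rfl fun g _ => Ffam_apply j Q g f',
    Finset.sum_congr rfl fun g _ => Ffam_apply j Q f g, ← Finset.sum_filter, ← Finset.sum_filter,
    Finset.filter_filter, Finset.filter_filter, Finset.sum_const, Finset.sum_const,
    card_flags_of_mid i f _ _ _ e1, card_flags_of_mid j f _ _ _ e2]
  · rintro ⟨h1, h2, h3⟩
    constructor
    · exact (f.mono (castSucc_lo_lt_mid j).le).trans h3.1
    · refine (f'.mono (mid_lt_succ_hi j).le).trans ?_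
      by_cases hs : (hi j).succ = mid i
      · rw [hs]
        exact h2.1
      · rw [h1 _ hs (succ_hi_ne_mid j)]
  · rintro ⟨h1, h2, h3⟩
    constructor
    · refine le_trans ?_ (f'.mono (castSucc_lo_lt_mid i).le)
      by_cases hs : (lo i).castSucc = mid j
      · rw [hs]
        exact h3.1
      · rw [h1 _ (castSucc_lo_ne_mid i) hs]
    · exact h2.1.trans (f.mono (mid_lt_succ_hi i).le)

/-- The commutator of `Efam i` and `Ffam i` is diagonal. -/
lemma Efam_mul_Ffam_sub (i : Fin (n - 1)) :
    ((LaurentPolynomial.T 2 - 1 : Lau) • (Efam i * Ffam i - Ffam i * Efam i) : ∀ Q, Conv n d Q) =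
      fpow (fun δ => 2 * gr δ (lo i)) - fpow fun δ => 2 * gr δ (hi i) := by
  classical
  refine fam_ext' fun Q f f' => ?_
  have e1 : (Efam i * Ffam i : ∀ Q, Conv n d Q) Q f f' =
      ((Finset.univ.filter fun g => EStep i f g ∧ EStep i f' g).card : Q.Val) • 1 := by
    rw [Efam_mul_apply, Finset.sum_congr rfl fun g _ => Ffam_apply i Q g f', ← Finset.sum_filter,
      Finset.filter_filter, Finset.sum_const, Nat.cast_smul_eq_nsmul]
  have e2 : (Ffam i * Efam i : ∀ Q, Conv n d Q) Q f f' =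
      ((Finset.univ.filter fun g => EStep i g f' ∧ EStep i g f).card : Q.Val) • 1 := by
    rw [mul_Efam_apply, Finset.sum_congr rfl fun g _ => Ffam_apply i Q f g, ← Finset.sum_filter,
      Finset.filter_filter, Finset.sum_const, Nat.cast_smul_eq_nsmul]
  have e3 : ∀ k : (Fin (n + 1) → ℕ) → ℤ, (fpow k : ∀ Q, Conv n d Q) Q f f' =
      if f = f' then Q.ev (LaurentPolynomial.T (k (dims f))) • 1 else 0 := by
    intro k
    rw [← mul_one (fpow k)]
    refine (fdiag_mul_apply _ _ Q f f').trans ?_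
    rw [Pi.one_apply, Matrix.one_apply, smul_ite, smul_zero]
  have e4 : ∀ a : Fin n, ∀ m : ℕ, gr (dims f) a = m →
      Q.ev (LaurentPolynomial.T (2 * gr (dims f) a)) = (Nat.card Q.F : Q.Val) ^ m := by
    intro a m hm
    rw [Q.ev_T, ← Q.rt_sq, ← pow_mul, ← zpow_natCast, hm]
    push_cast
    rfl
  rw [smul_apply', Pi.sub_apply, Matrix.sub_apply, Pi.sub_apply, Matrix.sub_apply, e1, e2, e3, e3,
    map_sub, map_one, Q.ev_T_two]
  by_cases hf : f = f'
  · subst hf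
    have c1 := card_eStep_from (R := Q.Val) i f
    have c2 := card_eStep_to (R := Q.Val) i f
    have m1 : dims f (lo i).castSucc ≤ dims f (mid i) :=
      Submodule.finrank_mono (f.mono (castSucc_lo_lt_mid i).le)
    have m2 : dims f (mid i) ≤ dims f (hi i).succ :=
      Submodule.finrank_mono (f.mono (mid_lt_succ_hi i).le)
    rw [if_pos rfl, if_pos rfl, e4 (lo i) _ (Nat.cast_sub m1).symm,
      e4 (hi i) _ (Nat.cast_sub m2).symm]
    simp only [and_self]
    rw [← sub_smul, ← sub_smul, smul_smul]
    congr 1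
    linear_combination c1 - c2
  · rw [if_neg hf, if_neg hf, sub_zero, ← sub_smul, smul_smul]
    -- the common steps are given by the intersection and by the sum of the two terms
    have key : (Finset.univ.filter fun g => EStep i f g ∧ EStep i f' g).card =
        (Finset.univ.filter fun g => EStep i g f' ∧ EStep i g f).card := by
      let P : Prop := (∀ s, s ≠ mid i → f.1 s = f'.1 s) ∧
        finrank Q.F (f.1 (mid i)) = finrank Q.F (f'.1 (mid i)) ∧
        finrank Q.F (f.1 (mid i)) =
          finrank Q.F (f.1 (mid i) ⊓ f'.1 (mid i) : Submodule Q.F (Fin d → Q.F)) + 1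
      have hne : (∀ s, s ≠ mid i → f.1 s = f'.1 s) → f.1 (mid i) ≠ f'.1 (mid i) := fun h1 h2 =>
        hf (Flag.ext_mid h1 h2)
      have hlt : (∀ s, s ≠ mid i → f.1 s = f'.1 s) →
          finrank Q.F (f.1 (mid i)) = finrank Q.F (f'.1 (mid i)) →
          finrank Q.F (f.1 (mid i) ⊓ f'.1 (mid i) : Submodule Q.F (Fin d → Q.F)) <
            finrank Q.F (f.1 (mid i)) := fun h1 h2 => by
        refine Submodule.finrank_lt_finrank_of_lt (lt_of_le_of_ne inf_le_left fun h => hne h1 ?_)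
        exact eq_of_le_of_finrank_eq (inf_eq_left.1 h) h2
      have hsum := Submodule.finrank_sup_add_finrank_inf_eq (f.1 (mid i)) (f'.1 (mid i))
      have a1 : ∀ g : Flag Q.F n d, EStep i f g ∧ EStep i f' g ↔
          P ∧ (∀ s, s ≠ mid i → f.1 s = g.1 s) ∧ g.1 (mid i) = f.1 (mid i) ⊓ f'.1 (mid i) := by
        intro g
        constructor
        · rintro ⟨h1, h2⟩
          have h3 : ∀ s, s ≠ mid i → f.1 s = f'.1 s := fun s hs =>
            (h1.1 s hs).trans (h2.1 s hs).symm
          have h4 := h1.2.2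
          have h5 := h2.2.2
          have h6 := hlt h3 (by omega)
          have h7 : g.1 (mid i) = f.1 (mid i) ⊓ f'.1 (mid i) :=
            eq_of_le_of_finrank_le (le_inf h1.2.1 h2.2.1) (by omega)
          exact ⟨⟨h3, by omega, by rw [← h7]; exact h4⟩, h1.1, h7⟩
        · rintro ⟨⟨h1, h2, h3⟩, h4, h5⟩
          refine ⟨⟨h4, ?_, ?_⟩, fun s hs => (h1 s hs).symm.trans (h4 s hs), ?_, ?_⟩
          · rw [h5]
            exact inf_le_left
          · rw [h5]
            exact h3
          · rw [h5]
            exact inf_le_right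
          · rw [h5, ← h2]
            exact h3
      have a2 : ∀ g : Flag Q.F n d, EStep i g f' ∧ EStep i g f ↔
          P ∧ (∀ s, s ≠ mid i → f.1 s = g.1 s) ∧ g.1 (mid i) = f.1 (mid i) ⊔ f'.1 (mid i) := by
        intro g
        constructor
        · rintro ⟨h2, h1⟩
          have h3 : ∀ s, s ≠ mid i → f.1 s = f'.1 s := fun s hs =>
            (h1.1 s hs).symm.trans (h2.1 s hs)
          have h4 := h1.2.2
          have h5 := h2.2.2
          have h6 := hlt h3 (by omega)
          have h7 : g.1 (mid i) = f.1 (mid i) ⊔ f'.1 (mid i) :=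
            (eq_of_le_of_finrank_le (sup_le h1.2.1 h2.2.1) (by omega)).symm
          rw [← h7] at hsum
          exact ⟨⟨h3, by omega, by omega⟩, fun s hs => (h1.1 s hs).symm, h7⟩
        · rintro ⟨⟨h1, h2, h3⟩, h4, h5⟩
          refine ⟨⟨fun s hs => (h4 s hs).symm.trans (h1 s hs), ?_, ?_⟩,
            fun s hs => (h4 s hs).symm, ?_, ?_⟩
          · rw [h5]
            exact le_sup_right
          · rw [h5]
            omega
          · rw [h5]
            exact le_sup_left
          · rw [h5]
            omega
      rw [card_flags_of_mid i f _ _ _ a1, card_flags_of_mid i f _ _ _ a2]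
      · rintro ⟨h1, -, -⟩
        refine ⟨(f.mono (castSucc_lo_lt_mid i).le).trans le_sup_left,
          sup_le (f.mono (mid_lt_succ_hi i).le) ?_⟩
        rw [h1 _ (succ_hi_ne_mid i)]
        exact f'.mono (mid_lt_succ_hi i).le
      · rintro ⟨h1, -, -⟩
        refine ⟨le_inf (f.mono (castSucc_lo_lt_mid i).le) ?_,
          inf_le_left.trans (f.mono (mid_lt_succ_hi i).le)⟩
        rw [h1 _ (castSucc_lo_ne_mid i)]
        exact f'.mono (castSucc_lo_lt_mid i).le
    rw [key, sub_self, mul_zero, zero_smul]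

end SerreRelations

/-! ### The defining relations -/

section Relations

open Submodule Module LaurentPolynomial

variable {n d : ℕ}

section Weights

variable {S B : Type*} [CommRing S] [Ring B] [Algebra S B]

lemma mul_mul_mul_of_comm {a b u w : B} {s : S} (h : u * b = s • (b * u)) :
    (a * u) * (b * w) = s • ((a * b) * (u * w)) := by
  rw [mul_assoc, ← mul_assoc u, h, smul_mul_assoc, mul_smul_comm, mul_assoc b, mul_assoc a]

lemma mul_mul_of_comm {c u w : B} {s t : S} (hu : u * c = s • (c * u)) (hw : w * c = t • (c * w)) :
    (u * w) * c = (s * t) • (c * (u * w)) := by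
  rw [mul_assoc, hw, mul_smul_comm, ← mul_assoc, hu, smul_mul_assoc, smul_smul, mul_assoc,
    mul_comm t]

end Weights

/-- The image of the generator `E_i`. -/
def Egen (i : Fin (n - 1)) : ∀ Q, Conv n d Q := Efam i * fpow fun δ => -gr δ (lo i)

/-- The image of the generator `F_i`. -/
def Fgen (i : Fin (n - 1)) : ∀ Q, Conv n d Q := Ffam i * fpow fun δ => -gr δ (hi i)

/-- The image of the generator `H_a`. -/
def Hgen (a : Fin n) : ∀ Q, Conv n d Q := fpow fun δ => gr δ a

/-- The image of the generator `H_a⁻¹`. -/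
def Hinvgen (a : Fin n) : ∀ Q, Conv n d Q := fpow fun δ => -gr δ a

/-- The image of the generator `L`. -/
def Lgen [NeZero n] : ∀ Q, Conv n d Q :=
  (fpow fun δ => -2 * (δ (0 : Fin n).succ : ℤ)) * Ifam (0 : Fin n).succ

lemma neg_gr_shift (i : Fin (n - 1)) (a : Fin n) (δ : Fin (n + 1) → ℕ) :
    -gr (shift i δ) a = -gr δ a + -wt a i := by
  rw [gr_shift, neg_add]

lemma fpow_neg_gr_mul_Efam (a : Fin n) (i : Fin (n - 1)) :
    ((fpow fun δ => -gr δ a) * Efam i : ∀ Q, Conv n d Q) =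
      (T (-wt a i) : Lau) • (Efam i * fpow fun δ => -gr δ a) :=
  fpow_mul_Efam _ i _ (neg_gr_shift i a)

lemma fpow_neg_gr_mul_Ffam (a : Fin n) (i : Fin (n - 1)) :
    ((fpow fun δ => -gr δ a) * Ffam i : ∀ Q, Conv n d Q) =
      (T (wt a i) : Lau) • (Ffam i * fpow fun δ => -gr δ a) := by
  rw [fpow_mul_Ffam _ i _ (neg_gr_shift i a), smul_smul, ← T_add, add_neg_cancel, T_zero, one_smul]

lemma wt_lo_self (i : Fin (n - 1)) : wt (lo i) i = 1 := by
  rw [wt, if_pos rfl, if_neg (DecMat.lo_ne_hi i), sub_zero]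

lemma wt_hi_self (i : Fin (n - 1)) : wt (hi i) i = -1 := by
  rw [wt, if_neg (DecMat.lo_ne_hi i).symm, if_pos rfl, zero_sub]

lemma wt_lo (i j : Fin (n - 1)) :
    wt (lo i) j = (if (i : ℕ) = j then 1 else 0) - if (i : ℕ) = j + 1 then 1 else 0 := by
  simp only [wt, Fin.ext_iff, val_lo, val_hi]

lemma wt_hi (i j : Fin (n - 1)) :
    wt (hi i) j = (if (i : ℕ) + 1 = j then 1 else 0) - if (i : ℕ) = j then 1 else 0 := by
  simp only [wt, Fin.ext_iff, val_lo, val_hi, Nat.add_right_cancel_iff]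

lemma Hgen_mul_Hinvgen (a : Fin n) : (Hgen a * Hinvgen a : ∀ Q, Conv n d Q) = 1 :=
  fpow_mul_neg _

lemma Hinvgen_mul_Hgen (a : Fin n) : (Hinvgen a * Hgen a : ∀ Q, Conv n d Q) = 1 :=
  fpow_neg_mul _

lemma Hgen_comm (a b : Fin n) : (Hgen a * Hgen b : ∀ Q, Conv n d Q) = Hgen b * Hgen a :=
  fpow_comm _ _

lemma Hgen_mul_Egen (a : Fin n) (i : Fin (n - 1)) : (Hgen a * Egen i : ∀ Q, Conv n d Q) =
    (T (wt a i) : Lau) • (Egen i * Hgen a) := by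
  unfold Hgen Egen
  rw [← mul_assoc, fpow_mul_Efam _ i _ (fun δ => gr_shift i δ a), smul_mul_assoc, mul_assoc,
    fpow_comm, mul_assoc]

lemma Hgen_mul_Fgen (a : Fin n) (i : Fin (n - 1)) : (Hgen a * Fgen i : ∀ Q, Conv n d Q) =
    (T (-wt a i) : Lau) • (Fgen i * Hgen a) := by
  have h : (Ffam i * fpow fun δ => gr δ a : ∀ Q, Conv n d Q) = _ :=
    fpow_mul_Ffam _ i _ (fun δ => gr_shift i δ a)
  unfold Hgen Fgen
  rw [mul_assoc (Ffam i), fpow_comm _ fun δ => gr δ a, ← mul_assoc (Ffam i), h, smul_mul_assoc,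
    smul_smul, ← T_add, neg_add_cancel, T_zero, one_smul, mul_assoc]

lemma Egen_mul_Egen (i j : Fin (n - 1)) : (Egen i * Egen j : ∀ Q, Conv n d Q) =
    (T (-wt (lo i) j) : Lau) • ((Efam i * Efam j) *
      ((fpow fun δ => -gr δ (lo i)) * fpow fun δ => -gr δ (lo j))) :=
  mul_mul_mul_of_comm (fpow_neg_gr_mul_Efam _ _)

lemma Egen_mul_Egen_mul_Egen (i j k : Fin (n - 1)) :
    (Egen i * Egen j * Egen k : ∀ Q, Conv n d Q) =
    (T (-wt (lo i) j + (-wt (lo i) k + -wt (lo j) k)) : Lau) • ((Efam i * Efam j * Efam k) *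
      ((fpow fun δ => -gr δ (lo i)) * (fpow fun δ => -gr δ (lo j)) *
        fpow fun δ => -gr δ (lo k))) := by
  rw [Egen_mul_Egen, smul_mul_assoc]
  unfold Egen
  rw [mul_mul_mul_of_comm (mul_mul_of_comm (fpow_neg_gr_mul_Efam (lo i) k)
    (fpow_neg_gr_mul_Efam (lo j) k)), smul_smul, ← T_add, ← T_add]

lemma Egen_comm {i j : Fin (n - 1)} (h : (i : ℕ) + 1 < j ∨ (j : ℕ) + 1 < i) :
    (Egen i * Egen j : ∀ Q, Conv n d Q) = Egen j * Egen i := by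
  rw [Egen_mul_Egen, Egen_mul_Egen, Efam_comm h, fpow_comm, wt_lo, wt_lo, if_neg (by omega),
    if_neg (by omega), if_neg (by omega), if_neg (by omega)]

lemma Egen_serre {i j : Fin (n - 1)} (h : (i : ℕ) + 1 = j ∨ (j : ℕ) + 1 = i) :
    (Egen i ^ 2 * Egen j + Egen j * Egen i ^ 2 : ∀ Q, Conv n d Q) =
      (T 1 + T (-1) : Lau) • (Egen i * Egen j * Egen i) := by
  rw [pow_two, ← mul_assoc, Egen_mul_Egen_mul_Egen, Egen_mul_Egen_mul_Egen,
    Egen_mul_Egen_mul_Egen, fpow_mul, fpow_mul, fpow_mul, fpow_mul, fpow_mul, fpow_mul,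
    add_comm (fun δ => -gr δ (lo j)), add_right_comm _ (fun δ => -gr δ (lo j)), smul_smul,
    wt_lo_self]
  simp only [← smul_mul_assoc, ← add_mul]
  congr 1
  rcases h with h | h
  · have h1 := Efam_serre_of_succ (d := d) h
    have e1 : wt (lo i) j = 0 := by
      rw [wt_lo, if_neg (by omega), if_neg (by omega), sub_zero]
    have e2 : wt (lo j) i = -1 := by
      rw [wt_lo, if_neg (by omega), if_pos (by omega), zero_sub]
    rw [← mul_assoc, ← mul_assoc] at h1
    have h2 := congrArg (fun x => (T (-1) : Lau) • x) h1
    simp only [smul_add, smul_smul, mul_add, ← T_add, mul_one] at h2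
    rw [e1, e2]
    simpa [add_mul, ← T_add] using h2
  · have h1 := Efam_serre_of_pred (d := d) h
    have e1 : wt (lo i) j = -1 := by
      rw [wt_lo, if_neg (by omega), if_pos (by omega), zero_sub]
    have e2 : wt (lo j) i = 0 := by
      rw [wt_lo, if_neg (by omega), if_neg (by omega), sub_zero]
    rw [← mul_assoc] at h1
    have h2 := congrArg (fun x => (T (-1) : Lau) • x) h1
    simp only [smul_add, smul_smul, mul_add, ← T_add, mul_one] at h2
    rw [e1, e2]
    simpa [add_mul, ← T_add] using h2

lemma Egen_mul_Fgen (i j : Fin (n - 1)) : (Egen i * Fgen j : ∀ Q, Conv n d Q) =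
    (T (wt (lo i) j) : Lau) • ((Efam i * Ffam j) *
      ((fpow fun δ => -gr δ (lo i)) * fpow fun δ => -gr δ (hi j))) :=
  mul_mul_mul_of_comm (fpow_neg_gr_mul_Ffam _ _)

lemma Fgen_mul_Egen (i j : Fin (n - 1)) : (Fgen j * Egen i : ∀ Q, Conv n d Q) =
    (T (wt (lo i) j) : Lau) • ((Ffam j * Efam i) *
      ((fpow fun δ => -gr δ (lo i)) * fpow fun δ => -gr δ (hi j))) := by
  have h : -wt (hi j) i = wt (lo i) j := by
    rw [wt_hi, wt_lo, neg_sub]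
    congr 1
    · exact if_congr eq_comm rfl rfl
    · exact if_congr eq_comm rfl rfl
  rw [← h, fpow_comm]
  exact mul_mul_mul_of_comm (fpow_neg_gr_mul_Efam _ _)

lemma Egen_mul_Fgen_comm {i j : Fin (n - 1)} (hij : i ≠ j) :
    (Egen i * Fgen j : ∀ Q, Conv n d Q) = Fgen j * Egen i := by
  rw [Egen_mul_Fgen, Fgen_mul_Egen, Efam_mul_Ffam_comm hij]

lemma Egen_mul_Fgen_sub (i : Fin (n - 1)) :
    ((T 1 - T (-1) : Lau) • (Egen i * Fgen i - Fgen i * Egen i) : ∀ Q, Conv n d Q) =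
      Hgen (lo i) * Hinvgen (hi i) - Hinvgen (lo i) * Hgen (hi i) := by
  rw [Egen_mul_Fgen, Fgen_mul_Egen, ← smul_sub, ← sub_mul, smul_smul, wt_lo_self, sub_mul, ← T_add,
    ← T_add, show (1 + 1 : ℤ) = 2 from rfl, neg_add_cancel, T_zero, ← smul_mul_assoc,
    Efam_mul_Ffam_sub, fpow_mul, sub_mul, fpow_mul, fpow_mul]
  unfold Hgen Hinvgen
  rw [fpow_mul, fpow_mul]
  congr 2
  · funext δ
    simp only [Pi.add_apply]
    ring
  · funext δ
    simp only [Pi.add_apply]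
    ring

section Averages

variable [NeZero n]

/-- The average of the elements of the first term of a flag. -/
def avg {Q : PrimePow} (f : Flag Q.F n d) : AddMonoidAlgebra Q.Val (Fin d → Q.F) :=
  Q.rt ^ (-2 * (dims f (0 : Fin n).succ : ℤ)) • ind Q.Val (f.1 (0 : Fin n).succ)

lemma avg_mul_avg {Q : PrimePow} {f f' : Flag Q.F n d}
    (h : f'.1 (0 : Fin n).succ ≤ f.1 (0 : Fin n).succ) : avg f * avg f' = avg f := by
  unfold avg
  rw [smul_mul_smul_comm, mul_comm (ind _ _), ind_mul_ind_of_le h, smul_smul,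
    Module.natCard_eq_pow_finrank (K := Q.F), mul_assoc]
  push_cast
  rw [← Q.rt_sq, ← pow_mul, ← zpow_natCast, ← zpow_add₀ Q.rt_ne_zero]
  have : -2 * (dims f' (0 : Fin n).succ : ℤ) +
      ((2 * finrank Q.F (f'.1 (0 : Fin n).succ) : ℕ) : ℤ) = 0 := by
    unfold dims
    push_cast
    ring
  rw [this, zpow_zero, mul_one]

lemma Lgen_mul_apply (x : ∀ Q, Conv n d Q) (Q : PrimePow) (f f' : Flag Q.F n d) :
    (Lgen * x : ∀ Q, Conv n d Q) Q f f' = avg f * x Q f f' := by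
  unfold Lgen
  rw [mul_assoc]
  refine (fdiag_mul_apply _ _ Q f f').trans ?_
  rw [Ifam_mul_apply, Q.ev_T, avg, smul_mul_assoc]

lemma fpow_mul_Lgen (k : (Fin (n + 1) → ℕ) → ℤ) :
    (fpow k * Lgen : ∀ Q, Conv n d Q) = Lgen * fpow k := by
  have h : (fpow k * Ifam (0 : Fin n).succ : ∀ Q, Conv n d Q) = _ := fdiag_mul_Ifam _ _
  unfold Lgen
  rw [← mul_assoc, fpow_comm, mul_assoc, h, mul_assoc]
  rfl

lemma mul_Lgen_apply (x : ∀ Q, Conv n d Q) (Q : PrimePow) (f f' : Flag Q.F n d) :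
    (x * Lgen : ∀ Q, Conv n d Q) Q f f' = x Q f f' * avg f' := by
  have h : (Lgen : ∀ Q, Conv n d Q) = Ifam (0 : Fin n).succ * _ := fdiag_mul_Ifam _ _
  rw [h, ← mul_assoc]
  refine (mul_fdiag_apply _ _ Q f f').trans ?_
  rw [mul_Ifam_apply, Q.ev_T, avg, mul_smul_comm]

lemma Hgen_mul_Lgen (a : Fin n) : (Hgen a * Lgen : ∀ Q, Conv n d Q) = Lgen * Hgen a :=
  fpow_mul_Lgen _

lemma Lgen_sq : (Lgen ^ 2 : ∀ Q, Conv n d Q) = Lgen := by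
  refine fam_ext' fun Q f f' => ?_
  rw [pow_two, ← mul_one (Lgen * Lgen), mul_assoc, Lgen_mul_apply, Lgen_mul_apply, ← mul_assoc,
    avg_mul_avg le_rfl, ← Lgen_mul_apply, mul_one]

lemma Lgen_mul_Efam (i : Fin (n - 1)) :
    (Lgen * Efam i : ∀ Q, Conv n d Q) = Lgen * Efam i * Lgen := by
  classical
  refine fam_ext' fun Q f f' => ?_
  rw [mul_Lgen_apply, Lgen_mul_apply, Efam_apply]
  split_ifs with h
  · rw [mul_one, avg_mul_avg (h.le _)]
  · rw [mul_zero, zero_mul]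

lemma Lgen_mul_Egen (i : Fin (n - 1)) :
    (Lgen * Egen i : ∀ Q, Conv n d Q) = Lgen * Egen i * Lgen := by
  unfold Egen
  rw [mul_assoc, mul_assoc (Efam i), fpow_mul_Lgen, ← mul_assoc, ← mul_assoc, ← mul_assoc,
    ← Lgen_mul_Efam]

/-- The cubic relation before normalization. If the step at `i` moves the first term of the flag, it
is the equation `∑ ind Z = ind U + q ind N` for the sum over the hyperplanes `Z` of `U` above `N`, a
subspace of codimension two of `U`; otherwise `avg` is the same for all flags involved. -/
lemma Efam_mul_Lgen_mul_Efam (i : Fin (n - 1)) :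
    ((T 1 + T (-1) : Lau) • (Efam i * (Lgen * Efam i)) : ∀ Q, Conv n d Q) =
      (T (-1) : Lau) • (Efam i * Efam i * Lgen) + (T 1 : Lau) • (Lgen * (Efam i * Efam i)) := by
  classical
  refine fam_ext' fun Q f f' => ?_
  have e1 : (Efam i * (Lgen * Efam i) : ∀ Q, Conv n d Q) Q f f' =
      ∑ g with EStep i f g ∧ EStep i g f', avg g := by
    rw [Efam_mul_apply, ← Finset.filter_filter,
      Finset.sum_filter (fun g : Flag Q.F n d => EStep i g f')]
    refine Finset.sum_congr rfl fun g _ => ?_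
    rw [Lgen_mul_apply, Efam_apply, mul_ite, mul_one, mul_zero]
  have e2 : (Efam i * Efam i : ∀ Q, Conv n d Q) Q f f' =
      ∑ g with EStep i f g ∧ EStep i g f', 1 := by
    rw [Efam_mul_apply, ← Finset.filter_filter,
      Finset.sum_filter (fun g : Flag Q.F n d => EStep i g f')]
    exact Finset.sum_congr rfl fun g _ => Efam_apply _ _ _ _
  rw [Pi.add_apply, Matrix.add_apply, smul_apply', smul_apply', smul_apply', e1, mul_Lgen_apply,
    Lgen_mul_apply, e2, map_add, Q.ev_T, Q.ev_T, Finset.sum_mul, Finset.mul_sum, zpow_one,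
    zpow_neg_one]
  simp only [one_mul, mul_one]
  by_cases hi0 : (0 : Fin n).succ = mid i
  · by_cases hT : (∀ s, s ≠ mid i → f.1 s = f'.1 s) ∧ Drop 2 i f f'
    · obtain ⟨h1, h2, h3⟩ := hT
      have hlo : (lo i).castSucc = 0 := by
        have := congrArg Fin.val hi0
        rw [Fin.val_succ, val_mid] at this
        exact Fin.ext (by rw [Fin.val_castSucc, val_lo, Fin.val_zero]; simpa using this.symm)
      have hfilter : (Finset.univ.filter fun g => EStep i f g ∧ EStep i g f') =
          Finset.univ.filter fun g => EStep i f g ∧ f'.1 (mid i) ≤ g.1 (mid i) := by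
        refine Finset.filter_congr fun g _ =>
          and_congr_right fun hg => ⟨fun h => h.2.1, fun h => ?_⟩
        have := hg.2.2
        exact ⟨fun s hs => (hg.1 s hs).symm.trans (h1 s hs), h, by omega⟩
      have hbot : f.1 (lo i).castSucc ≤ f'.1 (mid i) := by
        rw [hlo, f.2.2.1]
        exact bot_le
      have hs1 := sum_eStep_from i f hbot h3 fun Z =>
        Q.rt ^ (-2 * (finrank Q.F (f'.1 (mid i)) + 1 : ℤ)) • ind Q.Val Z
      replace hs1 := hs1.trans (Finset.smul_sum (s := between (f'.1 (mid i)) (f.1 (mid i)))).symm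
      rw [sum_ind_between h2, card_between_of_two h2 h3] at hs1
      have hs3 : ∀ x : AddMonoidAlgebra Q.Val (Fin d → Q.F),
          ∑ g with EStep i f g ∧ EStep i g f', x = ((Nat.card Q.F : Q.Val) + 1) • x := by
        intro x
        have := sum_eStep_from i f hbot h3 fun _ => x
        rw [hfilter, this, Finset.sum_const, ← Nat.cast_smul_eq_nsmul Q.Val,
          card_between_of_two h2 h3]
      have hs4 : ∑ g with EStep i f g ∧ EStep i g f', avg g =
          Q.rt ^ (-2 * (finrank Q.F (f'.1 (mid i)) + 1 : ℤ)) •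
            (ind Q.Val (f.1 (mid i)) + ((Nat.card Q.F : Q.Val) + 1 - 1) •
              ind Q.Val (f'.1 (mid i))) := by
        rw [← hs1, ← hfilter]
        refine Finset.sum_congr rfl fun g hg => ?_
        have h5 := (Finset.mem_filter.1 hg).2.2.2.2
        rw [avg, hi0, dims, h5]
        push_cast
        rfl
      rw [hs4, hs3, hs3]
      unfold avg
      rw [hi0]
      unfold dims
      rw [h3, ← Q.rt_sq]
      have hne := Q.rt_ne_zero
      have z1 : Q.rt ^ (-2 * (finrank Q.F (f'.1 (mid i)) + 1 : ℤ)) =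
          Q.rt ^ (-2 * (finrank Q.F (f'.1 (mid i)) : ℤ)) * (Q.rt ^ 2)⁻¹ := by
        rw [mul_add, zpow_add₀ hne]
        rfl
      have z2 : Q.rt ^ (-2 * ((finrank Q.F (f'.1 (mid i)) + 2 : ℕ) : ℤ)) =
          Q.rt ^ (-2 * (finrank Q.F (f'.1 (mid i)) : ℤ)) * (Q.rt ^ 4)⁻¹ := by
        push_cast
        rw [mul_add, zpow_add₀ hne]
        rfl
      rw [z1, z2]
      generalize Q.rt ^ (-2 * (finrank Q.F (f'.1 (mid i)) : ℤ)) = z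
      rw [smul_add, smul_add, smul_smul, smul_smul, smul_smul, smul_smul, smul_smul, smul_smul,
        smul_smul, add_comm]
      congr 2
      · field_simp
        ring
      · field_simp
    · have hempty : (Finset.univ.filter fun g => EStep i f g ∧ EStep i g f') = ∅ := by
        rw [Finset.filter_eq_empty_iff]
        rintro g - ⟨h1, h2⟩
        have h3 := h1.2.2
        have h4 := h2.2.2
        exact hT ⟨fun s hs => (h1.1 s hs).trans (h2.1 s hs), h2.2.1.trans h1.2.1, by omega⟩
      rw [hempty, Finset.sum_empty, Finset.sum_empty, Finset.sum_empty, smul_zero, smul_zero,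
        smul_zero, add_zero]
  · -- all the flags involved have the same first term
    have key : ∀ g ∈ Finset.univ.filter (fun g => EStep i f g ∧ EStep i g f'),
        avg g = avg f ∧ avg g = avg f' := by
      intro g hg
      obtain ⟨-, h1, h2⟩ := Finset.mem_filter.1 hg
      unfold avg dims
      rw [h1.1 _ hi0, h2.1 _ hi0]
      exact ⟨rfl, rfl⟩
    rw [Finset.sum_congr rfl fun g hg => (key g hg).1.symm,
      Finset.sum_congr rfl fun g hg => (key g hg).2.symm]
    module

lemma Egen_mul_Lgen_mul_Egen (i : Fin (n - 1)) :
    ((T 1 + T (-1) : Lau) • (Egen i * Lgen * Egen i) : ∀ Q, Conv n d Q) =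
      (T (-1) : Lau) • (Egen i ^ 2 * Lgen) + (T 1 : Lau) • (Lgen * Egen i ^ 2) := by
  have h1 : (Egen i ^ 2 : ∀ Q, Conv n d Q) = _ := (pow_two _).trans (Egen_mul_Egen i i)
  have h2 : (Egen i * Lgen * Egen i : ∀ Q, Conv n d Q) =
      (T (-wt (lo i) i) : Lau) • ((Efam i * (Lgen * Efam i)) *
        ((fpow fun δ => -gr δ (lo i)) * fpow fun δ => -gr δ (lo i))) := by
    unfold Egen
    rw [mul_assoc, ← mul_assoc Lgen]
    refine mul_mul_mul_of_comm ?_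
    rw [← mul_assoc, fpow_mul_Lgen, mul_assoc, fpow_neg_gr_mul_Efam, mul_smul_comm, mul_assoc]
  rw [h1, h2, smul_mul_assoc, mul_smul_comm, mul_assoc (Efam i * Efam i), fpow_mul, fpow_mul_Lgen,
    ← mul_assoc (Efam i * Efam i), ← mul_assoc Lgen, smul_comm _ (T (-wt (lo i) i) : Lau),
    smul_comm _ (T (-wt (lo i) i) : Lau), smul_comm _ (T (-wt (lo i) i) : Lau), ← smul_add,
    ← smul_mul_assoc, Efam_mul_Lgen_mul_Efam, add_mul, smul_mul_assoc, smul_mul_assoc]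

end Averages

end Relations

/-! ### The anti-automorphism exchanging raising and lowering operators -/

section Transposition

open Submodule Module LaurentPolynomial

variable {n d : ℕ}

/-- Entrywise transposition of the matrices over all finite fields. -/
def trfam (x : ∀ Q, Conv n d Q) : ∀ Q, Conv n d Q := fun Q => (x Q).transpose

lemma trfam_mul (x y : ∀ Q, Conv n d Q) : trfam (x * y) = trfam y * trfam x :=
  funext fun _ => Matrix.transpose_mul _ _

lemma trfam_smul (p : Lau) (x : ∀ Q, Conv n d Q) : trfam (p • x) = p • trfam x := rfl

lemma trfam_Efam (i : Fin (n - 1)) : trfam (Efam i : ∀ Q, Conv n d Q) = Ffam i :=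
  funext fun _ => sc_transpose _

lemma trfam_Ifam (s : Fin (n + 1)) : trfam (Ifam s : ∀ Q, Conv n d Q) = Ifam s :=
  funext fun _ => Ind_transpose s

lemma trfam_fpow (k : (Fin (n + 1) → ℕ) → ℤ) : trfam (fpow k : ∀ Q, Conv n d Q) = fpow k :=
  funext fun _ => (sc_transpose _).trans (by rw [Matrix.diagonal_transpose]; rfl)

/-- The exponent of the normalization of the transposition. -/
def twist (δ : Fin (n + 1) → ℕ) : ℤ := -∑ a : Fin n, gr δ a * δ a.succ

lemma twist_shift (i : Fin (n - 1)) (δ : Fin (n + 1) → ℕ) :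
    twist (shift i δ) = twist δ - gr δ (lo i) + gr (shift i δ) (hi i) := by
  have h : ∀ a : Fin n, gr (shift i δ) a * (shift i δ a.succ : ℤ) =
      gr δ a * δ a.succ + ((if a = lo i then gr δ a + δ a.succ + 1 else 0) -
        if a = hi i then (δ a.succ : ℤ) else 0) := by
    intro a
    have h1 : a.succ = mid i ↔ a = lo i := by
      rw [Fin.ext_iff, Fin.ext_iff, Fin.val_succ, val_mid, val_lo]
      omega
    rw [gr_shift, shift, Function.update_apply, if_congr h1 rfl rfl, wt]
    by_cases h2 : a = lo i
    · subst h2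
      rw [if_pos rfl, if_pos rfl, if_neg (DecMat.lo_ne_hi i), if_pos rfl,
        if_neg (DecMat.lo_ne_hi i), succ_lo]
      push_cast
      ring
    · rw [if_neg h2, if_neg h2, if_neg h2]
      split_ifs <;> ring
  unfold twist
  rw [Finset.sum_congr rfl fun a _ => h a, Finset.sum_add_distrib, Finset.sum_sub_distrib,
    Finset.sum_ite_eq' _ (lo i), Finset.sum_ite_eq' _ (hi i), if_pos (Finset.mem_univ _),
    if_pos (Finset.mem_univ _), gr_shift, wt_hi_self, succ_lo]
  unfold gr
  rw [castSucc_hi]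
  ring

/-- The anti-automorphism of the algebra of families that exchanges the images of `E_i` and `F_i`
and fixes the image of `L`: the transposition, conjugated by a power of `v` in each dimension. -/
def tau (x : ∀ Q, Conv n d Q) : ∀ Q, Conv n d Q := fpow twist * trfam x * fpow (-twist)

lemma tau_mul (x y : ∀ Q, Conv n d Q) : tau (x * y) = tau y * tau x := by
  unfold tau
  rw [trfam_mul, mul_assoc (fpow twist * trfam y), ← mul_assoc (fpow (-twist)),
    ← mul_assoc (fpow (-twist)), fpow_neg_mul, one_mul]
  simp only [mul_assoc]

lemma tau_add (x y : ∀ Q, Conv n d Q) : tau (x + y) = tau x + tau y := by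
  unfold tau
  rw [← add_mul, ← mul_add]
  rfl

lemma tau_smul (p : Lau) (x : ∀ Q, Conv n d Q) : tau (p • x) = p • tau x := by
  unfold tau
  rw [trfam_smul, mul_smul_comm, smul_mul_assoc]

lemma tau_Egen (i : Fin (n - 1)) : tau (Egen i : ∀ Q, Conv n d Q) = Fgen i := by
  have h (k : (Fin (n + 1) → ℕ) → ℤ) :
      (Ffam i * fpow k : ∀ Q, Conv n d Q) = (fpow fun δ => k (shift i δ)) * Ffam i :=
    Ffam_mul_fdiag _ _
  unfold tau Egen Fgen
  rw [trfam_mul, trfam_Efam, trfam_fpow, ← mul_assoc, mul_assoc, h, h, ← mul_assoc, fpow_mul,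
    fpow_mul]
  congr 2
  funext δ
  simp only [Pi.add_apply, Pi.neg_apply, twist_shift]
  ring

lemma tau_Lgen [NeZero n] : tau (Lgen : ∀ Q, Conv n d Q) = Lgen := by
  have h : trfam (Lgen : ∀ Q, Conv n d Q) = Lgen := by
    unfold Lgen
    rw [trfam_mul, trfam_fpow, trfam_Ifam]
    exact (fdiag_mul_Ifam _ _).symm
  unfold tau
  rw [h, fpow_mul_Lgen, mul_assoc, fpow_mul_neg, mul_one]

lemma Fgen_comm {i j : Fin (n - 1)} (h : (i : ℕ) + 1 < j ∨ (j : ℕ) + 1 < i) :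
    (Fgen i * Fgen j : ∀ Q, Conv n d Q) = Fgen j * Fgen i := by
  rw [← tau_Egen, ← tau_Egen, ← tau_mul, ← tau_mul, Egen_comm h]

lemma Fgen_serre {i j : Fin (n - 1)} (h : (i : ℕ) + 1 = j ∨ (j : ℕ) + 1 = i) :
    (Fgen i ^ 2 * Fgen j + Fgen j * Fgen i ^ 2 : ∀ Q, Conv n d Q) =
      (T 1 + T (-1) : Lau) • (Fgen i * Fgen j * Fgen i) := by
  have := congrArg tau (Egen_serre (d := d) h)
  rw [tau_add, tau_smul, tau_mul, tau_mul, tau_mul, tau_mul, pow_two, tau_mul, tau_Egen, tau_Egen,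
    ← mul_assoc (Fgen i)] at this
  rw [← this, pow_two, add_comm, mul_assoc]

lemma Fgen_mul_Lgen [NeZero n] (i : Fin (n - 1)) :
    (Fgen i * Lgen : ∀ Q, Conv n d Q) = Lgen * Fgen i * Lgen := by
  have := congrArg tau (Lgen_mul_Egen (d := d) i)
  rwa [tau_mul, tau_mul, tau_mul, tau_Egen, tau_Lgen, ← mul_assoc] at this

lemma Fgen_mul_Lgen_mul_Fgen [NeZero n] (i : Fin (n - 1)) :
    ((T 1 + T (-1) : Lau) • (Fgen i * Lgen * Fgen i) : ∀ Q, Conv n d Q) =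
      (T 1 : Lau) • (Fgen i ^ 2 * Lgen) + (T (-1) : Lau) • (Lgen * Fgen i ^ 2) := by
  have := congrArg tau (Egen_mul_Lgen_mul_Egen (d := d) i)
  rw [tau_add, tau_smul, tau_smul, tau_smul, tau_mul, tau_mul, tau_mul, tau_mul, pow_two, tau_mul,
    tau_Egen, tau_Lgen, ← mul_assoc (Fgen i)] at this
  rw [this, pow_two, add_comm]

end Transposition

/-! ### Scalar extension to the field of rational functions -/

section Scalars

open LaurentPolynomial

lemma algebraMap_T (k : ℤ) : algebraMap Lau Qv (T k) = v ^ k := by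
  change LaurentPolynomial.eval₂ _ _ (T k) = _
  rw [LaurentPolynomial.eval₂_T, Units.val_zpow_eq_zpow_val]
  rfl

lemma algebraMap_toLaurent (p : Polynomial ℤ) :
    algebraMap Lau Qv (Polynomial.toLaurent p) =
      algebraMap (Polynomial ℚ) Qv (p.map (Int.castRingHom ℚ)) := by
  change LaurentPolynomial.eval₂ _ _ (Polynomial.toLaurent p) = _
  rw [LaurentPolynomial.eval₂_toLaurent, Units.val_mk0, ← RatFunc.algebraMap_X,
    ← Polynomial.coe_mapRingHom]
  induction p using Polynomial.induction_on' with
  | add p q hp hq => rw [Polynomial.eval₂_add, hp, hq, map_add, map_add]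
  | monomial k a =>
    rw [Polynomial.eval₂_monomial, Polynomial.coe_mapRingHom, Polynomial.map_monomial,
      ← Polynomial.C_mul_X_pow_eq_monomial, map_mul, map_pow]
    congr 1
    simp

lemma algebraMap_ne_zero {p : Lau} (hp : p ≠ 0) : algebraMap Lau Qv p ≠ 0 := by
  obtain ⟨k, p', h⟩ := LaurentPolynomial.exists_T_pow p
  intro h0
  have h1 := algebraMap_toLaurent p'
  rw [h, map_mul, h0, zero_mul, eq_comm, map_eq_zero_iff _ (RatFunc.algebraMap_injective ℚ)] at h1
  have h2 : p' = 0 :=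
    Polynomial.map_injective _ Int.cast_injective (by rw [h1, Polynomial.map_zero])
  rw [h2, map_zero, eq_comm] at h
  have h3 := congrArg (· * (T (-(k : ℤ)) : Lau)) h
  simp only [mul_assoc, ← T_add, add_neg_cancel, T_zero, mul_one, zero_mul] at h3
  exact hp h3

lemma v_sub_inv_ne_zero : v - v⁻¹ ≠ 0 := by
  have h : (T 1 - T (-1) : Lau) ≠ 0 := by
    intro h
    have h1 := congrArg (fun p : Lau => p.coeff 1) (sub_eq_zero.1 h)
    simp [T_apply] at h1
  have := algebraMap_ne_zero h
  rwa [map_sub, algebraMap_T, algebraMap_T, zpow_one, zpow_neg_one] at this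

end Scalars

section Saturation

variable {R B : Type*} [CommRing R] [IsDomain R] [Ring B] [Algebra R B]

/-- The saturation of a subalgebra: the elements which have a nonzero multiple in it. -/
def saturation (A : Subalgebra R B) : Subalgebra R B where
  carrier := {x | ∃ p : R, p ≠ 0 ∧ p • x ∈ A}
  mul_mem' := by
    rintro x y ⟨p, hp, hx⟩ ⟨q, hq, hy⟩
    exact ⟨p * q, mul_ne_zero hp hq, by rw [← smul_mul_smul_comm]; exact mul_mem hx hy⟩
  add_mem' := by
    rintro x y ⟨p, hp, hx⟩ ⟨q, hq, hy⟩
    refine ⟨p * q, mul_ne_zero hp hq, ?_⟩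
    rw [smul_add, mul_smul p q y, mul_comm p, mul_smul]
    exact add_mem (A.smul_mem hx q) (A.smul_mem hy p)
  algebraMap_mem' r := ⟨1, one_ne_zero, by rw [one_smul]; exact A.algebraMap_mem r⟩

end Saturation

/-! ### The homomorphism -/

section Homomorphism

open LaurentPolynomial

variable {n d : ℕ}

lemma one_tmul_smul (p : Lau) (x : MS n d) :
    (1 : Qv) ⊗ₜ[Lau] (p • x) = algebraMap Lau Qv p • ((1 : Qv) ⊗ₜ[Lau] x) := by
  rw [algebraMap_smul, TensorProduct.tmul_smul]

lemma one_tmul_add (x y : MS n d) :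
    (1 : Qv) ⊗ₜ[Lau] (x + y) = (1 : Qv) ⊗ₜ[Lau] x + (1 : Qv) ⊗ₜ[Lau] y :=
  TensorProduct.tmul_add _ _ _

lemma one_tmul_sub (x y : MS n d) :
    (1 : Qv) ⊗ₜ[Lau] (x - y) = (1 : Qv) ⊗ₜ[Lau] x - (1 : Qv) ⊗ₜ[Lau] y :=
  TensorProduct.tmul_sub _ _ _

lemma one_tmul_mul (x y : MS n d) :
    (1 : Qv) ⊗ₜ[Lau] (x * y) = ((1 : Qv) ⊗ₜ[Lau] x) * ((1 : Qv) ⊗ₜ[Lau] y) := by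
  rw [Algebra.TensorProduct.tmul_mul_tmul, one_mul]

variable [NeZero n]

lemma coe_E_eq (i : Fin (n - 1)) : ((MS.E i : MS n d) : ∀ Q, Conv n d Q) = Egen i := coe_E i

lemma coe_F_eq (i : Fin (n - 1)) : ((MS.F i : MS n d) : ∀ Q, Conv n d Q) = Fgen i := coe_F i

lemma coe_H_eq (a : Fin n) : ((MS.H a : MS n d) : ∀ Q, Conv n d Q) = Hgen a := coe_H a

lemma coe_Hinv_eq (a : Fin n) : ((MS.Hinv a : MS n d) : ∀ Q, Conv n d Q) = Hinvgen a := coe_Hinv a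

lemma coe_L_eq : ((MS.L : MS n d) : ∀ Q, Conv n d Q) = Lgen := coe_L

/-- The images of the generators. -/
def img : Gen n → MS n d
  | .E i => MS.E i
  | .F i => MS.F i
  | .H a => MS.H a
  | .Hinv a => MS.Hinv a
  | .L => MS.L

/-- The homomorphism from the free algebra. -/
def freeHom (n d : ℕ) [NeZero n] : FreeGen n →ₐ[Qv] Qv ⊗[Lau] MS n d :=
  FreeAlgebra.lift Qv fun g => 1 ⊗ₜ[Lau] img g

lemma freeHom_gen (g : Gen n) : freeHom n d (gen g) = 1 ⊗ₜ[Lau] (img g : MS n d) :=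
  FreeAlgebra.lift_ι_apply _ _

lemma v_eq_algebraMap : v = algebraMap Lau Qv (T 1) := by rw [algebraMap_T, zpow_one]

lemma v_inv_eq_algebraMap : v⁻¹ = algebraMap Lau Qv (T (-1)) := by
  rw [algebraMap_T, zpow_neg_one]

lemma freeHom_serre {a b : Gen n}
    (h : (img a ^ 2 * img b + img b * img a ^ 2 : MS n d) =
      (T 1 + T (-1) : Lau) • (img a * img b * img a)) :
    freeHom n d (gen a ^ 2 * gen b + gen b * gen a ^ 2) =
      freeHom n d ((v + v⁻¹) • (gen a * gen b * gen a)) := by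
  rw [map_add, map_mul, map_mul, map_pow, map_smul, map_mul, map_mul, freeHom_gen, freeHom_gen,
    pow_two, ← one_tmul_mul, ← one_tmul_mul, ← one_tmul_mul, ← one_tmul_mul, ← one_tmul_mul,
    ← one_tmul_add, v_inv_eq_algebraMap, v_eq_algebraMap, ← map_add, ← one_tmul_smul, ← pow_two, h]

lemma freeHom_comm {a b : Gen n} (h : (img a * img b : MS n d) = img b * img a) :
    freeHom n d (gen a * gen b) = freeHom n d (gen b * gen a) := by
  rw [map_mul, map_mul, freeHom_gen, freeHom_gen, ← one_tmul_mul, ← one_tmul_mul, h]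

lemma freeHom_weight {a b : Gen n} {k : ℤ}
    (h : (img a * img b : MS n d) = (T k : Lau) • (img b * img a)) :
    freeHom n d (gen a * gen b) = freeHom n d ((v ^ k) • (gen b * gen a)) := by
  rw [map_mul, map_smul, map_mul, freeHom_gen, freeHom_gen, ← one_tmul_mul, ← one_tmul_mul,
    ← algebraMap_T, ← one_tmul_smul, h]

lemma freeHom_one {a b : Gen n} (h : (img a * img b : MS n d) = 1) :
    freeHom n d (gen a * gen b) = freeHom n d 1 := by
  rw [map_mul, freeHom_gen, freeHom_gen, ← one_tmul_mul, h, map_one,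
    Algebra.TensorProduct.one_def]

lemma freeHom_cubic {a b : Gen n} {k l : ℤ}
    (h : ((T 1 + T (-1) : Lau) • (img a * img b * img a) : MS n d) =
      (T k : Lau) • (img a ^ 2 * img b) + (T l : Lau) • (img b * img a ^ 2)) :
    freeHom n d ((v + v⁻¹) • (gen a * gen b * gen a)) =
      freeHom n d (v ^ k • (gen a ^ 2 * gen b) + v ^ l • (gen b * gen a ^ 2)) := by
  rw [map_smul, map_add, map_smul, map_smul, map_mul, map_mul, map_mul, map_mul, map_pow,
    freeHom_gen, freeHom_gen, pow_two, ← one_tmul_mul, ← one_tmul_mul, ← one_tmul_mul,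
    ← one_tmul_mul, ← one_tmul_mul, ← algebraMap_T, ← algebraMap_T, v_inv_eq_algebraMap,
    v_eq_algebraMap, ← map_add, ← one_tmul_smul, ← one_tmul_smul, ← one_tmul_smul, ← one_tmul_add,
    ← pow_two, h]

lemma freeHom_E_F (i j : Fin (n - 1)) :
    freeHom n d (gen (.E i) * gen (.F j) - gen (.F j) * gen (.E i)) =
      freeHom n d (if i = j then
          (v - v⁻¹)⁻¹ • (gen (.H (lo i)) * gen (.Hinv (hi i)) -
            gen (.Hinv (lo i)) * gen (.H (hi i)))
        else 0) := by
  have h1 : freeHom n d (gen (.E i) * gen (.F j) - gen (.F j) * gen (.E i)) =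
      1 ⊗ₜ[Lau] (MS.E i * MS.F j - MS.F j * MS.E i : MS n d) := by
    rw [map_sub, map_mul, map_mul, freeHom_gen, freeHom_gen, ← one_tmul_mul, ← one_tmul_mul,
      ← one_tmul_sub]
    rfl
  rw [h1]
  split_ifs with h
  · subst h
    rw [map_smul, eq_inv_smul_iff₀ v_sub_inv_ne_zero, v_inv_eq_algebraMap, v_eq_algebraMap,
      ← map_sub, ← one_tmul_smul, map_sub, map_mul, map_mul, freeHom_gen, freeHom_gen,
      freeHom_gen, freeHom_gen, ← one_tmul_mul, ← one_tmul_mul, ← one_tmul_sub]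
    congr 1
    refine Subtype.ext ?_
    have := Egen_mul_Fgen_sub (d := d) i
    rw [← coe_H_eq, ← coe_H_eq, ← coe_Hinv_eq, ← coe_Hinv_eq, ← coe_E_eq, ← coe_F_eq] at this
    exact this
  · have h2 : (MS.E i * MS.F j - MS.F j * MS.E i : MS n d) = 0 := by
      refine Subtype.ext ?_
      have := sub_eq_zero.2 (Egen_mul_Fgen_comm (d := d) h)
      rw [← coe_E_eq, ← coe_F_eq] at this
      exact this
    rw [h2, TensorProduct.tmul_zero, map_zero]

/-- The homomorphism from the free algebra respects the defining relations. -/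
lemma freeHom_rel {x y : FreeGen n} (h : Rel n x y) : freeHom n d x = freeHom n d y := by
  cases h with
  | H_mul_Hinv a =>
    refine freeHom_one (Subtype.ext ?_)
    exact (congrArg₂ _ (coe_H_eq a) (coe_Hinv_eq a)).trans (Hgen_mul_Hinvgen a)
  | Hinv_mul_H a =>
    refine freeHom_one (Subtype.ext ?_)
    exact (congrArg₂ _ (coe_Hinv_eq a) (coe_H_eq a)).trans (Hinvgen_mul_Hgen a)
  | E_F i j => exact freeHom_E_F i j
  | H_comm a b =>
    refine freeHom_comm (Subtype.ext ?_)
    have := Hgen_comm (d := d) a b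
    rw [← coe_H_eq, ← coe_H_eq] at this
    exact this
  | H_L a =>
    refine freeHom_comm (Subtype.ext ?_)
    have := Hgen_mul_Lgen (d := d) a
    rw [← coe_H_eq, ← coe_L_eq] at this
    exact this
  | E_comm i j h =>
    refine freeHom_comm (Subtype.ext ?_)
    have := Egen_comm (d := d) h
    rw [← coe_E_eq, ← coe_E_eq] at this
    exact this
  | F_comm i j h =>
    refine freeHom_comm (Subtype.ext ?_)
    have := Fgen_comm (d := d) h
    rw [← coe_F_eq, ← coe_F_eq] at this
    exact this
  | H_E a i =>
    refine freeHom_weight (Subtype.ext ?_)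
    have := Hgen_mul_Egen (d := d) a i
    rw [← coe_H_eq, ← coe_E_eq] at this
    exact this
  | H_F a i =>
    refine freeHom_weight (Subtype.ext ?_)
    have := Hgen_mul_Fgen (d := d) a i
    rw [← coe_H_eq, ← coe_F_eq] at this
    exact this
  | E_serre i j h =>
    refine freeHom_serre (Subtype.ext ?_)
    have := Egen_serre (d := d) h
    rw [← coe_E_eq, ← coe_E_eq] at this
    exact this
  | F_serre i j h =>
    refine freeHom_serre (Subtype.ext ?_)
    have := Fgen_serre (d := d) h
    rw [← coe_F_eq, ← coe_F_eq] at this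
    exact this
  | L_sq =>
    have h1 : (MS.L * MS.L : MS n d) = MS.L := by
      refine Subtype.ext ?_
      have := Lgen_sq (n := n) (d := d)
      rw [pow_two, ← coe_L_eq] at this
      exact this
    rw [map_pow, freeHom_gen, pow_two, ← one_tmul_mul]
    exact congrArg _ h1
  | L_E i =>
    have h1 : (MS.L * MS.E i : MS n d) = MS.L * MS.E i * MS.L := by
      refine Subtype.ext ?_
      have := Lgen_mul_Egen (d := d) i
      rw [← coe_L_eq, ← coe_E_eq] at this
      exact this
    rw [map_mul, map_mul, map_mul, freeHom_gen, freeHom_gen, ← one_tmul_mul, ← one_tmul_mul]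
    exact congrArg _ h1
  | F_L i =>
    have h1 : (MS.F i * MS.L : MS n d) = MS.L * MS.F i * MS.L := by
      refine Subtype.ext ?_
      have := Fgen_mul_Lgen (d := d) i
      rw [← coe_L_eq, ← coe_F_eq] at this
      exact this
    rw [map_mul, map_mul, map_mul, freeHom_gen, freeHom_gen, ← one_tmul_mul, ← one_tmul_mul,
      ← one_tmul_mul]
    exact congrArg _ h1
  | E_L_E i =>
    have h1 := Egen_mul_Lgen_mul_Egen (d := d) i
    rw [← coe_L_eq, ← coe_E_eq] at h1
    have h2 := freeHom_cubic (a := .E i) (b := .L) (k := -1) (l := 1) (d := d) (Subtype.ext h1)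
    rwa [zpow_neg_one, zpow_one] at h2
  | F_L_F i =>
    have h1 := Fgen_mul_Lgen_mul_Fgen (d := d) i
    rw [← coe_L_eq, ← coe_F_eq] at h1
    have h2 := freeHom_cubic (a := .F i) (b := .L) (k := 1) (l := -1) (d := d) (Subtype.ext h1)
    rwa [zpow_neg_one, zpow_one] at h2

/-- The homomorphism from the mirabolic quantum group. -/
def hom (n d : ℕ) [NeZero n] : MU n →ₐ[Qv] Qv ⊗[Lau] MS n d :=
  RingQuot.liftAlgHom Qv ⟨freeHom n d, fun _ _ h => freeHom_rel h⟩

lemma hom_of (g : Gen n) : hom n d (MU.of g) = 1 ⊗ₜ[Lau] (img g : MS n d) :=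
  (RingQuot.liftAlgHom_mkAlgHom_apply Qv _ _ _).trans (freeHom_gen g)

/-- The elements of the integral form whose images lie in the range of the homomorphism. -/
def integralRange (n d : ℕ) [NeZero n] : Subalgebra Lau (MS n d) :=
  ((hom n d).range.restrictScalars Lau).comap Algebra.TensorProduct.includeRight

lemma mem_integralRange {x : MS n d} :
    x ∈ integralRange n d ↔ (1 : Qv) ⊗ₜ[Lau] x ∈ (hom n d).range := Iff.rfl

lemma img_mem_integralRange (g : Gen n) : (img g : MS n d) ∈ integralRange n d :=
  ⟨MU.of g, hom_of g⟩

lemma char_mem_integralRange (X : DecMat n d) : MS.char X ∈ integralRange n d := by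
  have hmem (g : Gen n) : ((img g : MS n d) : ∀ Q, Conv n d Q) ∈
      saturation ((integralRange n d).map (MS n d).val) :=
    ⟨1, one_ne_zero, by rw [one_smul]; exact ⟨_, img_mem_integralRange g, rfl⟩⟩
  obtain ⟨p, hp, x, hx, hpx⟩ := e_mem_of_generators
    (A := saturation ((integralRange n d).map (MS n d).val))
    (fun p x hp ⟨q, hq, hx⟩ => ⟨q * p, mul_ne_zero hq hp, by rwa [mul_smul]⟩)
    (fun i => hmem (.E i)) (fun i => hmem (.F i)) (fun a => hmem (.H a)) (hmem .L) X
  have h : x = p • MS.char X := Subtype.ext hpx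
  subst h
  have h1 : (1 : Qv) ⊗ₜ[Lau] (p • MS.char X) ∈ (hom n d).range := hx
  rw [one_tmul_smul] at h1
  have h2 := (hom n d).range.smul_mem h1 (algebraMap Lau Qv p)⁻¹
  rwa [inv_smul_smul₀ (algebraMap_ne_zero hp)] at h2

lemma integralRange_eq_top : integralRange n d = ⊤ := by
  rw [eq_top_iff]
  rintro x -
  have h : MS n d ≤ (integralRange n d).map (MS n d).val :=
    Algebra.adjoin_le fun _ ⟨X, hX⟩ => ⟨_, char_mem_integralRange X, hX⟩
  obtain ⟨y, hy, hxy⟩ := h x.2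
  rwa [← (Subtype.ext hxy : y = x)]

lemma hom_surjective : Function.Surjective (hom n d) := by
  intro x
  induction x using TensorProduct.induction_on with
  | zero => exact ⟨0, map_zero _⟩
  | tmul q x =>
    have h : x ∈ integralRange n d := by
      rw [integralRange_eq_top]
      exact Algebra.mem_top
    obtain ⟨y, hy⟩ := (mem_integralRange.1 h : _)
    refine ⟨q • y, ?_⟩
    rw [map_smul]
    refine (congrArg (q • ·) hy).trans ?_
    rw [TensorProduct.smul_tmul', smul_eq_mul, mul_one]
  | add x y hx hy =>
    obtain ⟨x, rfl⟩ := hx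
    obtain ⟨y, rfl⟩ := hy
    exact ⟨x + y, map_add _ _ _⟩

end Homomorphism

end Mirabolic

end

open Mirabolic in
theorem proposition4p2p6 (n d : ℕ) [NeZero n] (hd : 0 < d) :
    ∃ φ : MU n →ₐ[Qv] Qv ⊗[Lau] MS n d,
      Function.Surjective φ ∧
      (∀ i : Fin (n - 1), φ (MU.of (Gen.E i)) = 1 ⊗ₜ[Lau] (MS.E i : MS n d)) ∧
      (∀ i : Fin (n - 1), φ (MU.of (Gen.F i)) = 1 ⊗ₜ[Lau] (MS.F i : MS n d)) ∧
      (∀ a : Fin n, φ (MU.of (Gen.H a)) = 1 ⊗ₜ[Lau] (MS.H a : MS n d)) ∧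
      (∀ a : Fin n, φ (MU.of (Gen.Hinv a)) = 1 ⊗ₜ[Lau] (MS.Hinv a : MS n d)) ∧
      φ (MU.of Gen.L) = 1 ⊗ₜ[Lau] (MS.L : MS n d) :=
  ⟨hom n d, hom_surjective, fun i => hom_of (.E i), fun i => hom_of (.F i), fun a => hom_of (.H a),
    fun a => hom_of (.Hinv a), hom_of .L⟩
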